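/- Let $\mathfrak{sl}_3$ be the Lie algebra of traceless complex $3\times 3$ matrices, with matrix units $E_{ij}$ and $e_1=E_{12}$, $e_2=E_{23}$, $e_{12}=[e_1,e_2]$, $f_1=E_{21}$, $f_2=E_{32}$, $f_{12}=-[f_1,f_2]$, simple coroots $h_1,h_2$, diagonal Cartan subalgebra $\mathfrak t$, simple roots $\alpha_1,\alpha_2$, $\rho=\alpha_1+\alpha_2$, Borel subalgebra $\mathfrak b=\mathfrak t\oplus\mathbb C e_1\oplus\mathbb C e_2\oplus\mathbb C e_{12}$ and $\mathfrak p_1=\mathbb C f_1\oplus\mathfrak b$. Let $\mu_1\in\mathbb C$ and $\mu_2\in\mathbb Z$ with $\mu_1+\mu_2\notin\mathbb Z$, and put $\bar k=k-\mu_1$, $\bar l=l-\mu_2$. *The module $M$.* Let $O=X_{w_\circ}\cap s_1X_{w_\circ}\cap s_2X_{w_\circ}\subset \mathrm{SL}_3/B$, where $X_{w_\circ}=Bw_\circ B/B$, with coordinates $(x,y,z)\in\mathbb G_m^2\times\mathbb A^1$ given by $(x,y,z)\mapsto e^{xe_1}e^{ye_2}e^{ze_{12}}w_\circ B$. Let $M=M_{\mu_1,\mu_2}$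 be the space of global sections of the rank one local system on $O$ with generator $1$ satisfying $(x\partial_x+\mu_1)1=(y\partial_y+\mu_2)1=\partial_z1=0$. The Lie algebra $\mathfrak{sl}_3$ acts on $M$ through the vector fields of infinitesimal left translations, $(Xf)(p)=\frac{d}{dt}\big|_{t=0}f(e^{-tX}p)$. With $u_{k,l,m}=x^ky^lz^m\cdot 1$ ($k,l\in\mathbb Z$, $m\in\mathbb Z_{\ge0}$) and the raising factorial $a^{(n)}=a(a+1)\cdots(a+n-1)$ put $$w_{k,l,m}=\sum_{n=0}^m\binom mn\frac{\bar l^{(n)}}{(\bar k+\bar l)^{(n)}}\,u_{k+n,l+n,m-n}.$$ If $J\subseteq\mathbb Z^2\times\mathbb Z_{\ge0}$ satisfies $J=J'\setminus J''$ with $J''\subseteq J'$ such that $\bigoplus_{J'}\mathbb C w_{k,l,m}$ and $\bigoplus_{J''}\mathbb C w_{k,l,m}$ are $\mathfrak{sl}_3$-submodules of $M$, then $M_J$ denotes the quotient of the former by the latter. A condition on $\bar l$ as a subscript stands for the set of all $(k,l,m)$ satisfying it. *Duals.* For an $\mathfrak{sl}_3$-module $N$ which is the direct sum of its simultaneous $(h_1,h_2,f_{12}e_{12})$-eigenspaces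 $N_\chi$, all of them finite dimensional, let $N^\vee=\bigoplus_\chi\mathrm{Hom}_{\mathbb C}(N_\chi,\mathbb C)$ with action $(X\eta)(v)=-\eta(\tau(X)v)$, where $\tau$ is the involution of $\mathfrak{sl}_3$ with $h_i\mapsto-h_i$, $e_1\leftrightarrow f_1$, $e_2\leftrightarrow f_2$, $e_{12}\leftrightarrow -f_{12}$. *Relaxed Verma modules.* For $\lambda\in\mathfrak t^*$ and $\mu\in\mathbb C$ let $\mathcal R_{\mathfrak p_1,\lambda,\mu}=U(\mathfrak{sl}_3)\otimes_{U(\mathfrak p_1)}V_{\lambda,\mu}$, where $V_{\lambda,\mu}$ is the $\mathfrak p_1$-module generated by one vector $v$ with defining relations $hv=(\lambda+\mu\alpha_1)(h)v$ for $h\in\mathfrak t$, $f_1e_1v=-(\mu+1)(\mu+\lambda(h_1))v$, $e_2v=e_{12}v=0$. Let $L_{\mathfrak p_1,\lambda,\mu}$ be the quotient of $\mathcal R_{\mathfrak p_1,\lambda,\mu}$ by the sum of all its proper submodules, i.e. its unique simple quotient. **Proposition.** The $w_{k,l,m}$ form a basis of $M$. The subquotients $M_{\bar l\ge0}$ and $M_{\bar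 l=0}$ (submodules of $M$), $M_{\bar l\ge1}$ (which is both $M/M_{\bar l\le0}$ and $M_{\bar l\ge0}/M_{\bar l=0}$), $M_{\bar l\ge2}=M/M_{\bar l\le1}$ and $M_{\bar l=1}=M_{\bar l\in\{0,1\}}/M_{\bar l=0}$ are defined. The modules $\mathcal R_{\mathfrak p_1,\lambda,\mu_1}$ for $\lambda\in\{0,-\rho,-2\alpha_2\}$ and $L_{\mathfrak p_1,\lambda,\mu_1}$ for $\lambda\in\{0,-\rho\}$ are direct sums of finite dimensional simultaneous $(h_1,h_2,f_{12}e_{12})$-eigenspaces, so that their duals are defined. The modules $L_{\mathfrak p_1,\lambda,\mu_1}$ for $\lambda\in\{0,-\rho,-2\alpha_2\}$ are simple. Moreover, as $\mathfrak{sl}_3$-modules and for every realization of the subquotients in question: 1. $M_{\bar l\ge0}\cong\mathcal R^\vee_{\mathfrak p_1,0,\mu_1}$. 2. $M_{\bar l\ge1}\cong\mathcal R^\vee_{\mathfrak p_1,-\rho,\mu_1}$. 3. $M_{\bar l\ge2}\cong\mathcal R_{\mathfrak p_1,-2\alpha_2,\mu_1}=L_{\mathfrak p_1,-2\alpha_2,\mu_1}$;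 this module is simple, and $\mathcal R_{\mathfrak p_1,-2\alpha_2,\mu_1}\cong\mathcal R^\vee_{\mathfrak p_1,-2\alpha_2,\mu_1}$. 4. $M_{\bar l=0}\cong L_{\mathfrak p_1,0,\mu_1}$; there is an injective homomorphism $\mathcal R_{\mathfrak p_1,-\rho,\mu_1}\to\mathcal R_{\mathfrak p_1,0,\mu_1}$ whose image is the kernel of $\mathcal R_{\mathfrak p_1,0,\mu_1}\to L_{\mathfrak p_1,0,\mu_1}$, so that $L_{\mathfrak p_1,0,\mu_1}=\mathcal R_{\mathfrak p_1,0,\mu_1}/\mathcal R_{\mathfrak p_1,-\rho,\mu_1}$; and $L_{\mathfrak p_1,0,\mu_1}\cong L^\vee_{\mathfrak p_1,0,\mu_1}$. 5. $M_{\bar l=1}\cong L_{\mathfrak p_1,-\rho,\mu_1}$; there is an injective homomorphism $\mathcal R_{\mathfrak p_1,-2\alpha_2,\mu_1}\to\mathcal R_{\mathfrak p_1,-\rho,\mu_1}$ whose image is the kernel of $\mathcal R_{\mathfrak p_1,-\rho,\mu_1}\to L_{\mathfrak p_1,-\rho,\mu_1}$, so that $L_{\mathfrak p_1,-\rho,\mu_1}=\mathcal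 R_{\mathfrak p_1,-\rho,\mu_1}/\mathcal R_{\mathfrak p_1,-2\alpha_2,\mu_1}$; and $L_{\mathfrak p_1,-\rho,\mu_1}\cong L^\vee_{\mathfrak p_1,-\rho,\mu_1}$. -/

import Mathlib

noncomputable section

namespace RelaxedSL3

open scoped TensorProduct

/-! ### The Lie algebra `𝔰𝔩₃` -/

/-- The Lie algebra `𝔰𝔩₃(ℂ)` of traceless `3 × 3` matrices. -/
abbrev sl3 := LieAlgebra.SpecialLinear.sl (Fin 3) ℂ

/-- The root vector of `α₁`. -/
def e1 : sl3 := LieAlgebra.SpecialLinear.single 0 1 (by decide) 1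
/-- The root vector of `α₂`. -/
def e2 : sl3 := LieAlgebra.SpecialLinear.single 1 2 (by decide) 1
/-- The root vector of `-α₁`. -/
def f1 : sl3 := LieAlgebra.SpecialLinear.single 1 0 (by decide) 1
/-- The root vector of `-α₂`. -/
def f2 : sl3 := LieAlgebra.SpecialLinear.single 2 1 (by decide) 1
/-- The root vector `e₁₂ = [e₁, e₂]` of `α₁ + α₂`. -/
def e12 : sl3 := ⁅e1, e2⁆
/-- The root vector `f₁₂ = -[f₁, f₂]` of `-α₁ - α₂`. -/
def f12 : sl3 := -⁅f1, f2⁆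
/-- The simple coroot `h₁ = diag(1, -1, 0)`. -/
def h1 : sl3 := LieAlgebra.SpecialLinear.singleSubSingle 0 1 1
/-- The simple coroot `h₂ = diag(0, 1, -1)`. -/
def h2 : sl3 := LieAlgebra.SpecialLinear.singleSubSingle 1 2 1

/-- The Cartan subalgebra `𝔱` of traceless diagonal matrices. -/
def cartan : Submodule ℂ sl3 where
  carrier := {X | ∀ i j, i ≠ j → X.1 i j = 0}
  add_mem' {X Y} hX hY i j hij := by simp [hX i j hij, hY i j hij]
  zero_mem' i j _ := by simp
  smul_mem' c X hX i j hij := by simp [hX i j hij]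

/-- The simple root `α₁ ∈ 𝔱*`. -/
def alpha1 : Module.Dual ℂ cartan where
  toFun h := h.1.1 0 0 - h.1.1 1 1
  map_add' a b := by simp; ring
  map_smul' c a := by simp; ring

/-- The simple root `α₂ ∈ 𝔱*`. -/
def alpha2 : Module.Dual ℂ cartan where
  toFun h := h.1.1 1 1 - h.1.1 2 2
  map_add' a b := by simp; ring
  map_smul' c a := by simp; ring

/-- The Weyl vector `ρ = α₁ + α₂`. -/
def rho : Module.Dual ℂ cartan := alpha1 + alpha2

theorem h1_mem_cartan : h1 ∈ cartan := by
  intro i j hij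
  simp only [h1, LieAlgebra.SpecialLinear.val_singleSubSingle, Matrix.sub_apply]
  fin_cases i <;> fin_cases j <;> simp_all

/-! ### The coordinate ring of `O` and the infinitesimal left translations -/

/-- The coordinate ring `ℂ[x^{±1}, y^{±1}, z]` of
`O = X_{w₀} ∩ s₁ X_{w₀} ∩ s₂ X_{w₀} ≅ 𝔾ₘ² × 𝔸¹`, where `x = x_{α₁}`, `y = x_{α₂}`,
`z = x_{α₁+α₂}`, as the monoid algebra of `ℤ × ℤ × ℕ`. -/
abbrev Coord := AddMonoidAlgebra ℂ (ℤ × ℤ × ℕ)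

/-- The monomial `x^k y^l z^m`. -/
def mono (k l : ℤ) (m : ℕ) : Coord := AddMonoidAlgebra.single (k, l, m) 1

/-- The linear map determined by its values on the monomials `x^k y^l z^m`. -/
def linOfMono (φ : ℤ → ℤ → ℕ → Coord) : Coord →ₗ[ℂ] Coord :=
  (Finsupp.lift Coord ℂ (ℤ × ℤ × ℕ) fun p => φ p.1 p.2.1 p.2.2) ∘ₗ
    (AddMonoidAlgebra.coeffLinearEquiv ℂ).toLinearMap

/-- `∂_x`. -/
def dX : Coord →ₗ[ℂ] Coord := linOfMono fun k l m => (k : ℂ) • mono (k - 1) l m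
/-- `∂_y`. -/
def dY : Coord →ₗ[ℂ] Coord := linOfMono fun k l m => (l : ℂ) • mono k (l - 1) m
/-- `∂_z`. -/
def dZ : Coord →ₗ[ℂ] Coord := linOfMono fun k l m => (m : ℂ) • mono k l (m - 1)

theorem linOfMono_mono (φ : ℤ → ℤ → ℕ → Coord) (k l : ℤ) (m : ℕ) :
    linOfMono φ (mono k l m) = φ k l m := by
  simp [linOfMono, mono]

theorem mono_mul (k l k' l' : ℤ) (m m' : ℕ) :
    mono k l m * mono k' l' m' = mono (k + k') (l + l') (m + m') := by
  simp [mono, AddMonoidAlgebra.single_mul_single]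

theorem mono_induction {P : Coord → Prop} (p : Coord) (zero : P 0)
    (add : ∀ p q, P p → P q → P (p + q)) (smul : ∀ (c : ℂ) p, P p → P (c • p))
    (mono : ∀ k l m, P (mono k l m)) : P p := by
  induction p using AddMonoidAlgebra.induction_linear with
  | zero => exact zero
  | add p q hp hq => exact add p q hp hq
  | single g c =>
    have := smul c _ (mono g.1 g.2.1 g.2.2)
    simpa [RelaxedSL3.mono] using this

theorem leibniz_of_mono (D : Coord →ₗ[ℂ] Coord)
    (h : ∀ k l m k' l' m', D (mono k l m * mono k' l' m') =
      mono k l m * D (mono k' l' m') + mono k' l' m' * D (mono k l m)) (p q : Coord) :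
    D (p * q) = p * D q + q * D p := by
  induction p using mono_induction with
  | zero => simp
  | add p p' hp hp' => simp only [add_mul, mul_add, map_add, hp, hp']; ring
  | smul c p hp => simp only [smul_mul_assoc, map_smul, hp, mul_smul_comm, smul_add]
  | mono k l m =>
    induction q using mono_induction with
    | zero => simp
    | add p p' hp hp' => simp only [add_mul, mul_add, map_add, hp, hp']; ring
    | smul c p hp => simp only [smul_mul_assoc, map_smul, hp, mul_smul_comm, smul_add]
    | mono k' l' m' => exact h k l m k' l' m'

theorem dX_mul (p q : Coord) : dX (p * q) = p * dX q + q * dX p := by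
  refine leibniz_of_mono _ (fun k l m k' l' m' => ?_) p q
  simp only [dX, mono_mul, linOfMono_mono, mul_smul_comm]
  rw [show k' + (k - 1) = k + k' - 1 by ring, show k + (k' - 1) = k + k' - 1 by ring,
    add_comm l' l, add_comm m' m, ← add_smul]
  push_cast
  rw [add_comm (k : ℂ)]

theorem dY_mul (p q : Coord) : dY (p * q) = p * dY q + q * dY p := by
  refine leibniz_of_mono _ (fun k l m k' l' m' => ?_) p q
  simp only [dY, mono_mul, linOfMono_mono, mul_smul_comm]
  rw [show l' + (l - 1) = l + l' - 1 by ring, show l + (l' - 1) = l + l' - 1 by ring,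
    add_comm k' k, add_comm m' m, ← add_smul]
  push_cast
  rw [add_comm (l : ℂ)]

theorem dZ_mul (p q : Coord) : dZ (p * q) = p * dZ q + q * dZ p := by
  refine leibniz_of_mono _ (fun k l m k' l' m' => ?_) p q
  simp only [dZ, mono_mul, linOfMono_mono, mul_smul_comm]
  rw [add_comm k' k, add_comm l' l]
  rcases m with _ | m <;> rcases m' with _ | m'
  · simp
  · simp
  · simp
  · rw [show m + 1 + (m' + 1) - 1 = m + m' + 1 by omega,
      show m + 1 + (m' + 1 - 1) = m + m' + 1 by omega,
      show m' + 1 + (m + 1 - 1) = m + m' + 1 by omega, ← add_smul]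
    push_cast
    congr 1
    ring

theorem dX_dY (p : Coord) : dX (dY p) = dY (dX p) := by
  induction p using mono_induction with
  | zero => simp
  | add p p' hp hp' => simp only [map_add, hp, hp']
  | smul c p hp => simp only [map_smul, hp]
  | mono k l m => simp only [dX, dY, linOfMono_mono, map_smul, smul_smul, mul_comm]

theorem dX_dZ (p : Coord) : dX (dZ p) = dZ (dX p) := by
  induction p using mono_induction with
  | zero => simp
  | add p p' hp hp' => simp only [map_add, hp, hp']
  | smul c p hp => simp only [map_smul, hp]
  | mono k l m => simp only [dX, dZ, linOfMono_mono, map_smul, smul_smul, mul_comm]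

theorem dY_dZ (p : Coord) : dY (dZ p) = dZ (dY p) := by
  induction p using mono_induction with
  | zero => simp
  | add p p' hp hp' => simp only [map_add, hp, hp']
  | smul c p hp => simp only [map_smul, hp]
  | mono k l m => simp only [dY, dZ, linOfMono_mono, map_smul, smul_smul, mul_comm]

/-- The coordinate function `x` on `O`. -/
def cx : Coord := mono 1 0 0
/-- The coordinate function `y` on `O`. -/
def cy : Coord := mono 0 1 0
/-- The coordinate function `z` on `O`. -/
def cz : Coord := mono 0 0 1

/-- The universal point `exp(x e₁) exp(y e₂) exp(z e₁₂)` of the chart `U → U w₀ B / B`. -/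
def chart : Matrix (Fin 3) (Fin 3) Coord :=
  Matrix.transvection 0 1 cx * Matrix.transvection 1 2 cy * Matrix.transvection 0 2 cz

/-- The inverse matrix of `chart`. -/
def chartInv : Matrix (Fin 3) (Fin 3) Coord :=
  Matrix.transvection 0 2 (-cz) * Matrix.transvection 1 2 (-cy) * Matrix.transvection 0 1 (-cx)

/-- `N⁻¹ X N` for `N = chart`. -/
def conj (X : sl3) : Matrix (Fin 3) (Fin 3) Coord :=
  chartInv * X.1.map (algebraMap ℂ Coord) * chart

/-- The components `(ξ x, ξ y, ξ z)` of the vector field `ξ = a(X)` by which `X ∈ 𝔰𝔩₃` acts on `O`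
through infinitesimal left translations, i.e. `(ξ f)(p) = d/dt f(exp(-tX) p)` at `t = 0`. With
`N = chart` this means that `ξ(N) = -X N + N β` for some lower triangular matrix `β`
(as `w₀ 𝔟 w₀⁻¹` consists of the lower triangular matrices), see `conj_add_chartInv_mul`. -/
def vf (X : sl3) : Fin 3 → Coord :=
  ![-conj X 0 1, -conj X 1 2, -conj X 0 2 + cy * conj X 0 1]

/-- The vector field `a(X)` on `O`. -/
def vectorField (X : sl3) (p : Coord) : Coord := vf X 0 * dX p + vf X 1 * dY p + vf X 2 * dZ p

/-! ### The module `M_{μ₁,μ₂}` of sections of the local system -/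

/-- The space of sections `M_{μ₁,μ₂} = Γ(O, 𝓛_{μ₁,μ₂})`. The `𝓓`-module
`𝓞^{(μ₁)} ⊠ 𝓞^{(μ₂)} ⊠ 𝓞`, where `𝓞^{(μ)} = 𝓓 / 𝓓 (x ∂_x + μ)` on `𝔾ₘ`, is the free
`𝓞_O`-module of rank one on the generator `1_{μ₁} ⊗ 1_{μ₂} ⊗ 1`, which satisfies
`(x ∂_x + μ₁) 1 = (y ∂_y + μ₂) 1 = ∂_z 1 = 0`; the element `f : Coord` stands for the section
`f · (1_{μ₁} ⊗ 1_{μ₂} ⊗ 1)`. -/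
@[nolint unusedArguments]
def Sec (_μ₁ _μ₂ : ℂ) : Type := Coord

instance (μ₁ μ₂ : ℂ) : AddCommGroup (Sec μ₁ μ₂) := inferInstanceAs (AddCommGroup Coord)
instance (μ₁ μ₂ : ℂ) : Module ℂ (Sec μ₁ μ₂) := inferInstanceAs (Module ℂ Coord)

/-- `∂_x` on sections: `∂_x (f 1) = (∂_x f - μ₁ x⁻¹ f) 1`. -/
def nablaX (μ₁ : ℂ) (p : Coord) : Coord := dX p - μ₁ • (mono (-1) 0 0 * p)
/-- `∂_y` on sections: `∂_y (f 1) = (∂_y f - μ₂ y⁻¹ f) 1`. -/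
def nablaY (μ₂ : ℂ) (p : Coord) : Coord := dY p - μ₂ • (mono 0 (-1) 0 * p)

/-- The action of the vector field `a(X)` on sections. -/
def secAct (μ₁ μ₂ : ℂ) (X : sl3) (p : Coord) : Coord :=
  vf X 0 * nablaX μ₁ p + vf X 1 * nablaY μ₂ p + vf X 2 * dZ p

/-- The basis section `u_{k,l,m} = x^k 1_{μ₁} ⊗ y^l 1_{μ₂} ⊗ z^m`. -/
def u (μ₁ μ₂ : ℂ) (k l : ℤ) (m : ℕ) : Sec μ₁ μ₂ := mono k l m

@[simp] theorem dX_cx : dX cx = 1 := by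
  simp [dX, cx, linOfMono_mono]; rfl
@[simp] theorem dX_cy : dX cy = 0 := by simp [dX, cy, linOfMono_mono]
@[simp] theorem dX_cz : dX cz = 0 := by simp [dX, cz, linOfMono_mono]
@[simp] theorem dY_cx : dY cx = 0 := by simp [dY, cx, linOfMono_mono]
@[simp] theorem dY_cy : dY cy = 1 := by simp [dY, cy, linOfMono_mono]; rfl
@[simp] theorem dY_cz : dY cz = 0 := by simp [dY, cz, linOfMono_mono]
@[simp] theorem dZ_cx : dZ cx = 0 := by simp [dZ, cx, linOfMono_mono]
@[simp] theorem dZ_cy : dZ cy = 0 := by simp [dZ, cy, linOfMono_mono]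
@[simp] theorem dZ_cz : dZ cz = 1 := by simp [dZ, cz, linOfMono_mono]; rfl

theorem mono_zero : mono 0 0 0 = 1 := rfl

@[simp] theorem dX_algebraMap (c : ℂ) : dX (algebraMap ℂ Coord c) = 0 := by
  rw [Algebra.algebraMap_eq_smul_one, map_smul, ← mono_zero]; simp [dX, linOfMono_mono]
@[simp] theorem dY_algebraMap (c : ℂ) : dY (algebraMap ℂ Coord c) = 0 := by
  rw [Algebra.algebraMap_eq_smul_one, map_smul, ← mono_zero]; simp [dY, linOfMono_mono]
@[simp] theorem dZ_algebraMap (c : ℂ) : dZ (algebraMap ℂ Coord c) = 0 := by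
  rw [Algebra.algebraMap_eq_smul_one, map_smul, ← mono_zero]; simp [dZ, linOfMono_mono]

theorem chart_eq : chart = !![1, cx, cz + cx * cy; 0, 1, cy; 0, 0, 1] := by
  ext i j
  fin_cases i <;> fin_cases j <;>
    simp [chart, Matrix.transvection, Matrix.mul_apply, Fin.sum_univ_three, Matrix.one_apply]

theorem chartInv_eq : chartInv = !![1, -cx, -cz; 0, 1, -cy; 0, 0, 1] := by
  ext i j
  fin_cases i <;> fin_cases j <;>
    simp [chartInv, Matrix.transvection, Matrix.mul_apply, Fin.sum_univ_three, Matrix.one_apply]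

theorem chartInv_mul_chart : chartInv * chart = 1 := by
  rw [chart_eq, chartInv_eq]
  ext i j
  fin_cases i <;> fin_cases j <;>
    simp [Matrix.mul_apply, Fin.sum_univ_three]

/-- The matrix entries of `X`, as constant functions. -/
def cst (X : sl3) (i j : Fin 3) : Coord := algebraMap ℂ Coord (X.1 i j)

theorem dX_cst (X : sl3) (i j : Fin 3) : dX (cst X i j) = 0 := dX_algebraMap _
theorem dY_cst (X : sl3) (i j : Fin 3) : dY (cst X i j) = 0 := dY_algebraMap _
theorem dZ_cst (X : sl3) (i j : Fin 3) : dZ (cst X i j) = 0 := dZ_algebraMap _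

theorem conj_apply (X : sl3) (i j : Fin 3) :
    conj X i j = ∑ b, (∑ a, chartInv i a * cst X a b) * chart b j := by
  simp only [conj, Matrix.mul_apply, Matrix.map_apply, cst]

theorem conj_zero_one (X : sl3) : conj X 0 1 =
    (cst X 0 0 - cx * cst X 1 0 - cz * cst X 2 0) * cx
      + (cst X 0 1 - cx * cst X 1 1 - cz * cst X 2 1) := by
  simp [conj_apply, chart_eq, chartInv_eq, Fin.sum_univ_three]; ring

theorem conj_one_two (X : sl3) : conj X 1 2 =
    (cst X 1 0 - cy * cst X 2 0) * (cz + cx * cy)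
      + (cst X 1 1 - cy * cst X 2 1) * cy + (cst X 1 2 - cy * cst X 2 2) := by
  simp [conj_apply, chart_eq, chartInv_eq, Fin.sum_univ_three]; ring

theorem conj_zero_two (X : sl3) : conj X 0 2 =
    (cst X 0 0 - cx * cst X 1 0 - cz * cst X 2 0) * (cz + cx * cy)
      + (cst X 0 1 - cx * cst X 1 1 - cz * cst X 2 1) * cy
      + (cst X 0 2 - cx * cst X 1 2 - cz * cst X 2 2) := by
  simp [conj_apply, chart_eq, chartInv_eq, Fin.sum_univ_three]; ring

@[simp] theorem dX_one : dX 1 = 0 := by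
  rw [← map_one (algebraMap ℂ Coord), dX_algebraMap]
@[simp] theorem dY_one : dY 1 = 0 := by
  rw [← map_one (algebraMap ℂ Coord), dY_algebraMap]
@[simp] theorem dZ_one : dZ 1 = 0 := by
  rw [← map_one (algebraMap ℂ Coord), dZ_algebraMap]

/-- The matrix `N⁻¹ (X N + a(X)(N))` is lower triangular, for `N = chart`. -/
theorem conj_add_chartInv_mul (X : sl3) (i j : Fin 3) (hij : i < j) :
    (conj X + chartInv * chart.map (vectorField X)) i j = 0 := by
  rw [Matrix.add_apply, chart_eq, chartInv_eq]
  fin_cases i <;> fin_cases j <;> simp at hij <;>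
  simp [Matrix.mul_apply, Fin.sum_univ_three, vectorField, vf, dX_mul, dY_mul, dZ_mul]
  ring

theorem vf_zero (X : sl3) : vf X 0 = -conj X 0 1 := rfl
theorem vf_one (X : sl3) : vf X 1 = -conj X 1 2 := rfl
theorem vf_two (X : sl3) : vf X 2 = -conj X 0 2 + cy * conj X 0 1 := rfl

/-- `a` is a homomorphism of Lie algebras. -/
theorem vf_lie (X Y : sl3) (j : Fin 3) : vf ⁅X, Y⁆ j =
    (vf X 0 * dX (vf Y j) + vf X 1 * dY (vf Y j) + vf X 2 * dZ (vf Y j)) -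
    (vf Y 0 * dX (vf X j) + vf Y 1 * dY (vf X j) + vf Y 2 * dZ (vf X j)) := by
  have hb : ∀ i j, cst ⁅X, Y⁆ i j = ∑ a, (cst X i a * cst Y a j - cst Y i a * cst X a j) := by
    intro i j
    simp only [cst, LieAlgebra.SpecialLinear.sl_bracket, Matrix.sub_apply, Matrix.mul_apply,
      map_sub, map_sum, map_mul, Finset.sum_sub_distrib]
  fin_cases j <;>
  simp only [Fin.zero_eta, Fin.mk_one, Fin.reduceFinMk, vf_zero, vf_one, vf_two, conj_zero_one,
    conj_one_two, conj_zero_two, hb, Fin.sum_univ_three, map_add, map_sub, map_neg, dX_mul, dY_mul,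
    dZ_mul, dX_cx, dX_cy, dX_cz, dY_cx, dY_cy, dY_cz, dZ_cx, dZ_cy, dZ_cz, dX_cst, dY_cst,
    dZ_cst] <;> ring

theorem conj_add (X Y : sl3) : conj (X + Y) = conj X + conj Y := by
  have : (X + Y).1.map (algebraMap ℂ Coord)
      = X.1.map (algebraMap ℂ Coord) + Y.1.map (algebraMap ℂ Coord) := by
    ext i j : 2; simp
  rw [conj, this, Matrix.mul_add, Matrix.add_mul]; rfl

theorem conj_smul (c : ℂ) (X : sl3) : conj (c • X) = c • conj X := by
  have : (c • X).1.map (algebraMap ℂ Coord) = c • X.1.map (algebraMap ℂ Coord) := by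
    ext i j : 2; simp
  rw [conj, this, Matrix.mul_smul, Matrix.smul_mul]; rfl

theorem vf_add (X Y : sl3) (j : Fin 3) : vf (X + Y) j = vf X j + vf Y j := by
  fin_cases j <;>
  simp only [Fin.zero_eta, Fin.mk_one, Fin.reduceFinMk, vf_zero, vf_one, vf_two, conj_add,
    Matrix.add_apply] <;> ring

theorem vf_smul (c : ℂ) (X : sl3) (j : Fin 3) : vf (c • X) j = c • vf X j := by
  fin_cases j <;>
  simp only [Fin.zero_eta, Fin.mk_one, Fin.reduceFinMk, vf_zero, vf_one, vf_two, conj_smul,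
    Matrix.smul_apply, smul_add, smul_neg, mul_smul_comm]

theorem nablaX_mul (μ : ℂ) (f p : Coord) : nablaX μ (f * p) = dX f * p + f * nablaX μ p := by
  simp only [nablaX, dX_mul, Algebra.smul_def]; ring
theorem nablaY_mul (μ : ℂ) (f p : Coord) : nablaY μ (f * p) = dY f * p + f * nablaY μ p := by
  simp only [nablaY, dY_mul, Algebra.smul_def]; ring

theorem nablaX_add (μ : ℂ) (p q : Coord) : nablaX μ (p + q) = nablaX μ p + nablaX μ q := by
  simp only [nablaX, map_add, mul_add, smul_add]; ring
theorem nablaY_add (μ : ℂ) (p q : Coord) : nablaY μ (p + q) = nablaY μ p + nablaY μ q := by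
  simp only [nablaY, map_add, mul_add, smul_add]; ring
theorem nablaX_smul (μ c : ℂ) (p : Coord) : nablaX μ (c • p) = c • nablaX μ p := by
  simp only [nablaX, map_smul, mul_smul_comm, smul_sub, smul_comm μ c]
theorem nablaY_smul (μ c : ℂ) (p : Coord) : nablaY μ (c • p) = c • nablaY μ p := by
  simp only [nablaY, map_smul, mul_smul_comm, smul_sub, smul_comm μ c]

theorem nablaX_nablaY (μ ν : ℂ) (p : Coord) : nablaX μ (nablaY ν p) = nablaY ν (nablaX μ p) := by
  have h1 : dX (mono 0 (-1) 0) = 0 := by simp [dX, linOfMono_mono]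
  have h2 : dY (mono (-1) 0 0) = 0 := by simp [dY, linOfMono_mono]
  simp only [nablaX, nablaY, map_sub, dX_algebraMap, dY_algebraMap, dX_mul, dY_mul, h1, h2, dX_dY, Algebra.smul_def]
  ring
theorem nablaX_dZ (μ : ℂ) (p : Coord) : nablaX μ (dZ p) = dZ (nablaX μ p) := by
  have h2 : dZ (mono (-1) 0 0) = 0 := by simp [dZ, linOfMono_mono]
  simp only [nablaX, map_sub, dZ_algebraMap, dZ_mul, h2, dX_dZ, Algebra.smul_def]
  ring
theorem nablaY_dZ (μ : ℂ) (p : Coord) : nablaY μ (dZ p) = dZ (nablaY μ p) := by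
  have h2 : dZ (mono 0 (-1) 0) = 0 := by simp [dZ, linOfMono_mono]
  simp only [nablaY, map_sub, dZ_algebraMap, dZ_mul, h2, dY_dZ, Algebra.smul_def]
  ring

theorem secAct_lie (μ₁ μ₂ : ℂ) (X Y : sl3) (p : Coord) : secAct μ₁ μ₂ ⁅X, Y⁆ p =
    secAct μ₁ μ₂ X (secAct μ₁ μ₂ Y p) - secAct μ₁ μ₂ Y (secAct μ₁ μ₂ X p) := by
  simp only [secAct, nablaX_add, nablaY_add, map_add, nablaX_mul, nablaY_mul, dZ_mul,
    nablaX_nablaY, nablaX_dZ, nablaY_dZ, vf_lie X Y]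
  ring

theorem secAct_add_left (μ₁ μ₂ : ℂ) (X Y : sl3) (p : Coord) :
    secAct μ₁ μ₂ (X + Y) p = secAct μ₁ μ₂ X p + secAct μ₁ μ₂ Y p := by
  simp only [secAct, vf_add]; ring

theorem secAct_smul_left (μ₁ μ₂ c : ℂ) (X : sl3) (p : Coord) :
    secAct μ₁ μ₂ (c • X) p = c • secAct μ₁ μ₂ X p := by
  simp only [secAct, vf_smul, smul_add, smul_mul_assoc]

theorem secAct_add (μ₁ μ₂ : ℂ) (X : sl3) (p q : Coord) :
    secAct μ₁ μ₂ X (p + q) = secAct μ₁ μ₂ X p + secAct μ₁ μ₂ X q := by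
  simp only [secAct, nablaX_add, nablaY_add, map_add]; ring

theorem secAct_smul (μ₁ μ₂ c : ℂ) (X : sl3) (p : Coord) :
    secAct μ₁ μ₂ X (c • p) = c • secAct μ₁ μ₂ X p := by
  simp only [secAct, nablaX_smul, nablaY_smul, map_smul, smul_add, mul_smul_comm]

section

attribute [local instance 100] LieRing.ofAssociativeRing

/-- The action of `𝔰𝔩₃` on sections through infinitesimal left translations. -/
def secRep (μ₁ μ₂ : ℂ) : sl3 →ₗ⁅ℂ⁆ Module.End ℂ Coord where
  toFun X :=
    { toFun := secAct μ₁ μ₂ X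
      map_add' := secAct_add μ₁ μ₂ X
      map_smul' := fun c => secAct_smul μ₁ μ₂ c X }
  map_add' X Y := LinearMap.ext fun p => secAct_add_left μ₁ μ₂ X Y p
  map_smul' c X := LinearMap.ext fun p => secAct_smul_left μ₁ μ₂ c X p
  map_lie' {X Y} := LinearMap.ext fun p => secAct_lie μ₁ μ₂ X Y p

instance (μ₁ μ₂ : ℂ) : LieRingModule sl3 (Sec μ₁ μ₂) :=
  LieRingModule.compLieHom Coord (secRep μ₁ μ₂)
instance (μ₁ μ₂ : ℂ) : LieModule ℂ sl3 (Sec μ₁ μ₂) :=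
  LieModule.compLieHom Coord (secRep μ₁ μ₂)

end

/-! ### The vectors `w_{k,l,m}` and the subquotients `M_J` -/

/-- `k̄ = k - μ`. -/
def bar (μ : ℂ) (k : ℤ) : ℂ := (k : ℂ) - μ

/-- The raising factorial `x^{(n)} = x (x + 1) ⋯ (x + n - 1)`. -/
def rising (x : ℂ) (n : ℕ) : ℂ := ∏ i ∈ Finset.range n, (x + i)

/-- The vector `w_{k,l,m} = ∑ₙ (m choose n) l̄^{(n)} / (k̄ + l̄)^{(n)} u_{k+n,l+n,m-n}`. -/
def w (μ₁ μ₂ : ℂ) (p : ℤ × ℤ × ℕ) : Sec μ₁ μ₂ :=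
  ∑ n ∈ Finset.range (p.2.2 + 1),
    ((p.2.2.choose n : ℂ) * (rising (bar μ₂ p.2.1) n / rising (bar μ₁ p.1 + bar μ₂ p.2.1) n)) •
      u μ₁ μ₂ (p.1 + n) (p.2.1 + n) (p.2.2 - n)

/-- The submodule of `M_{μ₁,μ₂}` generated by the `w_{k,l,m}` with `(k,l,m) ∈ J`. -/
def genSub (μ₁ μ₂ : ℂ) (J : Set (ℤ × ℤ × ℕ)) : LieSubmodule ℂ sl3 (Sec μ₁ μ₂) :=
  LieSubmodule.lieSpan ℂ sl3 (w μ₁ μ₂ '' J)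

/-- `⨁_{(k,l,m) ∈ J} ℂ w_{k,l,m}` is an `𝔰𝔩₃`-submodule of `M_{μ₁,μ₂}`. -/
def IsStable (μ₁ μ₂ : ℂ) (J : Set (ℤ × ℤ × ℕ)) : Prop :=
  (genSub μ₁ μ₂ J).toSubmodule = Submodule.span ℂ (w μ₁ μ₂ '' J)

/-- `J'` and `J''` index submodules `⨁_{J''} ℂ w ⊆ ⨁_{J'} ℂ w` of `M_{μ₁,μ₂}` whose quotient has
underlying vector space `⨁_J ℂ w`, i.e. whose quotient is the subquotient `M_{μ₁,μ₂,J}`. -/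
structure Realizes (μ₁ μ₂ : ℂ) (J' J'' J : Set (ℤ × ℤ × ℕ)) : Prop where
  stable_sup : IsStable μ₁ μ₂ J'
  stable_sub : IsStable μ₁ μ₂ J''
  subset : J'' ⊆ J'
  diff_eq : J' \ J'' = J

/-- The quotient of the submodule on `J'` by the submodule on `J''`. -/
abbrev Subquot (μ₁ μ₂ : ℂ) (J' J'' : Set (ℤ × ℤ × ℕ)) : Type :=
  genSub μ₁ μ₂ J' ⧸ (genSub μ₁ μ₂ J'').comap (genSub μ₁ μ₂ J').incl

/-! ### The dual -/

section Dual

variable (M : Type) [AddCommGroup M] [Module ℂ M] [LieRingModule sl3 M] [LieModule ℂ sl3 M]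

/-- The simultaneous `(h₁, h₂, f₁₂ e₁₂)`-eigenspace `M_χ` of `M`. -/
def eig (χ : ℂ × ℂ × ℂ) : Submodule ℂ M where
  carrier := {v | ⁅h1, v⁆ = χ.1 • v ∧ ⁅h2, v⁆ = χ.2.1 • v ∧ ⁅f12, ⁅e12, v⁆⁆ = χ.2.2 • v}
  add_mem' := by
    rintro a b ⟨ha, ha', ha''⟩ ⟨hb, hb', hb''⟩
    simp only [Set.mem_ofPred_eq, lie_add, smul_add, *, and_self]
  zero_mem' := by simp
  smul_mem' := by
    rintro c a ⟨ha, ha', ha''⟩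
    simp only [Set.mem_ofPred_eq, lie_smul, *, smul_comm c, and_self]

/-- `M` is the direct sum of its simultaneous `(h₁, h₂, f₁₂ e₁₂)`-eigenspaces, and these are finite
dimensional. -/
structure IsEigenSum : Prop where
  indep : iSupIndep (eig M)
  iSup_eq_top : ⨆ χ, eig M χ = ⊤
  finite : ∀ χ, FiniteDimensional ℂ (eig M χ)

end Dual

/-- `diag(1, -1, 1)`. -/
def signMat : Matrix (Fin 3) (Fin 3) ℂ := Matrix.diagonal ![1, -1, 1]

theorem signMat_mul_signMat : signMat * signMat = 1 := by
  rw [signMat, Matrix.diagonal_mul_diagonal, ← Matrix.diagonal_one]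
  congr 1
  ext i
  fin_cases i <;> simp

/-- The involution `τ` of `𝔰𝔩₃` with `h₁ ↦ -h₁`, `h₂ ↦ -h₂`, `f₁ ↔ e₁`, `f₂ ↔ e₂`,
`-f₁₂ ↔ e₁₂`, namely `X ↦ -D Xᵀ D` for `D = diag(1, -1, 1)`. -/
def tau : sl3 →ₗ⁅ℂ⁆ sl3 where
  toFun X := ⟨-(signMat * X.1.transpose * signMat), by
    have h : X.1.trace = 0 := X.2
    change (-(signMat * X.1.transpose * signMat)).trace = 0
    rw [Matrix.trace_neg, Matrix.trace_mul_comm, ← Matrix.mul_assoc, signMat_mul_signMat,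
      Matrix.one_mul, Matrix.trace_transpose, h, neg_zero]⟩
  map_add' X Y := by
    apply Subtype.ext
    change -(signMat * (X.1 + Y.1).transpose * signMat) =
      -(signMat * X.1.transpose * signMat) + -(signMat * Y.1.transpose * signMat)
    rw [Matrix.transpose_add, Matrix.mul_add, Matrix.add_mul, neg_add]
  map_smul' c X := by
    apply Subtype.ext
    change -(signMat * (c • X.1).transpose * signMat) = c • -(signMat * X.1.transpose * signMat)
    rw [Matrix.transpose_smul, Matrix.mul_smul, Matrix.smul_mul, smul_neg]
  map_lie' {X Y} := by
    apply Subtype.ext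
    simp only [LieAlgebra.SpecialLinear.sl_bracket, Matrix.transpose_sub, Matrix.transpose_mul,
      Matrix.mul_sub, Matrix.sub_mul, neg_mul_neg, neg_sub]
    have h : ∀ A B : Matrix (Fin 3) (Fin 3) ℂ,
        signMat * A * signMat * (signMat * B * signMat) = signMat * (A * B) * signMat := by
      intro A B
      calc _ = signMat * A * (signMat * signMat) * B * signMat := by simp only [Matrix.mul_assoc]
        _ = _ := by rw [signMat_mul_signMat]; simp only [Matrix.mul_assoc, Matrix.one_mul]
    rw [h, h]

theorem tau_h1 : tau h1 = -h1 := by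
  ext i j
  change (-(signMat * _ * signMat) : Matrix (Fin 3) (Fin 3) ℂ) i j = _
  fin_cases i <;> fin_cases j <;> simp [h1, signMat]
theorem tau_h2 : tau h2 = -h2 := by
  ext i j
  change (-(signMat * _ * signMat) : Matrix (Fin 3) (Fin 3) ℂ) i j = _
  fin_cases i <;> fin_cases j <;> simp [h2, signMat]
theorem tau_e1 : tau e1 = f1 := by
  ext i j
  change (-(signMat * _ * signMat) : Matrix (Fin 3) (Fin 3) ℂ) i j = _
  fin_cases i <;> fin_cases j <;> simp [e1, f1, signMat]
theorem tau_f1 : tau f1 = e1 := by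
  ext i j
  change (-(signMat * _ * signMat) : Matrix (Fin 3) (Fin 3) ℂ) i j = _
  fin_cases i <;> fin_cases j <;> simp [e1, f1, signMat]
theorem tau_e2 : tau e2 = f2 := by
  ext i j
  change (-(signMat * _ * signMat) : Matrix (Fin 3) (Fin 3) ℂ) i j = _
  fin_cases i <;> fin_cases j <;> simp [e2, f2, signMat]
theorem tau_f2 : tau f2 = e2 := by
  ext i j
  change (-(signMat * _ * signMat) : Matrix (Fin 3) (Fin 3) ℂ) i j = _
  fin_cases i <;> fin_cases j <;> simp [e2, f2, signMat]
theorem tau_e12 : tau e12 = -f12 := by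
  rw [e12, LieHom.map_lie, tau_e1, tau_e2, f12, neg_neg]
theorem tau_f12 : tau f12 = -e12 := by
  rw [e12, f12, map_neg, LieHom.map_lie, tau_f1, tau_f2]

section Dual

variable (M : Type) [AddCommGroup M] [Module ℂ M] [LieRingModule sl3 M] [LieModule ℂ sl3 M]

/-- The full linear dual of `M`, with the action of `𝔰𝔩₃` twisted by `τ`. -/
def TwistedDual : Type := M →ₗ[ℂ] ℂ

instance : AddCommGroup (TwistedDual M) := inferInstanceAs (AddCommGroup (M →ₗ[ℂ] ℂ))
instance : Module ℂ (TwistedDual M) := inferInstanceAs (Module ℂ (M →ₗ[ℂ] ℂ))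
instance : FunLike (TwistedDual M) M ℂ := inferInstanceAs (FunLike (M →ₗ[ℂ] ℂ) M ℂ)

/-- The action `(X η)(v) = -η(τ(X) v)`. -/
instance : LieRingModule sl3 (TwistedDual M) :=
  LieRingModule.compLieHom (M →ₗ[ℂ] ℂ) tau
instance : LieModule ℂ sl3 (TwistedDual M) :=
  LieModule.compLieHom (M →ₗ[ℂ] ℂ) tau

theorem twistedDual_lie_apply (X : sl3) (η : TwistedDual M) (v : M) :
    ⁅X, η⁆ v = -η ⁅tau X, v⁆ := rfl

/-- The functionals on `M` that vanish on all but finitely many of the `M_χ`. If `M = ⨁_χ M_χ`,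
this is the subspace `⨁_χ Hom(M_χ, ℂ)` of `Hom(M, ℂ)`. -/
def finSupported : Set (TwistedDual M) := {η | {χ | ∃ v ∈ eig M χ, η v ≠ 0}.Finite}

end Dual

section Dual

variable (M : Type) [AddCommGroup M] [Module ℂ M] [LieRingModule sl3 M] [LieModule ℂ sl3 M]

/-- The dual `M^∨ = ⨁_χ Hom(M_χ, ℂ)`, with the action `(X η)(v) = -η(τ(X) v)`, for `M = ⨁_χ M_χ`
with finite dimensional `M_χ`: by `coe_dual` below, the finitely supported functionals form a
submodule in this case. (For all other modules `M` this is a junk value.) -/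
def dual : LieSubmodule ℂ sl3 (TwistedDual M) := LieSubmodule.lieSpan ℂ sl3 (finSupported M)

variable {M}

theorem finSupported_add {η θ : TwistedDual M} (hη : η ∈ finSupported M)
    (hθ : θ ∈ finSupported M) : η + θ ∈ finSupported M := by
  refine (Set.Finite.union hη hθ).subset ?_
  rintro χ ⟨v, hv, h⟩
  by_contra hc
  have h1 : η v = 0 := by by_contra h'; exact hc (Or.inl ⟨v, hv, h'⟩)
  have h2 : θ v = 0 := by by_contra h'; exact hc (Or.inr ⟨v, hv, h'⟩)
  apply h
  change η v + θ v = 0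
  rw [h1, h2, add_zero]

theorem finSupported_smul (c : ℂ) {η : TwistedDual M} (hη : η ∈ finSupported M) :
    c • η ∈ finSupported M := by
  refine Set.Finite.subset hη ?_
  rintro χ ⟨v, hv, h⟩
  refine ⟨v, hv, fun h' => h ?_⟩
  change c * η v = 0
  rw [h', mul_zero]

theorem finSupported_zero : (0 : TwistedDual M) ∈ finSupported M := by
  refine Set.Finite.subset Set.finite_empty ?_
  rintro χ ⟨v, -, h⟩
  exact h rfl

/-- If `Y M_χ ⊆ ⨁ M_χ'` over the `χ'` with `(χ, χ') ∈ R`, and each `χ'` is related to finitely many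
`χ`, then composition with `Y` preserves finitely supported functionals. -/
theorem finSupported_of_rel {X Y : sl3} (hXY : tau X = Y) (R : ℂ × ℂ × ℂ → ℂ × ℂ × ℂ → Prop)
    (hR : ∀ χ', {χ | R χ χ'}.Finite)
    (h : ∀ χ, ∀ v ∈ eig M χ, ∃ g : (ℂ × ℂ × ℂ) →₀ M, (∀ χ', g χ' ∈ eig M χ') ∧
      (g.sum fun _ x => x) = ⁅Y, v⁆ ∧ ∀ χ', g χ' ≠ 0 → R χ χ')
    {η : TwistedDual M} (hη : η ∈ finSupported M) : ⁅X, η⁆ ∈ finSupported M := by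
  refine (Set.Finite.biUnion hη fun χ' _ => hR χ').subset ?_
  rintro χ ⟨v, hv, hne⟩
  rw [twistedDual_lie_apply, hXY] at hne
  obtain ⟨g, hg, hsum, hgR⟩ := h χ v hv
  by_contra hc
  apply hne
  rw [← hsum, neg_eq_zero, Finsupp.sum]
  have : ∀ s : Finset (ℂ × ℂ × ℂ), η (∑ a ∈ s, g a) = ∑ a ∈ s, η (g a) := fun s =>
    map_sum (show M →ₗ[ℂ] ℂ from η) _ _
  rw [this]
  refine Finset.sum_eq_zero fun χ' _ => ?_
  by_contra h0
  refine hc (Set.mem_biUnion (x := χ') ⟨g χ', hg χ', h0⟩ (hgR χ' ?_))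
  intro hz
  apply h0
  rw [hz]
  exact map_zero (show M →ₗ[ℂ] ℂ from η)

/-- Decomposition of a joint solution of polynomial equations in `h₁`, `h₂`, `f₁₂ e₁₂`. -/
theorem exists_decomp (hM : IsEigenSum M) {y : M} {a b p q : ℂ} (h₁ : ⁅h1, y⁆ = a • y)
    (h₂ : ⁅h2, y⁆ = b • y)
    (h₃ : ⁅f12, ⁅e12, ⁅f12, ⁅e12, y⁆⁆⁆⁆ + p • ⁅f12, ⁅e12, y⁆⁆ + q • y = 0) :
    ∃ g : (ℂ × ℂ × ℂ) →₀ M, (∀ χ', g χ' ∈ eig M χ') ∧ (g.sum fun _ x => x) = y ∧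
      ∀ χ', g χ' ≠ 0 → χ'.1 = a ∧ χ'.2.1 = b ∧ χ'.2.2 ^ 2 + p * χ'.2.2 + q = 0 := by
  have hy : y ∈ ⨆ χ, eig M χ := by rw [hM.iSup_eq_top]; trivial
  obtain ⟨g, hg, rfl⟩ := (Submodule.mem_iSup_iff_exists_finsupp _ _).1 hy
  refine ⟨g, hg, rfl, ?_⟩
  have key : ∀ (A : Module.End ℂ M) (c : ℂ × ℂ × ℂ → ℂ),
      (∀ χ, A (g χ) = c χ • g χ) → A (g.sum fun _ x => x) = 0 → ∀ χ, g χ ≠ 0 → c χ = 0 := by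
    intro A c hA h0 χ hχ
    rw [Finsupp.sum, map_sum] at h0
    simp only [hA] at h0
    have := (iSupIndep_iff_finsetSum_eq_zero_imp_eq_zero _).1 hM.indep g.support
      (fun χ => c χ • g χ) (fun i _ => Submodule.smul_mem _ _ (hg i)) h0 χ
      (Finsupp.mem_support_iff.2 hχ)
    exact (smul_eq_zero.1 this).resolve_right hχ
  let H1 : Module.End ℂ M := LieModule.toEnd ℂ sl3 M h1
  let H2 : Module.End ℂ M := LieModule.toEnd ℂ sl3 M h2
  let T : Module.End ℂ M := LieModule.toEnd ℂ sl3 M f12 * LieModule.toEnd ℂ sl3 M e12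
  have e₁ : ∀ χ, H1 (g χ) = χ.1 • g χ := fun χ => (hg χ).1
  have e₂ : ∀ χ, H2 (g χ) = χ.2.1 • g χ := fun χ => (hg χ).2.1
  have e₃ : ∀ χ, T (g χ) = χ.2.2 • g χ := fun χ => (hg χ).2.2
  intro χ hχ
  refine ⟨?_, ?_, ?_⟩
  · refine sub_eq_zero.1 (key (H1 - a • 1) (fun χ => χ.1 - a) (fun χ => ?_) ?_ χ hχ)
    · simp [e₁, sub_smul]
    · exact sub_eq_zero.2 h₁
  · refine sub_eq_zero.1 (key (H2 - b • 1) (fun χ => χ.2.1 - b) (fun χ => ?_) ?_ χ hχ)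
    · simp [e₂, sub_smul]
    · exact sub_eq_zero.2 h₂
  · refine key (T * T + p • T + q • 1) (fun χ => χ.2.2 ^ 2 + p * χ.2.2 + q) (fun χ => ?_) ?_ χ hχ
    · simp [e₃, add_smul, smul_smul, pow_two]
    · exact h₃

theorem finite_quadratic (B D : ℂ) : {c : ℂ | c ^ 2 + B * c + D = 0}.Finite := by
  rcases Set.eq_empty_or_nonempty {c : ℂ | c ^ 2 + B * c + D = 0} with h | ⟨c₀, h₀⟩
  · rw [h]; exact Set.finite_empty
  · refine (Set.toFinite {c₀, -c₀ - B}).subset fun c hc => ?_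
    have hc' : c ^ 2 + B * c + D = 0 := hc
    have h₀' : c₀ ^ 2 + B * c₀ + D = 0 := h₀
    have : (c - c₀) * (c - (-c₀ - B)) = 0 := by linear_combination hc' - h₀'
    rcases mul_eq_zero.1 this with h | h
    · exact Or.inl (sub_eq_zero.1 h)
    · exact Or.inr (sub_eq_zero.1 h)

theorem finite_rel (a b : ℂ) (P Q : ℂ → ℂ → ℂ) (B D : ℂ → ℂ → ℂ)
    (h : ∀ c l t, t ^ 2 + P c l * t + Q c l = c ^ 2 + B l t * c + D l t) (χ' : ℂ × ℂ × ℂ) :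
    {χ : ℂ × ℂ × ℂ | χ'.1 = χ.1 + a ∧ χ'.2.1 = χ.2.1 + b ∧ χ'.2.2 ^ 2 +
      P χ.2.2 (χ.1 + χ.2.1) * χ'.2.2 + Q χ.2.2 (χ.1 + χ.2.1) = 0}.Finite := by
  refine ((finite_quadratic (B (χ'.1 - a + (χ'.2.1 - b)) χ'.2.2)
    (D (χ'.1 - a + (χ'.2.1 - b)) χ'.2.2)).image fun c => (χ'.1 - a, χ'.2.1 - b, c)).subset ?_
  rintro ⟨x, y, c⟩ ⟨h₁, h₂, h₃⟩
  simp only at h₁ h₂ h₃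
  refine ⟨c, ?_, ?_⟩
  · change _ = _
    rw [h] at h₃
    rw [h₁, h₂, add_sub_cancel_right, add_sub_cancel_right]
    exact h₃
  · simp [h₁, h₂]

/-- `X` has the integral matrix `A`. -/
def HasInt (X : sl3) (A : Matrix (Fin 3) (Fin 3) ℤ) : Prop := X.1 = A.map (Int.castRingHom ℂ)

theorem HasInt.lie {X Y : sl3} {A B : Matrix (Fin 3) (Fin 3) ℤ} (hX : HasInt X A)
    (hY : HasInt Y B) : HasInt ⁅X, Y⁆ (A * B - B * A) := by
  change X.1 * Y.1 - Y.1 * X.1 = _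
  rw [hX, hY, ← Matrix.map_mul, ← Matrix.map_mul, Matrix.map_sub _ (map_sub _)]

theorem HasInt.neg {X : sl3} {A : Matrix (Fin 3) (Fin 3) ℤ} (hX : HasInt X A) :
    HasInt (-X) (-A) := by
  change -X.1 = _
  rw [hX]; ext i j; simp

theorem HasInt.smul (n : ℤ) {X : sl3} {A : Matrix (Fin 3) (Fin 3) ℤ} (hX : HasInt X A) :
    HasInt ((n : ℂ) • X) (n • A) := by
  change (n : ℂ) • X.1 = _
  rw [hX]
  ext i j
  exact (Int.cast_mul n (A i j)).symm

theorem HasInt.add {X Y : sl3} {A B : Matrix (Fin 3) (Fin 3) ℤ} (hX : HasInt X A)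
    (hY : HasInt Y B) : HasInt (X + Y) (A + B) := by
  change X.1 + Y.1 = _
  rw [hX, hY]; ext i j; simp

theorem HasInt.zero : HasInt 0 0 := by
  change (0 : Matrix (Fin 3) (Fin 3) ℂ) = _
  ext i j; simp

theorem HasInt.eq {X Y : sl3} {A B : Matrix (Fin 3) (Fin 3) ℤ} (hX : HasInt X A)
    (hY : HasInt Y B) (h : A = B) : X = Y := by
  apply Subtype.ext
  rw [hX, hY, h]

theorem int_e1 : HasInt e1 !![0, 1, 0; 0, 0, 0; 0, 0, 0] := by
  change e1.1 = _
  ext i j; fin_cases i <;> fin_cases j <;> simp [e1]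
theorem int_e2 : HasInt e2 !![0, 0, 0; 0, 0, 1; 0, 0, 0] := by
  change e2.1 = _
  ext i j; fin_cases i <;> fin_cases j <;> simp [e2]
theorem int_f1 : HasInt f1 !![0, 0, 0; 1, 0, 0; 0, 0, 0] := by
  change f1.1 = _
  ext i j; fin_cases i <;> fin_cases j <;> simp [f1]
theorem int_f2 : HasInt f2 !![0, 0, 0; 0, 0, 0; 0, 1, 0] := by
  change f2.1 = _
  ext i j; fin_cases i <;> fin_cases j <;> simp [f2]
theorem int_h1 : HasInt h1 !![1, 0, 0; 0, -1, 0; 0, 0, 0] := by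
  change h1.1 = _
  ext i j; fin_cases i <;> fin_cases j <;> simp [h1]
theorem int_h2 : HasInt h2 !![0, 0, 0; 0, 1, 0; 0, 0, -1] := by
  change h2.1 = _
  ext i j; fin_cases i <;> fin_cases j <;> simp [h2]
theorem int_e12 : HasInt e12 !![0, 0, 1; 0, 0, 0; 0, 0, 0] := by
  have h := int_e1.lie int_e2
  rwa [show _ * _ - _ * _ = (!![0, 0, 1; 0, 0, 0; 0, 0, 0] : Matrix (Fin 3) (Fin 3) ℤ)
    by decide] at h
theorem int_f12 : HasInt f12 !![0, 0, 0; 0, 0, 0; 1, 0, 0] := by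
  have h := (int_f1.lie int_f2).neg
  rwa [show -(_ * _ - _ * _) = (!![0, 0, 0; 0, 0, 0; 1, 0, 0] : Matrix (Fin 3) (Fin 3) ℤ)
    by decide] at h

theorem lie_e12_f12 : ⁅e12, f12⁆ = h1 + h2 :=
  (int_e12.lie int_f12).eq (int_h1.add int_h2) (by decide)

theorem lie_h_e12 : ⁅h1 + h2, e12⁆ = (2 : ℂ) • e12 := by
  have := ((int_h1.add int_h2).lie int_e12).eq (int_e12.smul 2) (by decide)
  rwa [Int.cast_ofNat] at this

theorem weight_shift {Y : sl3} {a b : ℂ} (h₁ : ⁅h1, Y⁆ = a • Y) (h₂ : ⁅h2, Y⁆ = b • Y)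
    {χ : ℂ × ℂ × ℂ} {v : M} (hv : v ∈ eig M χ) :
    ⁅h1, ⁅Y, v⁆⁆ = (χ.1 + a) • ⁅Y, v⁆ ∧ ⁅h2, ⁅Y, v⁆⁆ = (χ.2.1 + b) • ⁅Y, v⁆ := by
  rw [leibniz_lie h1, leibniz_lie h2, h₁, h₂, hv.1, hv.2.1, smul_lie, smul_lie, lie_smul, lie_smul,
    add_smul, add_smul, add_comm, add_comm (b • _)]
  exact ⟨rfl, rfl⟩

theorem finSupported_raise (hM : IsEigenSum M) {X Y Z : sl3} (hXY : tau X = Y) {a b : ℂ}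
    (h₁ : ⁅h1, Y⁆ = a • Y) (h₂ : ⁅h2, Y⁆ = b • Y) (hfY : ⁅f12, Y⁆ = Z) (heY : ⁅e12, Y⁆ = 0)
    (heZ : ⁅e12, Z⁆ = Y) (hfZ : ⁅f12, Z⁆ = 0)
    {η : TwistedDual M} (hη : η ∈ finSupported M) : ⁅X, η⁆ ∈ finSupported M := by
  refine finSupported_of_rel hXY _ (finite_rel a b (fun c l => -(2 * c - l - 1))
    (fun c l => c ^ 2 - (l + 2) * c) (fun l t => -(2 * t + l + 2))
    (fun l t => t ^ 2 + (l + 1) * t) (by intros; ring)) (fun χ v hv => ?_) hη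
  obtain ⟨w₁, w₂⟩ := weight_shift h₁ h₂ hv
  refine exists_decomp hM w₁ w₂ ?_
  obtain ⟨v₁, v₂, v₃⟩ := hv
  have E1 : ∀ m : M, ⁅e12, ⁅Y, m⁆⁆ = ⁅Y, ⁅e12, m⁆⁆ := fun m => by
    rw [leibniz_lie, heY, zero_lie, zero_add]
  have E2 : ∀ m : M, ⁅f12, ⁅Y, m⁆⁆ = ⁅Z, m⁆ + ⁅Y, ⁅f12, m⁆⁆ := fun m => by
    rw [leibniz_lie, hfY]
  have E3 : ∀ m : M, ⁅e12, ⁅Z, m⁆⁆ = ⁅Y, m⁆ + ⁅Z, ⁅e12, m⁆⁆ := fun m => by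
    rw [leibniz_lie, heZ]
  have E4 : ∀ m : M, ⁅f12, ⁅Z, m⁆⁆ = ⁅Z, ⁅f12, m⁆⁆ := fun m => by
    rw [leibniz_lie, hfZ, zero_lie, zero_add]
  have hw : ⁅f12, ⁅e12, ⁅e12, v⁆⁆⁆ = (χ.2.2 - (χ.1 + χ.2.1) - 2) • ⁅e12, v⁆ := by
    have A : ⁅h1 + h2, ⁅e12, v⁆⁆ = (χ.1 + χ.2.1 + 2) • ⁅e12, v⁆ := by
      rw [leibniz_lie, lie_h_e12, add_lie, v₁, v₂, lie_add, lie_smul, lie_smul, smul_lie]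
      module
    have B := lie_lie e12 f12 ⁅e12, v⁆
    rw [lie_e12_f12, A, v₃, lie_smul] at B
    rw [eq_sub_iff_add_eq] at B
    rw [eq_sub_iff_add_eq'.2 B]
    module
  have T1 : ⁅f12, ⁅e12, ⁅Y, v⁆⁆⁆ = χ.2.2 • ⁅Y, v⁆ + ⁅Z, ⁅e12, v⁆⁆ := by
    rw [E1, E2, v₃, lie_smul, add_comm]
  have T2 : ⁅f12, ⁅e12, ⁅Z, ⁅e12, v⁆⁆⁆⁆ =
      χ.2.2 • ⁅Y, v⁆ + (χ.2.2 - (χ.1 + χ.2.1) - 1) • ⁅Z, ⁅e12, v⁆⁆ := by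
    rw [E3, lie_add, E2, E4, hw, v₃, lie_smul, lie_smul]
    module
  rw [T1, lie_add, lie_add, lie_smul, lie_smul, T1, T2]
  module

theorem finSupported_lower (hM : IsEigenSum M) {X Y Z : sl3} (hXY : tau X = Y) {a b a' b' : ℂ}
    (h₁ : ⁅h1, Y⁆ = a • Y) (h₂ : ⁅h2, Y⁆ = b • Y) (hfY : ⁅f12, Y⁆ = 0) (heY : ⁅e12, Y⁆ = Z)
    (heZ : ⁅e12, Z⁆ = 0) (hfZ : ⁅f12, Z⁆ = Y) (z₁ : ⁅h1, Z⁆ = a' • Z) (z₂ : ⁅h2, Z⁆ = b' • Z)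
    (hab : a' + b' = 1)
    {η : TwistedDual M} (hη : η ∈ finSupported M) : ⁅X, η⁆ ∈ finSupported M := by
  refine finSupported_of_rel hXY _ (finite_rel a b (fun c l => -(2 * c + l + 1))
    (fun c l => c ^ 2 + l * c) (fun l t => l - 2 * t)
    (fun l t => t ^ 2 - (l + 1) * t) (by intros; ring)) (fun χ v hv => ?_) hη
  obtain ⟨w₁, w₂⟩ := weight_shift h₁ h₂ hv
  obtain ⟨y₁, y₂⟩ := weight_shift z₁ z₂ hv
  refine exists_decomp hM w₁ w₂ ?_
  obtain ⟨v₁, v₂, v₃⟩ := hv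
  have E1 : ∀ m : M, ⁅e12, ⁅Y, m⁆⁆ = ⁅Z, m⁆ + ⁅Y, ⁅e12, m⁆⁆ := fun m => by
    rw [leibniz_lie, heY]
  have E2 : ∀ m : M, ⁅f12, ⁅Y, m⁆⁆ = ⁅Y, ⁅f12, m⁆⁆ := fun m => by
    rw [leibniz_lie, hfY, zero_lie, zero_add]
  have E3 : ∀ m : M, ⁅e12, ⁅Z, m⁆⁆ = ⁅Z, ⁅e12, m⁆⁆ := fun m => by
    rw [leibniz_lie, heZ, zero_lie, zero_add]
  have E4 : ∀ m : M, ⁅f12, ⁅Z, m⁆⁆ = ⁅Y, m⁆ + ⁅Z, ⁅f12, m⁆⁆ := fun m => by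
    rw [leibniz_lie, hfZ]
  have T1 : ⁅f12, ⁅e12, ⁅Y, v⁆⁆⁆ = χ.2.2 • ⁅Y, v⁆ + ⁅f12, ⁅Z, v⁆⁆ := by
    rw [E1, lie_add, E2, v₃, lie_smul, add_comm]
  have A : ⁅e12, ⁅f12, ⁅Z, v⁆⁆⁆ = (χ.1 + χ.2.1 + 1) • ⁅Z, v⁆ + ⁅f12, ⁅Z, ⁅e12, v⁆⁆⁆ := by
    rw [leibniz_lie, lie_e12_f12, add_lie, y₁, y₂, E3, ← hab]
    module
  have T2 : ⁅f12, ⁅e12, ⁅f12, ⁅Z, v⁆⁆⁆⁆ =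
      χ.2.2 • ⁅Y, v⁆ + (χ.2.2 + (χ.1 + χ.2.1) + 1) • ⁅f12, ⁅Z, v⁆⁆ := by
    rw [A, lie_add, lie_smul, E4 ⁅e12, v⁆, v₃, lie_add, E2, v₃, lie_smul, lie_smul, lie_smul]
    module
  rw [T1, lie_add, lie_add, lie_smul, lie_smul, T1, T2]
  module

/-- The Lie algebra is generated by `e₁, e₂, f₁, f₂`. -/
theorem sl3_induction {P : sl3 → Prop} (he1 : P e1) (he2 : P e2) (hf1 : P f1) (hf2 : P f2)
    (add : ∀ X Y, P X → P Y → P (X + Y)) (smul : ∀ (c : ℂ) X, P X → P (c • X))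
    (lie : ∀ X Y, P X → P Y → P ⁅X, Y⁆) (X : sl3) : P X := by
  have ht : X.1 0 0 + X.1 1 1 + X.1 2 2 = 0 := by
    have : X.1.trace = 0 := X.2
    rwa [Matrix.trace_fin_three] at this
  have : X = X.1 0 1 • e1 + X.1 1 2 • e2 + X.1 1 0 • f1 + X.1 2 1 • f2 + X.1 0 2 • ⁅e1, e2⁆ +
      X.1 2 0 • ⁅f2, f1⁆ + X.1 0 0 • ⁅e1, f1⁆ + (-X.1 2 2) • ⁅e2, f2⁆ := by
    apply Subtype.ext
    change X.1 = X.1 0 1 • e1.1 + X.1 1 2 • e2.1 + X.1 1 0 • f1.1 + X.1 2 1 • f2.1 +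
      X.1 0 2 • ⁅e1, e2⁆.1 + X.1 2 0 • ⁅f2, f1⁆.1 + X.1 0 0 • ⁅e1, f1⁆.1 +
      (-X.1 2 2) • ⁅e2, f2⁆.1
    have E1 : e1.1 = _ := int_e1
    have E2 : e2.1 = _ := int_e2
    have F1 : f1.1 = _ := int_f1
    have F2 : f2.1 = _ := int_f2
    have E12 : ⁅e1, e2⁆.1 = _ := int_e1.lie int_e2
    have F12 : ⁅f2, f1⁆.1 = _ := int_f2.lie int_f1
    have H1 : ⁅e1, f1⁆.1 = _ := int_e1.lie int_f1
    have H2 : ⁅e2, f2⁆.1 = _ := int_e2.lie int_f2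
    rw [E1, E2, F1, F2, E12, F12, H1, H2]
    ext i j
    fin_cases i <;> fin_cases j <;> simp
    linear_combination ht
  rw [this]
  exact add _ _ (add _ _ (add _ _ (add _ _ (add _ _ (add _ _ (add _ _ (smul _ _ he1)
    (smul _ _ he2)) (smul _ _ hf1)) (smul _ _ hf2)) (smul _ _ (lie _ _ he1 he2)))
    (smul _ _ (lie _ _ hf2 hf1))) (smul _ _ (lie _ _ he1 hf1))) (smul _ _ (lie _ _ he2 hf2))

theorem finSupported_lie_e1 (hM : IsEigenSum M) {η : TwistedDual M} (hη : η ∈ finSupported M) :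
    ⁅e1, η⁆ ∈ finSupported M :=
  finSupported_lower hM (Z := -e2) tau_e1
    ((int_h1.lie int_f1).eq (int_f1.smul (-2)) (by decide))
    ((int_h2.lie int_f1).eq (int_f1.smul (1)) (by decide))
    ((int_f12.lie int_f1).eq .zero (by decide)) ((int_e12.lie int_f1).eq int_e2.neg (by decide))
    ((int_e12.lie int_e2.neg).eq .zero (by decide)) ((int_f12.lie int_e2.neg).eq int_f1 (by decide))
    ((int_h1.lie int_e2.neg).eq (HasInt.smul (-1) int_e2.neg) (by decide))
    ((int_h2.lie int_e2.neg).eq (HasInt.smul (2) int_e2.neg) (by decide)) (by norm_num) hη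

theorem finSupported_lie_e2 (hM : IsEigenSum M) {η : TwistedDual M} (hη : η ∈ finSupported M) :
    ⁅e2, η⁆ ∈ finSupported M :=
  finSupported_lower hM (Z := e1) tau_e2
    ((int_h1.lie int_f2).eq (int_f2.smul (1)) (by decide))
    ((int_h2.lie int_f2).eq (int_f2.smul (-2)) (by decide))
    ((int_f12.lie int_f2).eq .zero (by decide)) ((int_e12.lie int_f2).eq int_e1 (by decide))
    ((int_e12.lie int_e1).eq .zero (by decide)) ((int_f12.lie int_e1).eq int_f2 (by decide))
    ((int_h1.lie int_e1).eq (HasInt.smul (2) int_e1) (by decide))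
    ((int_h2.lie int_e1).eq (HasInt.smul (-1) int_e1) (by decide)) (by norm_num) hη

theorem finSupported_lie_f1 (hM : IsEigenSum M) {η : TwistedDual M} (hη : η ∈ finSupported M) :
    ⁅f1, η⁆ ∈ finSupported M :=
  finSupported_raise hM (Z := f2) tau_f1
    ((int_h1.lie int_e1).eq (int_e1.smul (2)) (by decide))
    ((int_h2.lie int_e1).eq (int_e1.smul (-1)) (by decide))
    ((int_f12.lie int_e1).eq int_f2 (by decide)) ((int_e12.lie int_e1).eq .zero (by decide))
    ((int_e12.lie int_f2).eq int_e1 (by decide)) ((int_f12.lie int_f2).eq .zero (by decide)) hη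

theorem finSupported_lie_f2 (hM : IsEigenSum M) {η : TwistedDual M} (hη : η ∈ finSupported M) :
    ⁅f2, η⁆ ∈ finSupported M :=
  finSupported_raise hM (Z := -f1) tau_f2
    ((int_h1.lie int_e2).eq (int_e2.smul (-1)) (by decide))
    ((int_h2.lie int_e2).eq (int_e2.smul (2)) (by decide))
    ((int_f12.lie int_e2).eq int_f1.neg (by decide)) ((int_e12.lie int_e2).eq .zero (by decide))
    ((int_e12.lie int_f1.neg).eq int_e2 (by decide)) ((int_f12.lie int_f1.neg).eq .zero (by decide)) hη

theorem finSupported_lie (hM : IsEigenSum M) (X : sl3) :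
    ∀ η ∈ finSupported M, ⁅X, η⁆ ∈ finSupported M := by
  induction X using sl3_induction with
  | he1 => exact fun η hη => finSupported_lie_e1 hM hη
  | he2 => exact fun η hη => finSupported_lie_e2 hM hη
  | hf1 => exact fun η hη => finSupported_lie_f1 hM hη
  | hf2 => exact fun η hη => finSupported_lie_f2 hM hη
  | add X Y hX hY =>
    intro η hη
    rw [add_lie]
    exact finSupported_add (hX η hη) (hY η hη)
  | smul c X hX =>
    intro η hη
    rw [smul_lie]
    exact finSupported_smul c (hX η hη)
  | lie X Y hX hY =>
    intro η hη
    rw [lie_lie, sub_eq_add_neg, ← neg_one_smul ℂ]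
    exact finSupported_add (hX _ (hY η hη)) (finSupported_smul _ (hY _ (hX η hη)))

/-- If `M` is the direct sum of the `M_χ`, the dual of `M` consists of the finitely supported
functionals. -/
theorem coe_dual (hM : IsEigenSum M) : (dual M : Set (TwistedDual M)) = finSupported M := by
  let N : LieSubmodule ℂ sl3 (TwistedDual M) :=
    { carrier := finSupported M
      add_mem' := finSupported_add
      zero_mem' := finSupported_zero
      smul_mem' := fun c _ h => finSupported_smul c h
      lie_mem := fun {X η} h => finSupported_lie hM X η h }
  exact congrArg (fun K : LieSubmodule ℂ sl3 (TwistedDual M) => (K : Set (TwistedDual M)))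
    (LieSubmodule.lieSpan_eq N)

end Dual

/-! ### Relaxed Verma modules -/

/-- The parabolic subalgebra `𝔭₁ = ℂ f₁ ⊕ 𝔟`. -/
def p1 : LieSubalgebra ℂ sl3 where
  carrier := {X | X.1 2 0 = 0 ∧ X.1 2 1 = 0}
  add_mem' {X Y} hX hY := ⟨by simp [hX.1, hY.1], by simp [hX.2, hY.2]⟩
  zero_mem' := by simp
  smul_mem' c X hX := ⟨by simp [hX.1], by simp [hX.2]⟩
  lie_mem' {X Y} hX hY := by
    have hX1 : X.1 2 0 = 0 := hX.1
    have hX2 : X.1 2 1 = 0 := hX.2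
    have hY1 : Y.1 2 0 = 0 := hY.1
    have hY2 : Y.1 2 1 = 0 := hY.2
    change (X.1 * Y.1 - Y.1 * X.1) 2 0 = 0 ∧ (X.1 * Y.1 - Y.1 * X.1) 2 1 = 0
    constructor <;>
    simp only [Matrix.sub_apply, Matrix.mul_apply, Fin.sum_univ_three, hX1, hX2, hY1, hY2] <;> ring

theorem cartan_le_p1 {h : sl3} (hh : h ∈ cartan) : h ∈ p1 :=
  ⟨hh 2 0 (by decide), hh 2 1 (by decide)⟩

theorem e1_mem_p1 : e1 ∈ p1 := by constructor <;> simp [e1]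
theorem e2_mem_p1 : e2 ∈ p1 := by constructor <;> simp [e2]
theorem e12_mem_p1 : e12 ∈ p1 := p1.lie_mem e1_mem_p1 e2_mem_p1
theorem f1_mem_p1 : f1 ∈ p1 := by constructor <;> simp [f1]

/-- The universal enveloping algebra `U(𝔰𝔩₃)`. -/
abbrev Usl3 := UniversalEnvelopingAlgebra ℂ sl3
/-- The universal enveloping algebra `U(𝔭₁)`. -/
abbrev Up1 := UniversalEnvelopingAlgebra ℂ p1

/-- The map `𝔭₁ → U(𝔭₁)`. -/
def ιp (X : sl3) (hX : X ∈ p1) : Up1 := UniversalEnvelopingAlgebra.ι ℂ (⟨X, hX⟩ : p1)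

section

attribute [local instance 100] LieRing.ofAssociativeRing

/-- The inclusion `U(𝔭₁) → U(𝔰𝔩₃)`. -/
def UIncl : Up1 →ₐ[ℂ] Usl3 := UniversalEnvelopingAlgebra.lift ℂ
  ((UniversalEnvelopingAlgebra.ι ℂ).comp p1.incl)

end

/-- The left ideal of `U(𝔭₁)` generated by `h - (λ + μ α₁)(h)`, `h ∈ 𝔱`,
`f₁ e₁ + (μ + 1)(μ + λ(h₁))`, `e₂` and `e₁₂`. -/
def topIdeal (lam : Module.Dual ℂ cartan) (μ : ℂ) : Submodule Up1 Up1 :=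
  Submodule.span Up1
    ({r | ∃ h : cartan, r = ιp h (cartan_le_p1 h.2) - algebraMap ℂ Up1 ((lam + μ • alpha1) h)} ∪
      {ιp f1 f1_mem_p1 * ιp e1 e1_mem_p1 +
          algebraMap ℂ Up1 ((μ + 1) * (μ + lam ⟨h1, h1_mem_cartan⟩)),
        ιp e2 e2_mem_p1, ιp e12 e12_mem_p1})

/-- The `𝔭₁`-module `𝓡^{𝔰𝔩₂⁽¹⁾}_{λ(h₁),μ} ⊗ ℂ_λ`: the relaxed Verma module of
`𝔰𝔩₂⁽¹⁾ = ℂ f₁ ⊕ ℂ h₁ ⊕ ℂ e₁`, which is generated by a vector `v` subject to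
`h₁ v = (λ(h₁) + 2 μ) v` and `f₁ e₁ v = -(μ + 1)(μ + λ(h₁)) v`, on which the centre of the Levi
subalgebra `ℂ f₁ ⊕ 𝔱 ⊕ ℂ e₁` acts by `λ` and the nilradical `ℂ e₂ ⊕ ℂ e₁₂` acts by zero. -/
abbrev TopModule (lam : Module.Dual ℂ cartan) (μ : ℂ) : Type := Up1 ⧸ topIdeal lam μ

/-- The relations `u a ⊗ v = u ⊗ a v`, `a ∈ U(𝔭₁)`, in `U(𝔰𝔩₃) ⊗_ℂ V`. -/
def balancing (V : Type) [AddCommGroup V] [Module ℂ V] [Module Up1 V] :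
    Submodule Usl3 (Usl3 ⊗[ℂ] V) :=
  Submodule.span Usl3 {t | ∃ (a : Up1) (v : V), t = UIncl a ⊗ₜ[ℂ] v - 1 ⊗ₜ[ℂ] (a • v)}

/-- The relaxed Verma module `𝓡_{𝔭₁,λ,μ} = U(𝔰𝔩₃) ⊗_{U(𝔭₁)} (𝓡^{𝔰𝔩₂⁽¹⁾}_{λ(h₁),μ} ⊗ ℂ_λ)`. -/
def RVerma (lam : Module.Dual ℂ cartan) (μ : ℂ) : Type :=
  (Usl3 ⊗[ℂ] TopModule lam μ) ⧸ balancing (TopModule lam μ)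

section

variable (lam : Module.Dual ℂ cartan) (μ : ℂ)

instance : AddCommGroup (RVerma lam μ) :=
  inferInstanceAs (AddCommGroup ((Usl3 ⊗[ℂ] TopModule lam μ) ⧸ balancing (TopModule lam μ)))
instance : Module Usl3 (RVerma lam μ) :=
  inferInstanceAs (Module Usl3 ((Usl3 ⊗[ℂ] TopModule lam μ) ⧸ balancing (TopModule lam μ)))
instance : Module ℂ (RVerma lam μ) :=
  inferInstanceAs (Module ℂ ((Usl3 ⊗[ℂ] TopModule lam μ) ⧸ balancing (TopModule lam μ)))
instance : IsScalarTower ℂ Usl3 (RVerma lam μ) :=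
  inferInstanceAs
    (IsScalarTower ℂ Usl3 ((Usl3 ⊗[ℂ] TopModule lam μ) ⧸ balancing (TopModule lam μ)))

/-- `X ∈ 𝔰𝔩₃` acts through `𝔰𝔩₃ → U(𝔰𝔩₃)`. -/
instance : LieRingModule sl3 (RVerma lam μ) where
  bracket X v := UniversalEnvelopingAlgebra.ι ℂ X • v
  add_lie X Y v := by simp only [map_add, add_smul]
  lie_add X v v' := smul_add _ _ _
  leibniz_lie X Y v := by
    simp only [LieHom.map_lie, LieRing.of_associative_ring_bracket, sub_smul, mul_smul,
      sub_add_cancel]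
instance : LieModule ℂ sl3 (RVerma lam μ) where
  smul_lie c X v := by
    change UniversalEnvelopingAlgebra.ι ℂ (c • X) • v = c • UniversalEnvelopingAlgebra.ι ℂ X • v
    rw [map_smul, smul_assoc]
  lie_smul c X v := by
    change UniversalEnvelopingAlgebra.ι ℂ X • c • v = c • UniversalEnvelopingAlgebra.ι ℂ X • v
    rw [← algebraMap_smul Usl3 c v, ← algebraMap_smul Usl3 c (_ • v), smul_smul, smul_smul,
      Algebra.commutes]

/-- The sum of all proper submodules of `𝓡_{𝔭₁,λ,μ}`. -/
def maxSub : LieSubmodule ℂ sl3 (RVerma lam μ) := sSup {N | N ≠ ⊤}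

/-- The unique simple quotient `L_{𝔭₁,λ,μ}` of `𝓡_{𝔭₁,λ,μ}`. -/
abbrev LSimple : Type := RVerma lam μ ⧸ maxSub lam μ

end

end RelaxedSL3

end

open RelaxedSL3

noncomputable section

namespace RelaxedSL3

open Module
open scoped TensorProduct

set_option linter.unusedSectionVars false

/-! Everything is read off from explicit matrices. As `μ₁ + μ₂` is not an integer, `k̄ + l̄` never
is one, and `w_{k,l,m}` is, up to a nonzero scalar, `f₁₂ᵐ u_{k,l,0}` (`lie_f12_w`). Commuting the
other root vectors past `f₁₂` gives their action on the `w` in closed form (`lie_f2_w`, `lie_f1_w`,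
`lie_e1_w`, `lie_e2_w`). The operators `h₁`, `h₂`, `f₁₂ e₁₂` are diagonal with pairwise different
joint eigenvalues (`wEig_injective`), so every submodule of a subquotient `M_J` is spanned by basis
vectors, and the submodule structure depends only on which matrix entries vanish. Moves in the `k`
direction, and in the `m` direction within `m ≥ 0`, are always possible. A step `l → l - 1` carries
the factor `l̄`, and a step `l → l + 1` the factor `l̄(l̄ - 1)`. Hence the levels `l̄ = 0` and `l̄ =
1` and the range `l̄ ≥ 2` each give a simple subquotient.

On the other side, a relaxed Verma module is spanned by `f₂ᵃ f₁₂ᵇ e₁ʲ v` and `f₂ᵃ f₁₂ᵇ f₁ʲ v`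
(`lie_mem_span_pbw`). For `c = 0, 1, 2`, a suitable coordinate functional on the level `l̄ = c`, in
the twisted dual of `M_{l̄ ≥ 0}`, satisfies the relations of the generator for `λ = 0, -ρ, -2α₂`
respectively: the arrow into the level `c` from below is missing, because `c - 1` is negative or a
zero of `l̄(l̄ - 1)`. The images of the spanning vectors are triangular, with nonzero diagonal, with
respect to the coordinate functionals on the levels `l̄ ≥ c` (`pbw_coordFun`). Hence they are
independent, and the relaxed Verma module has a basis indexed by `l̄ ≥ c` whose matrix is
contragredient to that of the `w` (`IsTopIndex.exists_basis`).

The statements follow by comparing matrices. Equal index sets with contragredient matrices give the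
dualities with `M_{l̄ ≥ c}` (`IsEigenBasis.nonempty_equiv_dual`). Passing from `l̄ ≥ c + 1` to `l̄ ≥
c` gives the embeddings, whose cokernels on the level `l̄ = c` are the simple quotients
(`IsTopIndex.exists_embedding`). Finally, `M_{l̄ = c}` for `c ≤ 1` and `M_{l̄ ≥ 2}` are irreducible
and contain a vector satisfying the relations of the generator, so they are simple quotients of the
relaxed Verma modules; combined with the dualities this yields the self-dualities. -/

theorem tau_tau (X : sl3) : tau (tau X) = X := by
  induction X using sl3_induction with
  | he1 => rw [tau_e1, tau_f1]
  | he2 => rw [tau_e2, tau_f2]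
  | hf1 => rw [tau_f1, tau_e1]
  | hf2 => rw [tau_f2, tau_e2]
  | add X Y hX hY => rw [map_add, map_add, hX, hY]
  | smul c X hX => rw [map_smul, map_smul, hX]
  | lie X Y hX hY => rw [LieHom.map_lie, LieHom.map_lie, hX, hY]

/-! ### Modules with a basis of simultaneous eigenvectors -/

section Generic

open scoped Classical

theorem basis_induction {ι V : Type} [AddCommGroup V] [Module ℂ V] (b : Basis ι ℂ V)
    {P : V → Prop} (x : V) (zero : P 0) (coe : ∀ i, P (b i)) (smul : ∀ (c : ℂ) x, P x → P (c • x))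
    (add : ∀ x y, P x → P y → P (x + y)) : P x := by
  have hx : x ∈ Submodule.span ℂ (Set.range b) := by rw [b.span_eq]; trivial
  induction hx using Submodule.span_induction with
  | mem x h => obtain ⟨i, rfl⟩ := h; exact coe i
  | zero => exact zero
  | add x y _ _ hx hy => exact add x y hx hy
  | smul c x _ hx => exact smul c x hx

variable {I : Type} {M R : Type}
  [AddCommGroup M] [Module ℂ M] [LieRingModule sl3 M] [LieModule ℂ sl3 M]
  [AddCommGroup R] [Module ℂ R] [LieRingModule sl3 R] [LieModule ℂ sl3 R]

/-- A bijective homomorphism of `𝔰𝔩₃`-modules is an isomorphism. -/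
def equivOfBijective (f : M →ₗ⁅ℂ, sl3⁆ R) (hf : Function.Bijective f) : M ≃ₗ⁅ℂ, sl3⁆ R :=
  { LinearEquiv.ofBijective (f : M →ₗ[ℂ] R) hf with
    map_lie' := fun {X m} => f.map_lie X m }

/-- The entry at `(p, q)` of `A X` is the coefficient of `b q` in `X b p`. -/
def HasMatrix {J : Set I} (b : Basis J ℂ M) (A : sl3 → I → I → ℂ) : Prop :=
  ∀ X (p q : J), b.repr ⁅X, b p⁆ q = A X p q

/-- The matrix of the contragredient action. -/
def dualMatrix (A : sl3 → I → I → ℂ) (X : sl3) (p q : I) : ℂ := -A (tau X) q p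

/-- The basis `b` consists of simultaneous eigenvectors with pairwise different eigenvalues. -/
structure IsEigenBasis {J : Set I} (b : Basis J ℂ M) (χ : I → ℂ × ℂ × ℂ) : Prop where
  mem : ∀ p : J, b p ∈ eig M (χ p)
  inj : Set.InjOn χ J

/-- When the kernel of `f` is spanned by the basis vectors outside `J`, the coordinates in `J`
descend to the target, and with them the `J × J` block of the matrix. This serves both the
subquotients `M_J` and the quotients of relaxed Verma modules. -/
theorem HasMatrix.exists_basis_of_surjective {J J' : Set I} {b : Basis J' ℂ M}
    {A : sl3 → I → I → ℂ} (hb : HasMatrix b A) (f : M →ₗ⁅ℂ, sl3⁆ R)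
    (hf : Function.Surjective f) (hJ : J ⊆ J')
    (hker : ∀ x, f x = 0 ↔ ∀ p : J', p.1 ∈ J → b.repr x p = 0) :
    ∃ c : Basis J ℂ R, HasMatrix c A ∧ ∀ p : J, c p = f (b (Set.inclusion hJ p)) := by
  have li : LinearIndependent ℂ fun p : J => f (b (Set.inclusion hJ p)) := by
    rw [linearIndependent_iff]
    intro l hl
    have h : f (∑ p ∈ l.support, l p • b (Set.inclusion hJ p)) = 0 := by
      rw [← hl, Finsupp.linearCombination_apply, Finsupp.sum,
        ← LieModuleHom.coe_toLinearMap, map_sum]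
      simp
    ext p
    have := (hker _).1 h (Set.inclusion hJ p) p.2
    rw [map_sum, Finsupp.finsetSum_apply] at this
    simp only [map_smul, Basis.repr_self, Finsupp.smul_apply, smul_eq_mul,
      Finsupp.single_apply, (Set.inclusion_injective hJ).eq_iff] at this
    rw [Finset.sum_eq_single p] at this
    · simpa using this
    · intro q _ hq
      rw [if_neg hq, mul_zero]
    · intro h
      rw [Finsupp.notMem_support_iff.1 h, zero_mul]
  have zero : ∀ p : J', p.1 ∉ J → f (b p) = 0 := by
    intro p hp
    rw [hker]
    intro q hq
    rw [Basis.repr_self, Finsupp.single_apply, if_neg]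
    rintro rfl
    exact hp hq
  have sp : ⊤ ≤ Submodule.span ℂ (Set.range fun p : J => f (b (Set.inclusion hJ p))) := by
    rintro y -
    obtain ⟨x, rfl⟩ := hf y
    induction x using basis_induction b with
    | zero => simp
    | coe p =>
      by_cases hp : p.1 ∈ J
      · exact Submodule.subset_span ⟨⟨p, hp⟩, rfl⟩
      · rw [zero p hp]; exact zero_mem _
    | smul c x hx => rw [map_smul]; exact Submodule.smul_mem _ _ hx
    | add x y hx hy => rw [map_add]; exact add_mem hx hy
  obtain ⟨c, hc⟩ : ∃ c : Basis J ℂ R, ∀ p, c p = f (b (Set.inclusion hJ p)) :=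
    ⟨Basis.mk li sp, fun p => Basis.mk_apply li sp p⟩
  have key : ∀ x (q : J), c.repr (f x) q = b.repr x (Set.inclusion hJ q) := by
    intro x q
    induction x using basis_induction b with
    | zero => simp
    | coe p =>
      by_cases hp : p.1 ∈ J
      · have : f (b p) = c ⟨p, hp⟩ := (hc ⟨p, hp⟩).symm
        rw [this, Basis.repr_self, Basis.repr_self, Finsupp.single_apply, Finsupp.single_apply]
        simp only [Subtype.ext_iff]
      · rw [zero p hp, Basis.repr_self, Finsupp.single_apply, if_neg]
        · simp
        · rintro rfl
          exact hp q.2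
    | smul c x hx => simp [hx]
    | add x y hx hy => simp [hx, hy]
  refine ⟨c, fun X p q => ?_, hc⟩
  rw [hc, ← f.map_lie, key, hb]

/-- Modules are compared through their matrices alone: matching basis vectors with the same index is
equivariant as soon as the matrices agree. -/
theorem HasMatrix.nonempty_equiv {J : Set I} {b : Basis J ℂ M} {c : Basis J ℂ R}
    {A : sl3 → I → I → ℂ} (hb : HasMatrix b A) (hc : HasMatrix c A) :
    Nonempty (M ≃ₗ⁅ℂ, sl3⁆ R) := by
  have h : ∀ (X : sl3) (m : M), b.equiv c (Equiv.refl _) ⁅X, m⁆ = ⁅X, b.equiv c (Equiv.refl _) m⁆ := by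
    intro X m
    induction m using basis_induction b with
    | zero => simp
    | coe p =>
      apply c.repr.injective
      ext q
      rw [Basis.equiv_apply, Equiv.refl_apply, hc, ← hb]
      simp [Basis.equiv]
    | smul c x hx => simp [hx]
    | add x y hx hy => simp [hx, hy]
  exact ⟨{ b.equiv c (Equiv.refl _) with map_lie' := fun {X m} => h X m }⟩

theorem mem_eig {χ : ℂ × ℂ × ℂ} {v : M} : v ∈ eig M χ ↔
    ⁅h1, v⁆ = χ.1 • v ∧ ⁅h2, v⁆ = χ.2.1 • v ∧ ⁅f12, ⁅e12, v⁆⁆ = χ.2.2 • v := Iff.rfl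

/-- The operators `h₁`, `h₂`, `f₁₂ e₁₂`. -/
def eigOp (i : Fin 3) : Module.End ℂ M :=
  ![LieModule.toEnd ℂ sl3 M h1, LieModule.toEnd ℂ sl3 M h2,
    LieModule.toEnd ℂ sl3 M f12 * LieModule.toEnd ℂ sl3 M e12] i

/-- The components of `χ`. -/
def comp (χ : ℂ × ℂ × ℂ) (i : Fin 3) : ℂ := ![χ.1, χ.2.1, χ.2.2] i

theorem comp_ext {χ χ' : ℂ × ℂ × ℂ} (h : ∀ i, comp χ i = comp χ' i) : χ = χ' :=
  Prod.ext (h 0) (Prod.ext (h 1) (h 2))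

theorem mem_eig_iff {χ : ℂ × ℂ × ℂ} {v : M} :
    v ∈ eig M χ ↔ ∀ i, eigOp i v = comp χ i • v := by
  rw [Fin.forall_fin_succ, Fin.forall_fin_two, mem_eig]
  rfl

theorem eigOp_mem (N : LieSubmodule ℂ sl3 M) (i : Fin 3) {x : M} (hx : x ∈ N) :
    eigOp i x ∈ N := by
  fin_cases i
  · exact N.lie_mem hx
  · exact N.lie_mem hx
  · exact N.lie_mem (N.lie_mem hx)

variable {J : Set I} {b : Basis J ℂ M} {χ : I → ℂ × ℂ × ℂ} {A : sl3 → I → I → ℂ}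

theorem IsEigenBasis.repr_eigOp (hχ : IsEigenBasis b χ) (i : Fin 3) (x : M) (p : J) :
    b.repr (eigOp i x) p = comp (χ p) i * b.repr x p := by
  induction x using basis_induction b with
  | zero => simp
  | coe q =>
    rw [mem_eig_iff.1 (hχ.mem q) i, map_smul, Basis.repr_self, Finsupp.smul_apply, smul_eq_mul,
      Finsupp.single_apply]
    split_ifs with h
    · rw [h]
    · simp
  | smul c x hx => simp only [map_smul, Finsupp.smul_apply, smul_eq_mul, hx]; ring
  | add x y hx hy => simp only [map_add, Finsupp.add_apply, hx, hy]; ring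

theorem IsEigenBasis.mem_eig_iff (hχ : IsEigenBasis b χ) {ψ : ℂ × ℂ × ℂ} {x : M} :
    x ∈ eig M ψ ↔ ∀ p, b.repr x p ≠ 0 → χ p = ψ := by
  rw [RelaxedSL3.mem_eig_iff]
  constructor
  · intro h p hp
    refine comp_ext fun i => ?_
    have := hχ.repr_eigOp i x p
    rw [h i, map_smul, Finsupp.smul_apply, smul_eq_mul] at this
    exact (mul_right_cancel₀ hp this).symm
  · intro h i
    apply b.repr.injective
    ext p
    rw [hχ.repr_eigOp, map_smul, Finsupp.smul_apply, smul_eq_mul]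
    by_cases hp : b.repr x p = 0
    · simp [hp]
    · rw [h p hp]

/-- A submodule contains the basis vectors that occur in one of its elements. -/
theorem IsEigenBasis.basis_mem (hχ : IsEigenBasis b χ) (N : LieSubmodule ℂ sl3 M) :
    ∀ (n : ℕ) (x : M), x ∈ N → (b.repr x).support.card ≤ n →
      ∀ p, b.repr x p ≠ 0 → b p ∈ N := by
  intro n
  induction n with
  | zero =>
    intro x _ hc p hp
    rw [Nat.le_zero, Finset.card_eq_zero, Finsupp.support_eq_empty] at hc
    simp [hc] at hp
  | succ n ih =>
    intro x hx hc p hp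
    by_cases hq : ∃ q, q ≠ p ∧ b.repr x q ≠ 0
    · obtain ⟨q, hqp, hq⟩ := hq
      -- Different indices differ in some eigenvalue. Subtracting the scalar `comp (χ q) i` from
      -- that operator erases the coordinate at `q` and keeps the one at `p`, so the support shrinks
      -- while the vector stays in `N`.
      obtain ⟨i, hi⟩ : ∃ i, comp (χ p) i ≠ comp (χ q) i := by
        by_contra! h
        exact hqp (Subtype.ext (hχ.inj q.2 p.2 (comp_ext h).symm))
      have hrepr : ∀ s, b.repr (eigOp i x - comp (χ q) i • x) s =
          (comp (χ s) i - comp (χ q) i) * b.repr x s := by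
        intro s
        rw [map_sub, map_smul, Finsupp.sub_apply, hχ.repr_eigOp, Finsupp.smul_apply, smul_eq_mul]
        ring
      refine ih (eigOp i x - comp (χ q) i • x)
        (sub_mem (eigOp_mem N i hx) (N.smul_mem _ hx)) ?_ p ?_
      · refine Nat.le_of_lt_succ (lt_of_lt_of_le (Finset.card_lt_card ?_) hc)
        refine (Finset.ssubset_iff_of_subset fun s hs => ?_).2 ⟨q, ?_, ?_⟩
        · rw [Finsupp.mem_support_iff, hrepr] at hs
          exact Finsupp.mem_support_iff.2 (right_ne_zero_of_mul hs)
        · exact Finsupp.mem_support_iff.2 hq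
        · rw [Finsupp.mem_support_iff, hrepr, sub_self, zero_mul, not_not]
      · rw [hrepr]
        exact mul_ne_zero (sub_ne_zero.2 hi) hp
    · push Not at hq
      have : x = b.repr x p • b p := by
        apply b.repr.injective
        ext s
        rw [map_smul, Basis.repr_self, Finsupp.smul_apply, Finsupp.single_apply]
        split_ifs with h
        · simp [h]
        · simp [hq s (Ne.symm h)]
      rw [this] at hx
      have := N.smul_mem (b.repr x p)⁻¹ hx
      rwa [smul_smul, inv_mul_cancel₀ hp, one_smul] at this

theorem IsEigenBasis.basis_mem_of_repr (hχ : IsEigenBasis b χ) {N : LieSubmodule ℂ sl3 M} {x : M}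
    (hx : x ∈ N) {p : J} (hp : b.repr x p ≠ 0) : b p ∈ N :=
  hχ.basis_mem N _ x hx le_rfl p hp

/-- The basis vector at `q` is reached from the one at `p`. -/
def Reach (A : sl3 → I → I → ℂ) (J : Set I) : J → J → Prop :=
  Relation.ReflTransGen fun p q => ∃ X, A X p q ≠ 0

/-- Since `τ` is an involution, the contragredient entry at `τ X` is minus the transposed entry at
`X`; every arrow is reversed. -/
theorem Reach.dual {A : sl3 → I → I → ℂ} {p q : J} (h : Reach A J p q) :
    Reach (dualMatrix A) J q p := by
  induction h with
  | refl => exact .refl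
  | tail _ h ih =>
    obtain ⟨X, hX⟩ := h
    refine .head ⟨tau X, ?_⟩ ih
    rw [dualMatrix, tau_tau]
    exact neg_ne_zero.2 hX

theorem IsEigenBasis.mem_of_reach (hχ : IsEigenBasis b χ) (hA : HasMatrix b A)
    {N : LieSubmodule ℂ sl3 M} {p q : J} (h : Reach A J p q) (hp : b p ∈ N) : b q ∈ N := by
  induction h with
  | refl => exact hp
  | @tail s t _ h ih =>
    obtain ⟨X, hX⟩ := h
    exact hχ.basis_mem_of_repr (N.lie_mem (x := X) ih) (by rwa [hA])

omit [LieModule ℂ sl3 M] in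
theorem eq_top_of_basis_mem {N : LieSubmodule ℂ sl3 M} (h : ∀ p, b p ∈ N) : N = ⊤ := by
  rw [← LieSubmodule.toSubmodule_eq_top, ← top_le_iff, ← b.span_eq]
  exact Submodule.span_le.2 (by rintro _ ⟨p, rfl⟩; exact h p)

/-- A nonzero submodule contains some basis vector, because the eigenvalues separate the basis, and
then it contains all those reachable from it. -/
theorem IsEigenBasis.isIrreducible (hχ : IsEigenBasis b χ) (hA : HasMatrix b A) (p₀ : J)
    (h : ∀ p q, Reach A J p q) : LieModule.IsIrreducible ℂ sl3 M := by
  have : Nontrivial M := ⟨⟨b p₀, 0, b.ne_zero p₀⟩⟩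
  refine LieModule.IsIrreducible.mk fun N hN => ?_
  obtain ⟨x, hx, h0⟩ : ∃ x ∈ N, x ≠ 0 := by
    by_contra! hc
    exact hN ((LieSubmodule.eq_bot_iff N).2 hc)
  obtain ⟨p, hp⟩ : ∃ p, b.repr x p ≠ 0 := by
    by_contra! hc
    exact h0 (b.repr.injective (by ext p; simp [hc]))
  exact eq_top_of_basis_mem fun q => hχ.mem_of_reach hA (h p q) (hχ.basis_mem_of_repr hx hp)

/-- Each simultaneous eigenspace is zero or the line through a single basis vector. -/
theorem IsEigenBasis.isEigenSum (hχ : IsEigenBasis b χ) : IsEigenSum M where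
  indep := by
    rw [iSupIndep_iff_finsetSum_eq_zero_imp_eq_zero]
    intro s v hv hs ψ hψ
    apply b.repr.injective
    ext p
    by_contra h
    rw [map_zero, Finsupp.zero_apply] at h
    have hpψ := hχ.mem_eig_iff.1 (hv ψ hψ) p h
    have := congrArg (fun x => b.repr x p) hs
    simp only [map_sum, Finsupp.finsetSum_apply, map_zero, Finsupp.zero_apply] at this
    rw [Finset.sum_eq_single_of_mem ψ hψ] at this
    · exact h this
    · intro ψ' hψ' hne
      by_contra h'
      exact hne ((hχ.mem_eig_iff.1 (hv ψ' hψ') p h').symm.trans hpψ)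
  iSup_eq_top := by
    rw [← top_le_iff, ← b.span_eq]
    refine Submodule.span_le.2 ?_
    rintro _ ⟨p, rfl⟩
    exact Submodule.mem_iSup_of_mem (χ p) (hχ.mem p)
  finite ψ := by
    by_cases h : ∃ p : J, χ p = ψ
    · obtain ⟨p, rfl⟩ := h
      have : eig M (χ p) ≤ Submodule.span ℂ {b p} := by
        intro x hx
        refine Submodule.mem_span_singleton.2 ⟨b.repr x p, ?_⟩
        apply b.repr.injective
        ext q
        rw [map_smul, Basis.repr_self, Finsupp.smul_apply, Finsupp.single_apply]
        split_ifs with h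
        · simp [h]
        · rw [smul_zero]
          by_contra h'
          exact h (Subtype.ext (hχ.inj p.2 q.2 (hχ.mem_eig_iff.1 hx q (Ne.symm h')).symm))
      exact Submodule.finiteDimensional_of_le this
    · have : eig M ψ ≤ ⊥ := by
        intro x hx
        rw [Submodule.mem_bot]
        apply b.repr.injective
        ext q
        by_contra h'
        exact h ⟨q, hχ.mem_eig_iff.1 hx q (by simpa using h')⟩
      exact Submodule.finiteDimensional_of_le this

/-- Modules with contragredient matrices are dual to each other. -/
theorem IsEigenBasis.nonempty_equiv_dual {r : Basis J ℂ R} (hχ : IsEigenBasis r χ)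
    (hb : HasMatrix b A) (hr : HasMatrix r (dualMatrix A)) :
    Nonempty (M ≃ₗ⁅ℂ, sl3⁆ dual R) := by
  -- The two bases are paired index by index: `b p` becomes the coordinate functional of `r` at `p`.
  let g : M →ₗ[ℂ] TwistedDual R := b.constr ℂ fun p => (r.coord p : R →ₗ[ℂ] ℂ)
  have hg : ∀ m q, g m (r q) = b.repr m q := by
    intro m q
    induction m using basis_induction b with
    | zero => rw [map_zero, map_zero]; rfl
    | coe p =>
      have : g (b p) (r q) = r.coord p (r q) := by
        rw [show g (b p) = r.coord p from b.constr_basis ℂ _ p]; rfl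
      rw [this, Basis.coord_apply, Basis.repr_self, Basis.repr_self, Finsupp.single_apply,
        Finsupp.single_apply]
      simp only [eq_comm]
    | smul c x hx =>
      rw [map_smul, map_smul, Finsupp.smul_apply, ← hx]; rfl
    | add x y hx hy =>
      rw [map_add, map_add, Finsupp.add_apply, ← hx, ← hy]; rfl
  have hext : ∀ η θ : TwistedDual R, (∀ q, η (r q) = θ (r q)) → η = θ := fun η θ h =>
    r.ext (f₁ := (η : R →ₗ[ℂ] ℂ)) (f₂ := (θ : R →ₗ[ℂ] ℂ)) h
  have hlin : ∀ (m : M) (x : R), g m x = (r.repr x).sum fun q a => a * b.repr m q := by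
    intro m x
    conv_lhs => rw [← r.linearCombination_repr x, Finsupp.linearCombination_apply, Finsupp.sum]
    rw [Finsupp.sum, show g m (∑ a ∈ (r.repr x).support, (r.repr x) a • r a) =
      ∑ a ∈ (r.repr x).support, g m ((r.repr x) a • r a) from
        map_sum (show R →ₗ[ℂ] ℂ from g m) _ _]
    refine Finset.sum_congr rfl fun q _ => ?_
    rw [← hg]
    exact map_smul (show R →ₗ[ℂ] ℂ from g m) _ _
  have hlie : ∀ (X : sl3) (m : M), g ⁅X, m⁆ = ⁅X, g m⁆ := by
    intro X m
    induction m using basis_induction b with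
    | zero => simp
    | coe p =>
      refine hext _ _ fun q => ?_
      rw [hg, hb, twistedDual_lie_apply, hlin, Finsupp.sum_eq_single p]
      · rw [hr, Basis.repr_self, Finsupp.single_eq_same, dualMatrix, tau_tau, mul_one, neg_neg]
      · intro s _ hs
        rw [Basis.repr_self, Finsupp.single_eq_of_ne hs, mul_zero]
      · simp
    | smul c x hx => rw [lie_smul, map_smul, hx, map_smul, lie_smul]
    | add x y hx hy => rw [lie_add, map_add, hx, hy, map_add, lie_add]
  have hmem : ∀ m, g m ∈ dual R := by
    intro m
    rw [← SetLike.mem_coe, coe_dual hχ.isEigenSum]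
    refine (((b.repr m).support.finite_toSet).image fun p : J => χ p).subset ?_
    rintro ψ ⟨v, hv, hne⟩
    rw [hlin] at hne
    obtain ⟨q, hq, hne⟩ := Finset.exists_ne_zero_of_sum_ne_zero hne
    exact ⟨q, Finsupp.mem_support_iff.2 (right_ne_zero_of_mul hne),
      hχ.mem_eig_iff.1 hv q (left_ne_zero_of_mul hne)⟩
  let f : M →ₗ⁅ℂ, sl3⁆ dual R :=
    { toFun := fun m => ⟨g m, hmem m⟩
      map_add' := fun x y => Subtype.ext (map_add g x y)
      map_smul' := fun c x => Subtype.ext (map_smul g c x)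
      map_lie' := fun {X m} => Subtype.ext (hlie X m) }
  refine ⟨equivOfBijective f ⟨?_, ?_⟩⟩
  · refine (injective_iff_map_eq_zero f).2 fun m hm => ?_
    apply b.repr.injective
    ext q
    rw [← hg, show g m = 0 from congrArg Subtype.val hm, map_zero]
    rfl
  · rintro ⟨η, hη⟩
    rw [← SetLike.mem_coe, coe_dual hχ.isEigenSum] at hη
    -- Injectivity of `χ` on `J` turns finitely many eigenspaces into finitely many basis vectors,
    -- so `η` is a finite combination of coordinate functionals.
    have hfin : {p : J | η (r p) ≠ 0}.Finite := by
      refine Set.Finite.of_finite_image (f := fun p : J => χ p) (Set.Finite.subset hη ?_) ?_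
      · rintro _ ⟨p, hp, rfl⟩
        exact ⟨r p, hχ.mem p, hp⟩
      · intro p _ q _ h
        exact Subtype.ext (hχ.inj p.2 q.2 h)
    refine ⟨∑ p ∈ hfin.toFinset, η (r p) • b p, Subtype.ext (hext _ _ fun q => ?_)⟩
    refine (hg _ q).trans ?_
    rw [map_sum, Finsupp.finsetSum_apply, Finset.sum_eq_single q]
    · simp
    · intro p _ hp
      simp [hp]
    · intro hq
      have : η (r q) = 0 := by simpa using hq
      rw [this]; simp

end Generic

/-! ### The action on the sections `u` -/

section Action

variable (μ₁ μ₂ : ℂ)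

theorem nablaX_mono (k l : ℤ) (m : ℕ) :
    nablaX μ₁ (mono k l m) = bar μ₁ k • mono (k - 1) l m := by
  rw [nablaX, dX, linOfMono_mono, mono_mul, bar, sub_smul]
  simp only [zero_add, neg_add_eq_sub]

theorem nablaY_mono (k l : ℤ) (m : ℕ) :
    nablaY μ₂ (mono k l m) = bar μ₂ l • mono k (l - 1) m := by
  rw [nablaY, dY, linOfMono_mono, mono_mul, bar, sub_smul]
  simp only [zero_add, neg_add_eq_sub]

theorem dZ_mono (k l : ℤ) (m : ℕ) : dZ (mono k l m) = (m : ℂ) • mono k l (m - 1) := by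
  rw [dZ, linOfMono_mono]

theorem secAct_mono (X : sl3) (k l : ℤ) (m : ℕ) : secAct μ₁ μ₂ X (mono k l m) =
    bar μ₁ k • (vf X 0 * mono (k - 1) l m) + bar μ₂ l • (vf X 1 * mono k (l - 1) m) +
      (m : ℂ) • (vf X 2 * mono k l (m - 1)) := by
  simp only [secAct, nablaX_mono, nablaY_mono, dZ_mono, mul_smul_comm]

theorem cst_eq {X : sl3} {A : Matrix (Fin 3) (Fin 3) ℤ} (h : HasInt X A) (i j : Fin 3) :
    cst X i j = (A i j : Coord) := by
  rw [cst, h, Matrix.map_apply]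
  simp

theorem vf_e1 : vf e1 0 = -1 ∧ vf e1 1 = 0 ∧ vf e1 2 = 0 := by
  simp [vf_zero, vf_one, vf_two, conj_zero_one, conj_one_two, conj_zero_two, cst_eq int_e1]
theorem vf_e2 : vf e2 0 = 0 ∧ vf e2 1 = -1 ∧ vf e2 2 = cx := by
  simp [vf_zero, vf_one, vf_two, conj_zero_one, conj_one_two, conj_zero_two, cst_eq int_e2]
theorem vf_e12 : vf e12 0 = 0 ∧ vf e12 1 = 0 ∧ vf e12 2 = -1 := by
  simp [vf_zero, vf_one, vf_two, conj_zero_one, conj_one_two, conj_zero_two, cst_eq int_e12]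
theorem vf_f1 : vf f1 0 = cx * cx ∧ vf f1 1 = -(cz + cx * cy) ∧ vf f1 2 = cx * cz := by
  simp [vf_zero, vf_one, vf_two, conj_zero_one, conj_one_two, conj_zero_two, cst_eq int_f1]
  ring
theorem vf_f2 : vf f2 0 = cz ∧ vf f2 1 = cy * cy ∧ vf f2 2 = 0 := by
  simp [vf_zero, vf_one, vf_two, conj_zero_one, conj_one_two, conj_zero_two, cst_eq int_f2]
  ring
theorem vf_f12 : vf f12 0 = cx * cz ∧ vf f12 1 = cy * cz + cx * cy * cy ∧ vf f12 2 = cz * cz := by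
  simp [vf_zero, vf_one, vf_two, conj_zero_one, conj_one_two, conj_zero_two, cst_eq int_f12]
  refine ⟨?_, ?_, ?_⟩ <;> ring
theorem vf_h1 : vf h1 0 = (-2 : ℂ) • cx ∧ vf h1 1 = cy ∧ vf h1 2 = -cz := by
  rw [show (-2 : ℂ) • cx = -2 * cx by rw [neg_smul, two_smul]; ring]
  simp [vf_zero, vf_one, vf_two, conj_zero_one, conj_one_two, conj_zero_two, cst_eq int_h1]
  try refine ⟨?_, ?_⟩
  all_goals ring
theorem vf_h2 : vf h2 0 = cx ∧ vf h2 1 = (-2 : ℂ) • cy ∧ vf h2 2 = -cz := by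
  rw [show (-2 : ℂ) • cy = -2 * cy by rw [neg_smul, two_smul]; ring]
  simp [vf_zero, vf_one, vf_two, conj_zero_one, conj_one_two, conj_zero_two, cst_eq int_h2]
  try refine ⟨?_, ?_⟩
  all_goals ring

/-- The truncated `m - 1` at `m = 0` is harmless, because the factor `m` vanishes there. -/
theorem smul_pred (m : ℕ) {V : Type} [AddCommGroup V] [Module ℂ V] (g : ℕ → V) :
    (m : ℂ) • g (m - 1 + 1) = (m : ℂ) • g m := by
  cases m <;> simp

theorem lie_h1_u (k l : ℤ) (m : ℕ) :
    ⁅h1, u μ₁ μ₂ k l m⁆ = (-2 * bar μ₁ k + bar μ₂ l - m) • u μ₁ μ₂ k l m := by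
  change secAct μ₁ μ₂ h1 (mono k l m) = (-2 * bar μ₁ k + bar μ₂ l - m) • mono k l m
  simp only [secAct_mono, vf_h1, neg_mul, cx, cy, cz, smul_mul_assoc, mono_mul, zero_add,
    add_sub_cancel, smul_neg, add_comm 1 (m - 1), smul_pred m (mono k l)]
  module

theorem lie_h2_u (k l : ℤ) (m : ℕ) :
    ⁅h2, u μ₁ μ₂ k l m⁆ = (bar μ₁ k - 2 * bar μ₂ l - m) • u μ₁ μ₂ k l m := by
  change secAct μ₁ μ₂ h2 (mono k l m) = (bar μ₁ k - 2 * bar μ₂ l - m) • mono k l m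
  simp only [secAct_mono, vf_h2, neg_mul, cx, cy, cz, smul_mul_assoc, mono_mul, zero_add,
    add_sub_cancel, smul_neg, add_comm 1 (m - 1), smul_pred m (mono k l)]
  module

/-- `f₁₂` is needed for all `m`, since it raises `m` and drives the induction. For the other root
vectors the case `m = 0` suffices. -/
theorem lie_f12_u (k l : ℤ) (m : ℕ) : ⁅f12, u μ₁ μ₂ k l m⁆ =
    (bar μ₁ k + bar μ₂ l + m) • u μ₁ μ₂ k l (m + 1) +
      bar μ₂ l • u μ₁ μ₂ (k + 1) (l + 1) m := by
  change secAct μ₁ μ₂ f12 (mono k l m) = (bar μ₁ k + bar μ₂ l + m) • mono k l (m + 1) +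
      bar μ₂ l • mono (k + 1) (l + 1) m
  have h := smul_pred m fun n => mono k l (n + 1)
  simp only [secAct_mono, vf_f12, add_mul, cx, cy, cz, mono_mul, zero_add, add_zero,
    show 1 + (k - 1) = k by ring, show 1 + (l - 1) = l by ring,
    show 1 + 1 + (l - 1) = l + 1 by ring, show 1 + 1 + (m - 1) = m - 1 + 1 + 1 by ring, h,
    add_comm 1 m, add_comm 1 k]
  module

theorem lie_e1_u (k l : ℤ) : ⁅e1, u μ₁ μ₂ k l 0⁆ = -bar μ₁ k • u μ₁ μ₂ (k - 1) l 0 := by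
  change secAct μ₁ μ₂ e1 (mono k l 0) = -bar μ₁ k • mono (k - 1) l 0
  simp [secAct_mono, vf_e1]

theorem lie_e12_u (k l : ℤ) : ⁅e12, u μ₁ μ₂ k l 0⁆ = 0 := by
  change secAct μ₁ μ₂ e12 (mono k l 0) = 0
  simp [secAct_mono, vf_e12]

theorem lie_e2_u (k l : ℤ) : ⁅e2, u μ₁ μ₂ k l 0⁆ = -bar μ₂ l • u μ₁ μ₂ k (l - 1) 0 := by
  change secAct μ₁ μ₂ e2 (mono k l 0) = -bar μ₂ l • mono k (l - 1) 0
  simp [secAct_mono, vf_e2]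

theorem lie_f1_u (k l : ℤ) : ⁅f1, u μ₁ μ₂ k l 0⁆ =
    (bar μ₁ k - bar μ₂ l) • u μ₁ μ₂ (k + 1) l 0 - bar μ₂ l • u μ₁ μ₂ k (l - 1) 1 := by
  change secAct μ₁ μ₂ f1 (mono k l 0) =
    (bar μ₁ k - bar μ₂ l) • mono (k + 1) l 0 - bar μ₂ l • mono k (l - 1) 1
  simp only [secAct_mono, vf_f1, add_mul, neg_mul, cx, cy, cz, mono_mul, zero_add, add_zero,
    show 1 + 1 + (k - 1) = k + 1 by ring, show 1 + (l - 1) = l by ring, add_comm 1 k,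
    Nat.cast_zero, zero_smul]
  module

theorem lie_f2_u (k l : ℤ) : ⁅f2, u μ₁ μ₂ k l 0⁆ =
    bar μ₁ k • u μ₁ μ₂ (k - 1) l 1 + bar μ₂ l • u μ₁ μ₂ k (l + 1) 0 := by
  change secAct μ₁ μ₂ f2 (mono k l 0) =
    bar μ₁ k • mono (k - 1) l 1 + bar μ₂ l • mono k (l + 1) 0
  simp only [secAct_mono, vf_f2, cy, cz, mono_mul, zero_add, add_zero,
    show 1 + 1 + (l - 1) = l + 1 by ring, Nat.cast_zero, zero_smul]

/-! ### The action on the vectors `w` -/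

theorem bar_add (μ : ℂ) (k n : ℤ) : bar μ (k + n) = bar μ k + n := by
  simp only [bar]; push_cast; ring
theorem bar_add_one (μ : ℂ) (k : ℤ) : bar μ (k + 1) = bar μ k + 1 := by
  simp only [bar]; push_cast; ring
theorem bar_sub_one (μ : ℂ) (k : ℤ) : bar μ (k - 1) = bar μ k - 1 := by
  simp only [bar]; push_cast; ring

variable {μ₁ μ₂}

/-- The coefficient of `u_{k+n,l+n,m-n}` in `w_{k,l,m}`. -/
def wCoeff (L S : ℂ) (m n : ℕ) : ℂ := (m.choose n : ℂ) * (rising L n / rising S n)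

theorem w_eq (k l : ℤ) (m : ℕ) : w μ₁ μ₂ (k, l, m) =
    ∑ n ∈ Finset.range (m + 1), wCoeff (bar μ₂ l) (bar μ₁ k + bar μ₂ l) m n •
      u μ₁ μ₂ (k + n) (l + n) (m - n) := rfl

theorem rising_zero (x : ℂ) : rising x 0 = 1 := by simp [rising]
theorem rising_succ (x : ℂ) (n : ℕ) : rising x (n + 1) = rising x n * (x + n) := by
  rw [rising, Finset.prod_range_succ, rising]

theorem w_zero (k l : ℤ) : w μ₁ μ₂ (k, l, 0) = u μ₁ μ₂ k l 0 := by
  simp [w_eq, wCoeff, rising_zero]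

theorem w_one (k l : ℤ) : w μ₁ μ₂ (k, l, 1) = u μ₁ μ₂ k l 1 +
    (bar μ₂ l / (bar μ₁ k + bar μ₂ l)) • u μ₁ μ₂ (k + 1) (l + 1) 0 := by
  simp [w_eq, Finset.sum_range_succ, wCoeff, rising_zero, rising_succ]

/-- The recursion behind the choice of coefficients. Once the rising factorials are taken out, it is
Pascal's rule together with `(n + 1) C(m, n + 1) = (m - n) C(m, n)`. -/
theorem wCoeff_succ {L S : ℂ} (hS : ∀ n : ℕ, S + n ≠ 0) (m n : ℕ) :
    (S + m) * wCoeff L S (m + 1) (n + 1) =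
      (S + m + (n + 1)) * wCoeff L S m (n + 1) + (L + n) * wCoeff L S m n := by
  have h1 : rising S (n + 1) ≠ 0 := Finset.prod_ne_zero_iff.2 fun i _ => hS i
  have h2 : rising S n ≠ 0 := Finset.prod_ne_zero_iff.2 fun i _ => hS i
  have h3 : ((n : ℂ) + 1) * (m.choose (n + 1) : ℂ) = (m - n) * m.choose n := by
    rcases le_or_gt n m with h | h
    · have := Nat.choose_succ_right_eq m n
      have h' : ((m.choose (n + 1) * (n + 1) : ℕ) : ℂ) = ((m.choose n * (m - n) : ℕ) : ℂ) := by
        rw [this]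
      push_cast [h] at h'
      linear_combination h'
    · rw [Nat.choose_eq_zero_of_lt h, Nat.choose_eq_zero_of_lt (by omega)]; simp
  simp only [wCoeff, Nat.choose_succ_succ, Nat.cast_add]
  rw [rising_succ] at h1
  have h4 : S + n ≠ 0 := hS n
  rw [rising_succ, rising_succ]
  field_simp
  linear_combination (-(L + n) * rising L n) * h3

theorem wCoeff_zero (L S : ℂ) (m : ℕ) : wCoeff L S m 0 = 1 := by
  simp [wCoeff, rising_zero]
theorem wCoeff_of_lt (L S : ℂ) {m n : ℕ} (h : m < n) : wCoeff L S m n = 0 := by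
  simp [wCoeff, Nat.choose_eq_zero_of_lt h]

/-- This explains the definition of `w`: iterating, `f₁₂ᵐ w_{k,l,0}` is `w_{k,l,m}` times the rising
factorial of `k̄ + l̄`, so each string in `m` is generated by `u_{k,l,0}`. -/
theorem lie_f12_w {k l : ℤ} (hS : ∀ n : ℕ, bar μ₁ k + bar μ₂ l + n ≠ 0) (m : ℕ) :
    ⁅f12, w μ₁ μ₂ (k, l, m)⁆ = (bar μ₁ k + bar μ₂ l + m) • w μ₁ μ₂ (k, l, m + 1) := by
  rw [w_eq, w_eq, lie_sum, Finset.smul_sum, Finset.sum_range_succ' _ (m + 1)]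
  have hl : ∀ n ∈ Finset.range (m + 1), ⁅f12, wCoeff (bar μ₂ l) (bar μ₁ k + bar μ₂ l) m n •
      u μ₁ μ₂ (k + n) (l + n) (m - n)⁆ =
      (wCoeff (bar μ₂ l) (bar μ₁ k + bar μ₂ l) m n * (bar μ₁ k + bar μ₂ l + m + n)) •
        u μ₁ μ₂ (k + n) (l + n) (m + 1 - n) +
      (wCoeff (bar μ₂ l) (bar μ₁ k + bar μ₂ l) m n * (bar μ₂ l + n)) •
        u μ₁ μ₂ (k + (n + 1 : ℕ)) (l + (n + 1 : ℕ)) (m + 1 - (n + 1)) := by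
    intro n hn
    have hnm : n ≤ m := Nat.lt_succ_iff.1 (Finset.mem_range.1 hn)
    rw [lie_smul, lie_f12_u, smul_add, smul_smul, smul_smul, ← Nat.sub_add_comm hnm, bar_add,
      bar_add, Nat.add_sub_add_right]
    push_cast [hnm]
    rw [add_assoc k, add_assoc l]
    congr 3
    ring
  rw [Finset.sum_congr rfl hl, Finset.sum_add_distrib, Finset.sum_range_succ' _ m, add_right_comm]
  congr 1
  -- The term for `m + 1` has a vanishing binomial coefficient; it is added so that both sums run
  -- over the same range.
  · have hz : ∀ x : Sec μ₁ μ₂, (wCoeff (bar μ₂ l) (bar μ₁ k + bar μ₂ l) m (m + 1) *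
        (bar μ₁ k + bar μ₂ l + m + (m + 1 : ℕ))) • x = 0 := fun x => by
      rw [wCoeff_of_lt _ _ (Nat.lt_succ_self m), zero_mul, zero_smul]
    have := Finset.sum_range_succ (fun n : ℕ =>
      (wCoeff (bar μ₂ l) (bar μ₁ k + bar μ₂ l) m (n + 1) *
        (bar μ₁ k + bar μ₂ l + m + (n + 1 : ℕ))) •
          u μ₁ μ₂ (k + (n + 1 : ℕ)) (l + (n + 1 : ℕ)) (m + 1 - (n + 1))) m
    rw [hz, add_zero] at this
    rw [← this, ← Finset.sum_add_distrib]
    refine Finset.sum_congr rfl fun n _ => ?_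
    rw [← add_smul, smul_smul, wCoeff_succ hS]
    push_cast
    congr 1
    ring
  · simp [wCoeff_zero]

end Action

/-! ### Structure constants of `𝔰𝔩₃` -/

theorem lie_h1_e1 : ⁅h1, e1⁆ = (2 : ℂ) • e1 := by
  simpa using (int_h1.lie int_e1).eq (int_e1.smul 2) (by decide)
theorem lie_h2_e1 : ⁅h2, e1⁆ = (-1 : ℂ) • e1 := by
  simpa using (int_h2.lie int_e1).eq (int_e1.smul (-1)) (by decide)
theorem lie_h1_f1 : ⁅h1, f1⁆ = (-2 : ℂ) • f1 := by
  simpa using (int_h1.lie int_f1).eq (int_f1.smul (-2)) (by decide)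
theorem lie_h2_f1 : ⁅h2, f1⁆ = f1 := (int_h2.lie int_f1).eq int_f1 (by decide)
theorem lie_h2_f2 : ⁅h2, f2⁆ = (-2 : ℂ) • f2 := by
  simpa using (int_h2.lie int_f2).eq (int_f2.smul (-2)) (by decide)
theorem lie_h1_f12 : ⁅h1, f12⁆ = -f12 := (int_h1.lie int_f12).eq int_f12.neg (by decide)
theorem lie_h2_f12 : ⁅h2, f12⁆ = -f12 := (int_h2.lie int_f12).eq int_f12.neg (by decide)
theorem lie_e1_f12 : ⁅e1, f12⁆ = -f2 := (int_e1.lie int_f12).eq int_f2.neg (by decide)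
theorem lie_e2_f12 : ⁅e2, f12⁆ = f1 := (int_e2.lie int_f12).eq int_f1 (by decide)
theorem lie_f1_f12 : ⁅f1, f12⁆ = 0 := (int_f1.lie int_f12).eq .zero (by decide)
theorem lie_f2_f12 : ⁅f2, f12⁆ = 0 := (int_f2.lie int_f12).eq .zero (by decide)
theorem lie_e1_f2 : ⁅e1, f2⁆ = 0 := (int_e1.lie int_f2).eq .zero (by decide)
theorem lie_e2_f1 : ⁅e2, f1⁆ = 0 := (int_e2.lie int_f1).eq .zero (by decide)
theorem lie_e1_f1 : ⁅e1, f1⁆ = h1 := (int_e1.lie int_f1).eq int_h1 (by decide)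
theorem lie_e2_f2 : ⁅e2, f2⁆ = h2 := (int_e2.lie int_f2).eq int_h2 (by decide)
theorem lie_f1_f2 : ⁅f1, f2⁆ = -f12 := (int_f1.lie int_f2).eq int_f12.neg (by decide)
theorem lie_e12_f1 : ⁅e12, f1⁆ = -e2 := (int_e12.lie int_f1).eq int_e2.neg (by decide)
theorem lie_e12_e1 : ⁅e12, e1⁆ = 0 := (int_e12.lie int_e1).eq .zero (by decide)
theorem lie_e2_e1 : ⁅e2, e1⁆ = -e12 := (int_e2.lie int_e1).eq int_e12.neg (by decide)

section Action

variable {μ₁ μ₂ : ℂ}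

/-- The nonintegrality hypothesis enters here. It keeps all denominators nonzero, prevents `f₁₂`
from killing a `w`, and lets the eigenvalues separate the basis. -/
theorem wt_add_ne (hμ : ∀ n : ℤ, μ₁ + μ₂ ≠ n) (k l n : ℤ) : bar μ₁ k + bar μ₂ l + n ≠ 0 := by
  intro h
  apply hμ (k + l + n)
  simp only [bar] at h
  push_cast
  linear_combination -h

variable (hμ : ∀ n : ℤ, μ₁ + μ₂ ≠ n) (k l : ℤ) (m : ℕ)
include hμ

theorem wt_ne : bar μ₁ k + bar μ₂ l ≠ 0 := by simpa using wt_add_ne hμ k l 0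
theorem wt_sub_one_ne : bar μ₁ k + bar μ₂ l - 1 ≠ 0 := by
  simpa [sub_eq_add_neg] using wt_add_ne hμ k l (-1)
theorem wt_add_nat_ne : bar μ₁ k + bar μ₂ l + m ≠ 0 := by
  simpa using wt_add_ne hμ k l m

theorem lie_f12_w' : ⁅f12, w μ₁ μ₂ (k, l, m)⁆ =
    (bar μ₁ k + bar μ₂ l + m) • w μ₁ μ₂ (k, l, m + 1) :=
  lie_f12_w (fun n => by simpa using wt_add_ne hμ k l n) m

theorem smul_lie_f12_w_pred : (m : ℂ) • ⁅f12, w μ₁ μ₂ (k, l, m - 1)⁆ =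
    (m * (bar μ₁ k + bar μ₂ l + m - 1)) • w μ₁ μ₂ (k, l, m) := by
  cases m with
  | zero => simp
  | succ m =>
    rw [Nat.add_sub_cancel, lie_f12_w' hμ, smul_smul]
    congr 1
    push_cast
    ring

/-- Induction on `m` for the action of `X` on `w_{k,l,m}`. -/
theorem lie_w_succ {X : sl3} {y : Sec μ₁ μ₂}
    (h : ⁅⁅X, f12⁆, w μ₁ μ₂ (k, l, m)⁆ + ⁅f12, ⁅X, w μ₁ μ₂ (k, l, m)⁆⁆ =
      (bar μ₁ k + bar μ₂ l + m) • y) :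
    ⁅X, w μ₁ μ₂ (k, l, m + 1)⁆ = y := by
  -- `f₁₂ w_m` is a nonzero multiple of `w_{m+1}`, so `X w_{m+1}` is determined by `X f₁₂ w_m = [X,
  -- f₁₂] w_m + f₁₂ X w_m`.
  apply smul_right_injective _ (wt_add_nat_ne hμ k l m)
  change (_ : ℂ) • _ = (_ : ℂ) • _
  rw [← h, ← lie_smul, ← lie_f12_w' hμ, leibniz_lie]

theorem lie_h1_w : ⁅h1, w μ₁ μ₂ (k, l, m)⁆ =
    (-2 * bar μ₁ k + bar μ₂ l - m) • w μ₁ μ₂ (k, l, m) := by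
  induction m with
  | zero => rw [w_zero, lie_h1_u]
  | succ m ih =>
    refine lie_w_succ hμ k l m ?_
    rw [ih, lie_h1_f12, neg_lie, lie_smul, lie_f12_w' hμ]
    push_cast
    module

theorem lie_h2_w : ⁅h2, w μ₁ μ₂ (k, l, m)⁆ =
    (bar μ₁ k - 2 * bar μ₂ l - m) • w μ₁ μ₂ (k, l, m) := by
  induction m with
  | zero => rw [w_zero, lie_h2_u]
  | succ m ih =>
    refine lie_w_succ hμ k l m ?_
    rw [ih, lie_h2_f12, neg_lie, lie_smul, lie_f12_w' hμ]
    push_cast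
    module

/-- For fixed `k` and `l`, the vectors `w_{k,l,m}` form a string for the `𝔰𝔩₂`-triple `e₁₂`, `h₁ +
h₂`, `f₁₂`, whose end `m = 0` is killed by `e₁₂`. -/
theorem lie_e12_w : ⁅e12, w μ₁ μ₂ (k, l, m)⁆ = (-m : ℂ) • w μ₁ μ₂ (k, l, m - 1) := by
  induction m with
  | zero => rw [w_zero, lie_e12_u]; simp
  | succ m ih =>
    refine lie_w_succ hμ k l m ?_
    rw [ih, lie_e12_f12, add_lie, lie_h1_w hμ, lie_h2_w hμ, lie_smul, neg_smul,
      smul_lie_f12_w_pred hμ, Nat.add_sub_cancel]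
    push_cast
    module

/-- `f₂` commutes with `f₁₂`, so the formula propagates from `m = 0`. There, trading `u_{k-1,l,1}`
for `w_{k-1,l,1}` changes the coefficient of `u_{k,l+1,0}` from `l̄` to `l̄(l̄ - 1)/(k̄ + l̄ - 1)`.
The zeros `l̄ = 0, 1` block the way up in `l`. -/
theorem lie_f2_w : ⁅f2, w μ₁ μ₂ (k, l, m)⁆ = bar μ₁ k • w μ₁ μ₂ (k - 1, l, m + 1) +
    (bar μ₂ l * (bar μ₂ l - 1) * (m + (bar μ₁ k + bar μ₂ l)) /
      ((bar μ₁ k + bar μ₂ l) * (bar μ₁ k + bar μ₂ l - 1))) • w μ₁ μ₂ (k, l + 1, m) := by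
  have h0 := wt_ne hμ k l
  have h1 := wt_sub_one_ne hμ k l
  induction m with
  | zero =>
    rw [w_zero, w_zero, lie_f2_u, w_one, bar_sub_one, sub_add_cancel]
    match_scalars
    · ring
    · rw [show bar μ₁ k - 1 + bar μ₂ l = bar μ₁ k + bar μ₂ l - 1 by ring]
      field_simp
      ring
  | succ m ih =>
    refine lie_w_succ hμ k l m ?_
    rw [ih, lie_f2_f12, zero_lie, lie_add, lie_smul, lie_smul, lie_f12_w' hμ, lie_f12_w' hμ,
      bar_sub_one, bar_add_one]
    match_scalars
    · ring
    · field_simp; ring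

theorem lie_f1_w : ⁅f1, w μ₁ μ₂ (k, l, m)⁆ = -bar μ₂ l • w μ₁ μ₂ (k, l - 1, m + 1) +
    (bar μ₁ k * (bar μ₁ k - 1) * (m + (bar μ₁ k + bar μ₂ l)) /
      ((bar μ₁ k + bar μ₂ l) * (bar μ₁ k + bar μ₂ l - 1))) • w μ₁ μ₂ (k + 1, l, m) := by
  have h0 := wt_ne hμ k l
  have h1 := wt_sub_one_ne hμ k l
  induction m with
  | zero =>
    rw [w_zero, w_zero, lie_f1_u, w_one, bar_sub_one, sub_add_cancel]
    match_scalars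
    · rw [show bar μ₁ k + (bar μ₂ l - 1) = bar μ₁ k + bar μ₂ l - 1 by ring]
      field_simp
      ring
    · ring
  | succ m ih =>
    refine lie_w_succ hμ k l m ?_
    rw [ih, lie_f1_f12, zero_lie, lie_add, lie_smul, lie_smul, lie_f12_w' hμ, lie_f12_w' hμ,
      bar_sub_one, bar_add_one]
    match_scalars
    · ring
    · field_simp; ring

/-- As `[e₁, f₁₂] = -f₂`, the formula for `f₂` feeds the induction; for `e₂` the formula for `f₁`
plays this role, by `[e₂, f₁₂] = f₁`. -/
theorem lie_e1_w : ⁅e1, w μ₁ μ₂ (k, l, m)⁆ = -bar μ₁ k • w μ₁ μ₂ (k - 1, l, m) +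
    (-(bar μ₂ l * (bar μ₂ l - 1)) /
      ((bar μ₁ k + bar μ₂ l) * (bar μ₁ k + bar μ₂ l - 1)) * m) • w μ₁ μ₂ (k, l + 1, m - 1) := by
  have h0 := wt_ne hμ k l
  have h1 := wt_sub_one_ne hμ k l
  induction m with
  | zero => simp [w_zero, lie_e1_u]
  | succ m ih =>
    refine lie_w_succ hμ k l m ?_
    rw [ih, lie_e1_f12, neg_lie, lie_f2_w hμ, lie_add, lie_smul, lie_smul, mul_smul,
      smul_lie_f12_w_pred hμ, lie_f12_w' hμ, bar_sub_one, bar_add_one, Nat.add_sub_cancel]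
    match_scalars
    · ring
    · field_simp; ring

theorem lie_e2_w : ⁅e2, w μ₁ μ₂ (k, l, m)⁆ = -bar μ₂ l • w μ₁ μ₂ (k, l - 1, m) +
    ((bar μ₁ k * (bar μ₁ k - 1)) /
      ((bar μ₁ k + bar μ₂ l) * (bar μ₁ k + bar μ₂ l - 1)) * m) • w μ₁ μ₂ (k + 1, l, m - 1) := by
  have h0 := wt_ne hμ k l
  have h1 := wt_sub_one_ne hμ k l
  induction m with
  | zero => simp [w_zero, lie_e2_u]
  | succ m ih =>
    refine lie_w_succ hμ k l m ?_
    rw [ih, lie_e2_f12, lie_f1_w hμ, lie_add, lie_smul, lie_smul, mul_smul,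
      smul_lie_f12_w_pred hμ, lie_f12_w' hμ, bar_sub_one, bar_add_one, Nat.add_sub_cancel]
    match_scalars
    · ring
    · field_simp; ring

end Action

/-! ### Triangular families -/

section Triangular

variable {ι V : Type} [AddCommGroup V] [Module ℂ V] {B v : ι → V} {ht : ι → ℕ} {d : ι → ℂ}

/-- Induction on the height: `d p` is invertible and the corrections to `d p • B p` are strictly
lower. -/
theorem span_range_eq_of_triangular (hd : ∀ p, d p ≠ 0)
    (hv : ∀ p, v p - d p • B p ∈ Submodule.span ℂ (B '' {q | ht q < ht p})) :
    Submodule.span ℂ (Set.range v) = Submodule.span ℂ (Set.range B) := by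
  apply le_antisymm
  · refine Submodule.span_le.2 ?_
    rintro _ ⟨p, rfl⟩
    have := Submodule.span_mono (Set.image_subset_range _ _) (hv p)
    rw [← sub_add_cancel (v p) (d p • B p)]
    exact add_mem this (Submodule.smul_mem _ _ (Submodule.subset_span ⟨p, rfl⟩))
  · refine Submodule.span_le.2 ?_
    have : ∀ n p, ht p < n → B p ∈ Submodule.span ℂ (Set.range v) := by
      intro n
      induction n with
      | zero => intro p hp; omega
      | succ n ih =>
        intro p hp
        have h : Submodule.span ℂ (B '' {q | ht q < ht p}) ≤ Submodule.span ℂ (Set.range v) := by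
          refine Submodule.span_le.2 ?_
          rintro _ ⟨q, hq, rfl⟩
          have hq' : ht q < ht p := hq
          exact ih q (by omega)
        have h2 := sub_mem (Submodule.subset_span (Set.mem_range_self p)) (h (hv p))
        rw [sub_sub_cancel] at h2
        simpa [smul_smul, hd p] using Submodule.smul_mem _ (d p)⁻¹ h2
    rintro _ ⟨p, rfl⟩
    exact this _ p (Nat.lt_succ_self _)

theorem linearIndependent_of_triangular {φ : ι → V →ₗ[ℂ] ℂ} (hd : ∀ p, d p ≠ 0)
    (hφ : ∀ p q, p ≠ q → φ p (B q) = 0) (hφ' : ∀ p, φ p (B p) = 1)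
    (hv : ∀ p, v p - d p • B p ∈ Submodule.span ℂ (B '' {q | ht q < ht p})) :
    LinearIndependent ℂ v := by
  have key : ∀ p q, ht q ≤ ht p → φ p (v q - d q • B q) = 0 := by
    intro p q h
    have : Submodule.span ℂ (B '' {s | ht s < ht q}) ≤ LinearMap.ker (φ p) := by
      refine Submodule.span_le.2 ?_
      rintro _ ⟨s, hs, rfl⟩
      have hs' : ht s < ht q := hs
      refine hφ p s ?_
      rintro rfl
      omega
    exact this (hv q)
  rw [linearIndependent_iff']
  intro s g hg
  by_contra! hc
  obtain ⟨i, his, hi⟩ := hc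
  classical
  -- At an index of maximal height among those with nonzero coefficient, the functional `φ p` sees
  -- only the diagonal term.
  obtain ⟨p, hp, hmax⟩ := (s.filter fun i => g i ≠ 0).exists_max_image ht
    ⟨i, Finset.mem_filter.2 ⟨his, hi⟩⟩
  rw [Finset.mem_filter] at hp
  have := congrArg (φ p) hg
  rw [map_sum, map_zero, Finset.sum_eq_single_of_mem p hp.1] at this
  · have h := key p p le_rfl
    rw [map_sub, map_smul, hφ', sub_eq_zero] at h
    rw [map_smul, h] at this
    simp [hp.2, hd p] at this
  · intro q hq hqp
    by_cases h0 : g q = 0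
    · simp [h0]
    · have h := key p q (hmax q (Finset.mem_filter.2 ⟨hq, h0⟩))
      rw [map_sub, map_smul, hφ p q hqp.symm, sub_eq_zero] at h
      rw [map_smul, h]; simp

end Triangular

/-! ### The basis `w` and the subquotients of `M` -/

section Sections

variable (μ₁ μ₂ : ℂ)

theorem span_u : Submodule.span ℂ
    (Set.range fun p : ℤ × ℤ × ℕ => u μ₁ μ₂ p.1 p.2.1 p.2.2) = ⊤ := by
  rw [eq_top_iff]
  rintro x -
  refine mono_induction (P := fun x : Coord => (show Sec μ₁ μ₂ from x) ∈ Submodule.span ℂ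
    (Set.range fun p : ℤ × ℤ × ℕ => u μ₁ μ₂ p.1 p.2.1 p.2.2)) x ?_ ?_ ?_ ?_
  · exact zero_mem _
  · exact fun p q hp hq => add_mem hp hq
  · exact fun c p hp => Submodule.smul_mem _ c hp
  · exact fun k l m => Submodule.subset_span ⟨(k, l, m), rfl⟩

/-- The coefficient of `u_p`. -/
def uCoord (p : ℤ × ℤ × ℕ) : Sec μ₁ μ₂ →ₗ[ℂ] ℂ :=
  Finsupp.lapply p ∘ₗ (AddMonoidAlgebra.coeffLinearEquiv ℂ).toLinearMap

theorem uCoord_u (p q : ℤ × ℤ × ℕ) :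
    uCoord μ₁ μ₂ p (u μ₁ μ₂ q.1 q.2.1 q.2.2) = Finsupp.single q (1 : ℂ) p := by
  change ((AddMonoidAlgebra.coeffLinearEquiv ℂ) (AddMonoidAlgebra.single q (1 : ℂ))) p = _
  simp

/-- The term `n = 0` of the sum is `u_p`, and all others have a smaller power of `z`. -/
theorem w_triangular (p : ℤ × ℤ × ℕ) :
    w μ₁ μ₂ p - (1 : ℂ) • u μ₁ μ₂ p.1 p.2.1 p.2.2 ∈ Submodule.span ℂ
      ((fun q : ℤ × ℤ × ℕ => u μ₁ μ₂ q.1 q.2.1 q.2.2) '' {q | q.2.2 < p.2.2}) := by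
  obtain ⟨k, l, m⟩ := p
  rw [w_eq, Finset.sum_range_succ', wCoeff_zero]
  simp only [Nat.cast_zero, add_zero, Nat.sub_zero, add_sub_cancel_right]
  refine sum_mem fun n hn => Submodule.smul_mem _ _ (Submodule.subset_span
    ⟨(k + (n + 1 : ℕ), l + (n + 1 : ℕ), m - (n + 1)), ?_, rfl⟩)
  have := Finset.mem_range.1 hn
  change m - (n + 1) < m
  omega

theorem span_w : Submodule.span ℂ (Set.range (w μ₁ μ₂)) = ⊤ := by
  rw [← span_u μ₁ μ₂]
  exact span_range_eq_of_triangular (fun _ => one_ne_zero) (w_triangular μ₁ μ₂)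

theorem linearIndependent_w : LinearIndependent ℂ (w μ₁ μ₂) :=
  linearIndependent_of_triangular (φ := uCoord μ₁ μ₂) (fun _ => one_ne_zero)
    (fun p q h => by rw [uCoord_u, Finsupp.single_eq_of_ne h])
    (fun p => by rw [uCoord_u, Finsupp.single_eq_same]) (w_triangular μ₁ μ₂)

/-- The basis `w`. -/
def wBasis : Basis (ℤ × ℤ × ℕ) ℂ (Sec μ₁ μ₂) :=
  Basis.mk (linearIndependent_w μ₁ μ₂) (span_w μ₁ μ₂).ge

@[simp] theorem wBasis_apply (p : ℤ × ℤ × ℕ) : wBasis μ₁ μ₂ p = w μ₁ μ₂ p :=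
  Basis.mk_apply _ _ _

/-- The matrix of the action on `M` with respect to the basis `w`. -/
def wMatrix (X : sl3) (p q : ℤ × ℤ × ℕ) : ℂ := (wBasis μ₁ μ₂).repr ⁅X, w μ₁ μ₂ p⁆ q

/-- The eigenvalues of `h₁`, `h₂`, `f₁₂ e₁₂` on `w_{k,l,m}`. -/
def wEig (p : ℤ × ℤ × ℕ) : ℂ × ℂ × ℂ :=
  (-2 * bar μ₁ p.1 + bar μ₂ p.2.1 - p.2.2, bar μ₁ p.1 - 2 * bar μ₂ p.2.1 - p.2.2,
    -(p.2.2 * (bar μ₁ p.1 + bar μ₂ p.2.1 + p.2.2 - 1)))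

variable {μ₁ μ₂}

theorem wEig_injective (hμ : ∀ n : ℤ, μ₁ + μ₂ ≠ n) : Function.Injective (wEig μ₁ μ₂) := by
  rintro ⟨k, l, m⟩ ⟨k', l', m'⟩ h
  simp only [wEig, Prod.mk.injEq, bar] at h
  obtain ⟨h₁, h₂, h₃⟩ := h
  -- The eigenvalue of `h₁ + h₂` fixes `k̄ + l̄ + 2m`. Given this, the difference of the third
  -- eigenvalues is, up to sign, `(m - m')(k̄ + l̄ + m - m' - 1)`, and the second factor cannot
  -- vanish.
  have hmm : ((m : ℂ) - m') * ((k : ℂ) - μ₁ + (l - μ₂) + ((m - m' - 1 : ℤ) : ℂ)) = 0 := by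
    push_cast
    linear_combination -h₃ + m' * (h₁ + h₂)
  have hm : m = m' := by
    rcases mul_eq_zero.1 hmm with h | h
    · exact_mod_cast sub_eq_zero.1 h
    · exact absurd h (wt_add_ne hμ k l _)
  subst hm
  have hk : (k : ℂ) = k' := by linear_combination (-2 / 3 : ℂ) * h₁ + (-1 / 3 : ℂ) * h₂
  have hl : (l : ℂ) = l' := by linear_combination (-1 / 3 : ℂ) * h₁ + (-2 / 3 : ℂ) * h₂
  rw [Int.cast_inj.1 hk, Int.cast_inj.1 hl]

theorem w_mem_eig (hμ : ∀ n : ℤ, μ₁ + μ₂ ≠ n) (p : ℤ × ℤ × ℕ) :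
    w μ₁ μ₂ p ∈ eig (Sec μ₁ μ₂) (wEig μ₁ μ₂ p) := by
  obtain ⟨k, l, m⟩ := p
  refine ⟨lie_h1_w hμ k l m, lie_h2_w hμ k l m, ?_⟩
  rw [lie_e12_w hμ, lie_smul, neg_smul, smul_lie_f12_w_pred hμ, ← neg_smul]
  rfl

theorem map_mem_eig {M R : Type} [AddCommGroup M] [Module ℂ M] [LieRingModule sl3 M]
    [LieModule ℂ sl3 M] [AddCommGroup R] [Module ℂ R] [LieRingModule sl3 R] [LieModule ℂ sl3 R]
    (f : M →ₗ⁅ℂ, sl3⁆ R) {χ : ℂ × ℂ × ℂ} {v : M} (hv : v ∈ eig M χ) : f v ∈ eig R χ := by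
  obtain ⟨a, b, c⟩ := hv
  refine ⟨?_, ?_, ?_⟩
  · rw [← f.map_lie, a, map_smul]
  · rw [← f.map_lie, b, map_smul]
  · rw [← f.map_lie, ← f.map_lie, c, map_smul]

theorem mem_eig_of_coe {M : Type} [AddCommGroup M] [Module ℂ M] [LieRingModule sl3 M]
    [LieModule ℂ sl3 M] {N : LieSubmodule ℂ sl3 M} {χ : ℂ × ℂ × ℂ} {v : N}
    (hv : (v : M) ∈ eig M χ) : v ∈ eig N χ :=
  ⟨Subtype.ext hv.1, Subtype.ext hv.2.1, Subtype.ext hv.2.2⟩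

theorem IsStable.exists_basis {J : Set (ℤ × ℤ × ℕ)} (hJ : IsStable μ₁ μ₂ J) :
    ∃ b : Basis J ℂ (genSub μ₁ μ₂ J), HasMatrix b (wMatrix μ₁ μ₂) ∧
      (∀ p, (b p : Sec μ₁ μ₂) = w μ₁ μ₂ p) ∧
      ∀ x p, b.repr x p = (wBasis μ₁ μ₂).repr (x : Sec μ₁ μ₂) p := by
  have hmem : ∀ p : J, w μ₁ μ₂ p ∈ genSub μ₁ μ₂ J := fun p =>
    LieSubmodule.subset_lieSpan ⟨p, p.2, rfl⟩
  let v : J → genSub μ₁ μ₂ J := fun p => ⟨w μ₁ μ₂ p, hmem p⟩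
  have li : LinearIndependent ℂ v := by
    apply LinearIndependent.of_comp (genSub μ₁ μ₂ J).toSubmodule.subtype
    exact (linearIndependent_w μ₁ μ₂).comp (fun p : J => p.1) Subtype.val_injective
  have sp : ⊤ ≤ Submodule.span ℂ (Set.range v) := by
    rintro ⟨x, hx⟩ -
    have hx' : x ∈ Submodule.span ℂ (w μ₁ μ₂ '' J) := by rw [← hJ]; exact hx
    have himg : w μ₁ μ₂ '' J = (genSub μ₁ μ₂ J).toSubmodule.subtype '' Set.range v := by
      ext y
      constructor
      · rintro ⟨p, hp, rfl⟩
        exact ⟨v ⟨p, hp⟩, ⟨_, rfl⟩, rfl⟩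
      · rintro ⟨_, ⟨p, rfl⟩, rfl⟩
        exact ⟨p, p.2, rfl⟩
    rw [himg, ← Submodule.map_span] at hx'
    obtain ⟨y, hy, hyx⟩ := hx'
    have : y = ⟨x, hx⟩ := Subtype.ext hyx
    rwa [← this]
  obtain ⟨b, hb⟩ : ∃ b : Basis J ℂ (genSub μ₁ μ₂ J), ∀ p, b p = v p :=
    ⟨Basis.mk li sp, fun p => Basis.mk_apply li sp p⟩
  have hr : ∀ x p, b.repr x p = (wBasis μ₁ μ₂).repr (x : Sec μ₁ μ₂) p := by
    classical
    intro x p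
    induction x using basis_induction b with
    | zero => simp
    | coe q =>
      rw [Basis.repr_self, hb, show ((v q : genSub μ₁ μ₂ J) : Sec μ₁ μ₂) = w μ₁ μ₂ q from rfl,
        ← wBasis_apply, Basis.repr_self, Finsupp.single_apply, Finsupp.single_apply]
      simp only [Subtype.ext_iff]
    | smul c x hx => simp [hx]
    | add x y hx hy => simp [hx, hy]
  refine ⟨b, fun X p q => ?_, fun p => by rw [hb], hr⟩
  rw [hr, hb]
  rfl

theorem IsStable.mem_iff {J : Set (ℤ × ℤ × ℕ)} (hJ : IsStable μ₁ μ₂ J) {x : Sec μ₁ μ₂} :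
    x ∈ genSub μ₁ μ₂ J ↔ ∀ p, (wBasis μ₁ μ₂).repr x p ≠ 0 → p ∈ J := by
  have himg : w μ₁ μ₂ '' J = wBasis μ₁ μ₂ '' J := by simp
  rw [← LieSubmodule.mem_toSubmodule, hJ, himg, Basis.mem_span_image]
  exact ⟨fun h p hp => h (Finsupp.mem_support_iff.2 hp),
    fun h p hp => h p (Finsupp.mem_support_iff.1 hp)⟩

/-- Neither the matrix nor the eigenvalues remember `J'` and `J''`, which is why the choice of a
realization is irrelevant. -/
theorem Realizes.exists_basis (hμ : ∀ n : ℤ, μ₁ + μ₂ ≠ n) {J' J'' J : Set (ℤ × ℤ × ℕ)}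
    (h : Realizes μ₁ μ₂ J' J'' J) :
    ∃ b : Basis J ℂ (Subquot μ₁ μ₂ J' J''),
      HasMatrix b (wMatrix μ₁ μ₂) ∧ IsEigenBasis b (wEig μ₁ μ₂) := by
  obtain ⟨b, hb, hbw, hr⟩ := h.stable_sup.exists_basis
  have hJ : J ⊆ J' := by rw [← h.diff_eq]; exact Set.sdiff_subset
  have hx : ∀ x : genSub μ₁ μ₂ J',
      x.1 ∈ genSub μ₁ μ₂ J'' ↔ ∀ p : J', p.1 ∈ J → b.repr x p = 0 := by
    intro x
    rw [h.stable_sub.mem_iff]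
    constructor
    · intro hx p hp
      by_contra hne
      rw [hr] at hne
      rw [← h.diff_eq] at hp
      exact hp.2 (hx p hne)
    · intro hx p hp
      have hpJ' : p ∈ J' := h.stable_sup.mem_iff.1 x.2 p hp
      by_contra hpJ''
      have := hx ⟨p, hpJ'⟩ (by rw [← h.diff_eq]; exact ⟨hpJ', hpJ''⟩)
      rw [hr] at this
      exact hp this
  obtain ⟨c, hc, hcf⟩ := hb.exists_basis_of_surjective (J := J)
    (LieSubmodule.Quotient.mk' ((genSub μ₁ μ₂ J'').comap (genSub μ₁ μ₂ J').incl))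
    (LieSubmodule.Quotient.surjective_mk' _) hJ
    fun x => (LieSubmodule.Quotient.mk_eq_zero _).trans (hx x)
  refine ⟨c, hc, fun p => ?_, (wEig_injective hμ).injOn⟩
  rw [hcf]
  apply map_mem_eig
  apply mem_eig_of_coe
  rw [hbw]
  exact w_mem_eig hμ p.1

end Sections

/-! ### Arrows between the basis vectors and stable index sets -/

section Reach

variable {μ₁ : ℂ} {μ₂ : ℤ}

theorem repr_w (μ₁ μ₂ : ℂ) (p : ℤ × ℤ × ℕ) :
    (wBasis μ₁ μ₂).repr (w μ₁ μ₂ p) = Finsupp.single p 1 := by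
  rw [← wBasis_apply, Basis.repr_self]

theorem bar_int (μ₂ l : ℤ) : bar (μ₂ : ℂ) l = ((l - μ₂ : ℤ) : ℂ) := by
  simp [bar]

theorem bar_int_ne {μ₂ l : ℤ} (n : ℤ) (h : l ≠ μ₂ + n) : bar (μ₂ : ℂ) l - n ≠ 0 := by
  rw [bar_int, ← Int.cast_sub, Int.cast_ne_zero]
  omega

variable (hμ : ∀ n : ℤ, μ₁ + (μ₂ : ℂ) ≠ n)
include hμ

/-- As `μ₂` is an integer, `μ₁` is not; therefore factors such as `k̄` and `k̄ - 1` never vanish. -/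
theorem bar_sub_ne (k n : ℤ) : bar μ₁ k - n ≠ 0 := by
  intro h
  apply hμ (k - n + μ₂)
  simp only [bar] at h
  push_cast
  linear_combination -h

theorem bar_ne (k : ℤ) : bar μ₁ k ≠ 0 := by simpa using bar_sub_ne hμ k 0
theorem bar_sub_one_ne (k : ℤ) : bar μ₁ k - 1 ≠ 0 := by simpa using bar_sub_ne hμ k 1

/-- A set given by a condition on `l̄` is stable if no arrow leaves it. -/
theorem isStable_of {P : ℤ → Prop} (hdown : ∀ l, P l → l ≠ μ₂ → P (l - 1))
    (hup : ∀ l, P l → l ≠ μ₂ → l ≠ μ₂ + 1 → P (l + 1)) :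
    IsStable μ₁ μ₂ {p | P p.2.1} := by
  let W := Submodule.span ℂ (w μ₁ μ₂ '' {p | P p.2.1})
  have hw : ∀ k l m, P l → w μ₁ μ₂ (k, l, m) ∈ W := fun k l m h =>
    Submodule.subset_span ⟨(k, l, m), h, rfl⟩
  -- In the formulas for `e₁`, `e₂`, `f₁`, `f₂`, every term that lowers `l` carries the factor `l̄`,
  -- and every term that raises `l` carries `l̄(l̄ - 1)`. These zeros make up for the cases left out
  -- of `hdown` and `hup`.
  have hd : ∀ k l m, P l → bar (μ₂ : ℂ) l • w μ₁ μ₂ (k, l - 1, m) ∈ W := by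
    intro k l m h
    by_cases hl : l = μ₂
    · rw [bar_int, hl, sub_self, Int.cast_zero, zero_smul]; exact zero_mem _
    · exact Submodule.smul_mem _ _ (hw _ _ _ (hdown l h hl))
  have hu : ∀ k l m, P l →
      (bar (μ₂ : ℂ) l * (bar (μ₂ : ℂ) l - 1)) • w μ₁ μ₂ (k, l + 1, m) ∈ W := by
    intro k l m h
    by_cases hl : l = μ₂
    · rw [bar_int, hl, sub_self, Int.cast_zero, zero_mul, zero_smul]; exact zero_mem _
    · by_cases hl' : l = μ₂ + 1
      · rw [bar_int, hl', add_sub_cancel_left, Int.cast_one, sub_self, mul_zero, zero_smul]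
        exact zero_mem _
      · exact Submodule.smul_mem _ _ (hw _ _ _ (hup l h hl hl'))
  have hX : ∀ X : sl3, ∀ x ∈ W, ⁅X, x⁆ ∈ W := by
    have red : ∀ X : sl3, (∀ k l m, P l → ⁅X, w μ₁ μ₂ (k, l, m)⁆ ∈ W) →
        ∀ x ∈ W, ⁅X, x⁆ ∈ W := by
      intro X h x hx
      induction hx using Submodule.span_induction with
      | mem x hx => obtain ⟨p, hp, rfl⟩ := hx; exact h _ _ _ hp
      | zero => rw [lie_zero]; exact zero_mem _
      | add x y _ _ hx hy => rw [lie_add]; exact add_mem hx hy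
      | smul c x _ hx => rw [lie_smul]; exact Submodule.smul_mem _ _ hx
    intro X
    induction X using sl3_induction with
    | he1 =>
      refine red _ fun k l m h => ?_
      rw [lie_e1_w hμ, mul_comm, neg_div, mul_neg, ← mul_div_assoc, ← neg_div, ← mul_neg,
        mul_div_right_comm, mul_neg, ← neg_mul, mul_smul]
      exact add_mem (Submodule.smul_mem _ _ (hw _ _ _ h)) (Submodule.smul_mem _ _ (hu _ _ _ h))
    | he2 =>
      refine red _ fun k l m h => ?_
      rw [lie_e2_w hμ, neg_smul]
      exact add_mem (neg_mem (hd _ _ _ h)) (Submodule.smul_mem _ _ (hw _ _ _ h))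
    | hf1 =>
      refine red _ fun k l m h => ?_
      rw [lie_f1_w hμ, neg_smul]
      exact add_mem (neg_mem (hd _ _ _ h)) (Submodule.smul_mem _ _ (hw _ _ _ h))
    | hf2 =>
      refine red _ fun k l m h => ?_
      rw [lie_f2_w hμ, mul_comm _ (_ + _), mul_div_right_comm, mul_smul]
      exact add_mem (Submodule.smul_mem _ _ (hw _ _ _ h)) (Submodule.smul_mem _ _ (hu _ _ _ h))
    | add X Y hX hY => intro x hx; rw [add_lie]; exact add_mem (hX x hx) (hY x hx)
    | smul c X hX => intro x hx; rw [smul_lie]; exact Submodule.smul_mem _ _ (hX x hx)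
    | lie X Y hX hY =>
      intro x hx
      rw [lie_lie]
      exact sub_mem (hX _ (hY x hx)) (hY _ (hX x hx))
  let N : LieSubmodule ℂ sl3 (Sec μ₁ μ₂) := { W with lie_mem := fun {X x} hx => hX X x hx }
  apply le_antisymm
  · exact (LieSubmodule.lieSpan_le (N := N)).2 Submodule.subset_span
  · exact Submodule.span_le.2 LieSubmodule.subset_lieSpan

/-- The arrows in the `k` and `m` directions never degenerate: their coefficients involve only
integer translates of `k̄` and `k̄ + l̄`, and positive integers. -/
theorem wMatrix_e1_ne (k l : ℤ) (m : ℕ) : wMatrix μ₁ μ₂ e1 (k, l, m) (k - 1, l, m) ≠ 0 := by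
  rw [wMatrix, lie_e1_w hμ]
  simpa [repr_w, Finsupp.single_apply] using bar_ne hμ k

theorem wMatrix_f1_ne (k l : ℤ) (m : ℕ) : wMatrix μ₁ μ₂ f1 (k, l, m) (k + 1, l, m) ≠ 0 := by
  have h : bar μ₁ k * (bar μ₁ k - 1) * (m + (bar μ₁ k + bar (μ₂ : ℂ) l)) /
      ((bar μ₁ k + bar (μ₂ : ℂ) l) * (bar μ₁ k + bar (μ₂ : ℂ) l - 1)) ≠ 0 := by
    refine div_ne_zero (mul_ne_zero (mul_ne_zero (bar_ne hμ k) (bar_sub_one_ne hμ k)) ?_)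
      (mul_ne_zero (wt_ne hμ k l) (wt_sub_one_ne hμ k l))
    rw [add_comm]
    exact wt_add_nat_ne hμ k l m
  rw [wMatrix, lie_f1_w hμ]
  simpa only [map_add, map_smul, repr_w, Finsupp.add_apply, Finsupp.smul_apply,
    Finsupp.single_apply, Prod.mk.injEq, sub_eq_self, one_ne_zero, smul_eq_mul, mul_one,
    false_and, and_false, if_false, mul_zero, zero_add, and_self, if_true] using h

theorem wMatrix_f12_ne (k l : ℤ) (m : ℕ) :
    wMatrix μ₁ μ₂ f12 (k, l, m) (k, l, m + 1) ≠ 0 := by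
  rw [wMatrix, lie_f12_w' hμ]
  simpa [repr_w] using wt_add_nat_ne hμ k l m

theorem wMatrix_e12_ne (k l : ℤ) (m : ℕ) :
    wMatrix μ₁ μ₂ e12 (k, l, m + 1) (k, l, m) ≠ 0 := by
  rw [wMatrix, lie_e12_w hμ]
  simpa only [map_smul, repr_w, Nat.add_sub_cancel, Finsupp.smul_apply, Finsupp.single_eq_same,
    smul_eq_mul, mul_one] using neg_ne_zero.2 (Nat.cast_ne_zero (R := ℂ).2 m.succ_ne_zero)

theorem wMatrix_e2_ne {l : ℤ} (hl : l ≠ μ₂) (k : ℤ) (m : ℕ) :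
    wMatrix μ₁ μ₂ e2 (k, l, m) (k, l - 1, m) ≠ 0 := by
  rw [wMatrix, lie_e2_w hμ]
  simpa [repr_w, Finsupp.single_apply] using bar_int_ne 0 (by simpa using hl)

theorem wMatrix_f2_ne {l : ℤ} (hl : l ≠ μ₂) (hl' : l ≠ μ₂ + 1) (k : ℤ) (m : ℕ) :
    wMatrix μ₁ μ₂ f2 (k, l, m) (k, l + 1, m) ≠ 0 := by
  have h : bar (μ₂ : ℂ) l * (bar (μ₂ : ℂ) l - 1) * (m + (bar μ₁ k + bar (μ₂ : ℂ) l)) /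
      ((bar μ₁ k + bar (μ₂ : ℂ) l) * (bar μ₁ k + bar (μ₂ : ℂ) l - 1)) ≠ 0 := by
    refine div_ne_zero (mul_ne_zero (mul_ne_zero ?_ ?_) ?_)
      (mul_ne_zero (wt_ne hμ k l) (wt_sub_one_ne hμ k l))
    · simpa using bar_int_ne 0 (by simpa using hl)
    · simpa using bar_int_ne 1 hl'
    · rw [add_comm]
      exact wt_add_nat_ne hμ k l m
  rw [wMatrix, lie_f2_w hμ]
  simpa only [map_add, map_smul, repr_w, Finsupp.add_apply, Finsupp.smul_apply,
    Finsupp.single_apply, Prod.mk.injEq, sub_eq_self, one_ne_zero, smul_eq_mul, mul_one,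
    false_and, and_false, if_false, mul_zero, zero_add, and_self, if_true] using h

theorem reach_k {P : ℤ → Prop} {l : ℤ} (hl : P l) (m : ℕ) (k k' : ℤ) :
    Reach (wMatrix μ₁ μ₂) {p | P p.2.1} ⟨(k, l, m), hl⟩ ⟨(k', l, m), hl⟩ := by
  induction k' using Int.inductionOn' (b := k) with
  | zero => exact .refl
  | succ k' _ ih => exact ih.tail ⟨f1, wMatrix_f1_ne hμ k' l m⟩
  | pred k' _ ih => exact ih.tail ⟨e1, wMatrix_e1_ne hμ k' l m⟩

theorem reach_m {P : ℤ → Prop} {l : ℤ} (hl : P l) (k : ℤ) (m m' : ℕ) :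
    Reach (wMatrix μ₁ μ₂) {p | P p.2.1} ⟨(k, l, m), hl⟩ ⟨(k, l, m'), hl⟩ := by
  have h1 : Reach (wMatrix μ₁ μ₂) {p | P p.2.1} ⟨(k, l, m), hl⟩ ⟨(k, l, 0), hl⟩ := by
    induction m with
    | zero => exact .refl
    | succ m ih => exact .head ⟨e12, wMatrix_e12_ne hμ k l m⟩ ih
  refine h1.trans ?_
  clear h1
  induction m' with
  | zero => exact .refl
  | succ m ih => exact ih.tail ⟨f12, wMatrix_f12_ne hμ k l m⟩

theorem reach_of_l {P : ℤ → Prop} {l : ℤ} (hl : P l) (k k' : ℤ) (m m' : ℕ) :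
    Reach (wMatrix μ₁ μ₂) {p | P p.2.1} ⟨(k, l, m), hl⟩ ⟨(k', l, m'), hl⟩ :=
  (reach_k hμ hl m k k').trans (reach_m hμ hl k' m m')

/-- A single level is always connected, since `k` and `m` can be changed freely. For the levels `l̄
= 0, 1` this gives the simplicity of the subquotients. -/
theorem reach_eq (c : ℤ) (p q : ({p | p.2.1 = c} : Set (ℤ × ℤ × ℕ))) :
    Reach (wMatrix μ₁ μ₂) {p | p.2.1 = c} p q := by
  obtain ⟨⟨k, l, m⟩, h⟩ := p
  obtain ⟨⟨k', l', m'⟩, h'⟩ := q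
  have hl : l = c := h
  have hl' : l' = c := h'
  subst hl'
  subst hl
  exact reach_of_l (P := fun x => x = l) hμ rfl k k' m m'

/-- From `l̄ = 2` on, neither `l̄` nor `l̄(l̄ - 1)` vanishes, so `e₂` descends to the lowest level
`l̄ = 2` and `f₂` climbs back up. -/
theorem reach_ge (p q : ({p | μ₂ + 2 ≤ p.2.1} : Set (ℤ × ℤ × ℕ))) :
    Reach (wMatrix μ₁ μ₂) {p | μ₂ + 2 ≤ p.2.1} p q := by
  obtain ⟨⟨k, l, m⟩, h⟩ := p
  obtain ⟨⟨k', l', m'⟩, h'⟩ := q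
  have h : μ₂ + 2 ≤ l := h
  have h' : μ₂ + 2 ≤ l' := h'
  have down : ∀ (l : ℤ) (h : μ₂ + 2 ≤ l), Reach (wMatrix μ₁ μ₂) {p | μ₂ + 2 ≤ p.2.1}
      ⟨(k, l, m), h⟩ ⟨(k, μ₂ + 2, m), le_refl (μ₂ + 2)⟩ := by
    intro l h
    induction l, h using Int.leInduction with
    | base => exact .refl
    | succ l hl ih =>
      refine .head ⟨e2, ?_⟩ ih
      have := wMatrix_e2_ne hμ (l := l + 1) (by omega) k m
      rwa [add_sub_cancel_right] at this
  have up : ∀ (l : ℤ) (h : μ₂ + 2 ≤ l), Reach (wMatrix μ₁ μ₂) {p | μ₂ + 2 ≤ p.2.1}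
      ⟨(k, μ₂ + 2, m), le_refl (μ₂ + 2)⟩ ⟨(k, l, m), h⟩ := by
    intro l h
    induction l, h using Int.leInduction with
    | base => exact .refl
    | succ l hl ih => exact ih.tail ⟨f2, wMatrix_f2_ne hμ (by omega) (by omega) k m⟩
  exact ((down l h).trans (up l' h')).trans
    (reach_of_l (P := fun x => μ₂ + 2 ≤ x) hμ h' k k' m m')

end Reach

/-! ### The universal property of the relaxed Verma modules -/

section Verma

attribute [local instance 100] LieRing.ofAssociativeRing

variable {lam : Module.Dual ℂ cartan} {μ : ℂ}

/-- The defining relations of the generator of `𝓡_{𝔭₁,λ,μ}`. -/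
structure IsTopVector {N : Type} [AddCommGroup N] [Module ℂ N] [LieRingModule sl3 N]
    (lam : Module.Dual ℂ cartan) (μ : ℂ) (v : N) : Prop where
  weight : ∀ h : cartan, ⁅(h : sl3), v⁆ = (lam + μ • alpha1) h • v
  casimir : ⁅f1, ⁅e1, v⁆⁆ = -((μ + 1) * (μ + lam ⟨h1, h1_mem_cartan⟩)) • v
  e2_eq : ⁅e2, v⁆ = 0
  e12_eq : ⁅e12, v⁆ = 0

theorem UIncl_ιp (X : sl3) (hX : X ∈ p1) : UIncl (ιp X hX) = UniversalEnvelopingAlgebra.ι ℂ X :=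
  UniversalEnvelopingAlgebra.lift_ι_apply ℂ _ _

/-- The class of `u ⊗ t` in `𝓡_{𝔭₁,λ,μ}`. -/
def RVerma.mk (lam : Module.Dual ℂ cartan) (μ : ℂ) :
    Usl3 ⊗[ℂ] TopModule lam μ →ₗ[Usl3] RVerma lam μ :=
  (balancing (TopModule lam μ)).mkQ

/-- The generator of `𝓡_{𝔭₁,λ,μ}`. -/
def RVerma.gen (lam : Module.Dual ℂ cartan) (μ : ℂ) : RVerma lam μ :=
  RVerma.mk lam μ (1 ⊗ₜ Submodule.Quotient.mk 1)

/-- The balancing relation moves `r` across the tensor sign, so pure tensors are multiples of the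
generator. -/
theorem RVerma.mk_tmul (a : Usl3) (r : Up1) :
    RVerma.mk lam μ (a ⊗ₜ Submodule.Quotient.mk r) = (a * UIncl r) • RVerma.gen lam μ := by
  have h : RVerma.mk lam μ (UIncl r ⊗ₜ Submodule.Quotient.mk 1) =
      RVerma.mk lam μ (1 ⊗ₜ (r • Submodule.Quotient.mk 1)) := by
    rw [← sub_eq_zero, ← map_sub]
    exact (Submodule.Quotient.mk_eq_zero _).2 (Submodule.subset_span ⟨r, _, rfl⟩)
  rw [← Submodule.Quotient.mk_smul, smul_eq_mul, mul_one] at h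
  rw [mul_smul, RVerma.gen, ← map_smul, TensorProduct.smul_tmul', smul_eq_mul, mul_one, h,
    ← map_smul, TensorProduct.smul_tmul', smul_eq_mul, mul_one]

theorem RVerma.UIncl_smul_gen {r : Up1} (hr : r ∈ topIdeal lam μ) :
    UIncl r • RVerma.gen lam μ = 0 := by
  rw [← one_mul (UIncl r), ← RVerma.mk_tmul, (Submodule.Quotient.mk_eq_zero _).2 hr,
    TensorProduct.tmul_zero, map_zero]

theorem RVerma.isTopVector_gen : IsTopVector lam μ (RVerma.gen lam μ) where
  weight h := by
    have := RVerma.UIncl_smul_gen (lam := lam) (μ := μ) (Submodule.subset_span (Or.inl ⟨h, rfl⟩))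
    rwa [map_sub, sub_smul, UIncl_ιp, AlgHom.commutes, algebraMap_smul, sub_eq_zero] at this
  casimir := by
    have := RVerma.UIncl_smul_gen (lam := lam) (μ := μ)
      (Submodule.subset_span (Or.inr (Or.inl rfl)))
    rwa [map_add, add_smul, map_mul, mul_smul, UIncl_ιp, UIncl_ιp, AlgHom.commutes,
      algebraMap_smul, add_eq_zero_iff_eq_neg, ← neg_smul] at this
  e2_eq := by
    have := RVerma.UIncl_smul_gen (lam := lam) (μ := μ)
      (Submodule.subset_span (Or.inr (Or.inr (Or.inl rfl))))
    rwa [UIncl_ιp] at this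
  e12_eq := by
    have := RVerma.UIncl_smul_gen (lam := lam) (μ := μ)
      (Submodule.subset_span (Or.inr (Or.inr (Or.inr rfl))))
    rwa [UIncl_ιp] at this

/-- `U(𝔰𝔩₃)` is a quotient of the tensor algebra, so stability under `𝔰𝔩₃` implies stability under
all of it. -/
theorem RVerma.smul_mem (N : LieSubmodule ℂ sl3 (RVerma lam μ)) (a : Usl3) :
    ∀ x ∈ N, a • x ∈ N := by
  obtain ⟨t, rfl⟩ : ∃ t, UniversalEnvelopingAlgebra.mkAlgHom ℂ sl3 t = a :=
    Quotient.exists_rep a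
  induction t using TensorAlgebra.induction with
  | algebraMap c =>
    intro x hx
    rw [AlgHom.commutes, algebraMap_smul]
    exact N.smul_mem c hx
  | ι X =>
    intro x hx
    exact N.lie_mem (x := X) hx
  | mul a b ha hb =>
    intro x hx
    rw [map_mul, mul_smul]
    exact ha _ (hb _ hx)
  | add a b ha hb =>
    intro x hx
    rw [map_add, add_smul]
    exact add_mem (ha _ hx) (hb _ hx)

theorem RVerma.eq_top_of_gen_mem {N : LieSubmodule ℂ sl3 (RVerma lam μ)}
    (h : RVerma.gen lam μ ∈ N) : N = ⊤ := by
  rw [eq_top_iff]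
  rintro x -
  obtain ⟨t, rfl⟩ : ∃ t, RVerma.mk lam μ t = x := Submodule.mkQ_surjective _ x
  induction t using TensorProduct.induction_on with
  | zero => rw [map_zero]; exact zero_mem _
  | tmul a r =>
    obtain ⟨r, rfl⟩ := Submodule.Quotient.mk_surjective _ r
    rw [RVerma.mk_tmul]
    exact RVerma.smul_mem N _ _ h
  | add s t hs ht => rw [map_add]; exact add_mem hs ht

/-- The action on `N` extends to `U(𝔰𝔩₃)`. The relations of `v` say that `topIdeal` annihilates it,
which gives a `U(𝔭₁)`-linear map `ψ` on the top module, and `a ⊗ t ↦ a ψ(t)` kills the balancing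
relations. -/
theorem RVerma.exists_hom {N : Type} [AddCommGroup N] [Module ℂ N] [LieRingModule sl3 N]
    [LieModule ℂ sl3 N] {v : N} (hv : IsTopVector lam μ v) :
    ∃ f : RVerma lam μ →ₗ⁅ℂ, sl3⁆ N, f (RVerma.gen lam μ) = v := by
  let ρ : Usl3 →ₐ[ℂ] Module.End ℂ N :=
    UniversalEnvelopingAlgebra.lift ℂ (LieModule.toEnd ℂ sl3 N)
  have hρ : ∀ X n, ρ (UniversalEnvelopingAlgebra.ι ℂ X) n = ⁅X, n⁆ := fun X n =>
    congrArg (fun T : Module.End ℂ N => T n) (UniversalEnvelopingAlgebra.lift_ι_apply ℂ _ X)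
  let m1 : Module Usl3 N := Module.compHom N (ρ : Usl3 →+* Module.End ℂ N)
  let m2 : Module Up1 N := Module.compHom N (UIncl : Up1 →+* Usl3)
  have s1 : ∀ (a : Usl3) (n : N), a • n = ρ a n := fun _ _ => rfl
  have s2 : ∀ (a : Up1) (n : N), a • n = ρ (UIncl a) n := fun _ _ => rfl
  have t1 : IsScalarTower ℂ Usl3 N := ⟨fun c a n => by
    rw [s1, s1, map_smul, LinearMap.smul_apply]⟩
  have t2 : IsScalarTower ℂ Up1 N := ⟨fun c a n => by
    rw [s2, s2, map_smul, map_smul, LinearMap.smul_apply]⟩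
  have c1 : SMulCommClass Usl3 ℂ N := ⟨fun a c n => by
    rw [s1, s1, map_smul]⟩
  have c2 : SMulCommClass ℂ Usl3 N := SMulCommClass.symm _ _ _
  let ψ₀ : Up1 →ₗ[Up1] N := LinearMap.toSpanSingleton Up1 N v
  have hψ₀ : topIdeal lam μ ≤ LinearMap.ker ψ₀ := by
    refine Submodule.span_le.2 ?_
    rintro r (⟨h, rfl⟩ | rfl | rfl | rfl)
    · change (ιp _ _ - algebraMap ℂ Up1 _) • v = 0
      rw [sub_smul, algebraMap_smul, s2, UIncl_ιp, hρ, hv.weight, sub_self]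
    · change (ιp _ _ * ιp _ _ + algebraMap ℂ Up1 _) • v = 0
      rw [add_smul, algebraMap_smul, mul_smul, s2, s2, UIncl_ιp, UIncl_ιp, hρ, hρ, hv.casimir,
        neg_smul, neg_add_cancel]
    · change ιp _ _ • v = 0
      rw [s2, UIncl_ιp, hρ, hv.e2_eq]
    · change ιp _ _ • v = 0
      rw [s2, UIncl_ιp, hρ, hv.e12_eq]
  let ψ : TopModule lam μ →ₗ[Up1] N := (topIdeal lam μ).liftQ ψ₀ hψ₀
  let φ : Usl3 ⊗[ℂ] TopModule lam μ →ₗ[Usl3] N :=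
    TensorProduct.AlgebraTensorModule.lift
      (LinearMap.toSpanSingleton Usl3 (TopModule lam μ →ₗ[ℂ] N) (ψ.restrictScalars ℂ))
  have hφ : ∀ a t, φ (a ⊗ₜ t) = a • ψ t := fun _ _ => rfl
  have hbal : balancing (TopModule lam μ) ≤ LinearMap.ker φ := by
    refine Submodule.span_le.2 ?_
    rintro _ ⟨a, t, rfl⟩
    change φ _ = 0
    rw [map_sub, hφ, hφ, one_smul, map_smul]
    exact sub_self _
  let F : RVerma lam μ →ₗ[Usl3] N := (balancing (TopModule lam μ)).liftQ φ hbal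
  refine ⟨{ F.restrictScalars ℂ with map_lie' := fun {X x} => ?_ }, ?_⟩
  · exact (F.map_smul (UniversalEnvelopingAlgebra.ι ℂ X) x).trans (hρ X (F x))
  · change φ (1 ⊗ₜ Submodule.Quotient.mk 1) = v
    rw [hφ, one_smul]
    exact one_smul Up1 v

end Verma

/-! ### A spanning family of the relaxed Verma modules -/

section PBW

variable {N R : Type} [AddCommGroup N] [Module ℂ N] [LieRingModule sl3 N] [LieModule ℂ sl3 N]
  [AddCommGroup R] [Module ℂ R] [LieRingModule sl3 R] [LieModule ℂ sl3 R]

/-- A weight vector killed by the nilradical of `𝔭₁` on which `f₁ e₁` acts by a scalar. -/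
structure IsTopWeight (v : N) : Prop where
  h1_eq : ∃ a : ℂ, ⁅h1, v⁆ = a • v
  h2_eq : ∃ a : ℂ, ⁅h2, v⁆ = a • v
  casimir : ∃ a : ℂ, ⁅f1, ⁅e1, v⁆⁆ = a • v
  e2_eq : ⁅e2, v⁆ = 0
  e12_eq : ⁅e12, v⁆ = 0

theorem h2_mem_cartan : h2 ∈ cartan := by
  intro i j hij
  simp only [h2, LieAlgebra.SpecialLinear.val_singleSubSingle, Matrix.sub_apply]
  fin_cases i <;> fin_cases j <;> simp_all

theorem IsTopVector.isTopWeight {lam : Module.Dual ℂ cartan} {μ : ℂ} {v : N}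
    (hv : IsTopVector lam μ v) : IsTopWeight v :=
  ⟨⟨_, hv.weight ⟨h1, h1_mem_cartan⟩⟩, ⟨_, hv.weight ⟨h2, h2_mem_cartan⟩⟩, ⟨_, hv.casimir⟩,
    hv.e2_eq, hv.e12_eq⟩

theorem weight_lie {h X : sl3} {c a : ℂ} {v : N} (hX : ⁅h, X⁆ = c • X) (hv : ⁅h, v⁆ = a • v) :
    ⁅h, ⁅X, v⁆⁆ = (c + a) • ⁅X, v⁆ := by
  rw [leibniz_lie, hX, hv, smul_lie, lie_smul, add_smul]

/-- `f₁ e₁ e₁ v = e₁ f₁ e₁ v - h₁ e₁ v`, so `f₁ e₁` still acts by a scalar; and `e₁` normalizes the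
nilradical. -/
theorem IsTopWeight.lie_e1 {v : N} (hv : IsTopWeight v) : IsTopWeight ⁅e1, v⁆ := by
  obtain ⟨⟨a, ha⟩, ⟨b, hb⟩, ⟨c, hc⟩, h₂, h₁₂⟩ := hv
  have hw := weight_lie lie_h1_e1 ha
  refine ⟨⟨_, hw⟩, ⟨_, weight_lie lie_h2_e1 hb⟩, ⟨c - (2 + a), ?_⟩, ?_, ?_⟩
  · have := leibniz_lie e1 f1 ⁅e1, v⁆
    rw [lie_e1_f1, hc, hw, lie_smul] at this
    rw [sub_smul, this, add_sub_cancel_left]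
  · rw [leibniz_lie, lie_e2_e1, neg_lie, h₁₂, h₂, neg_zero, lie_zero, add_zero]
  · rw [leibniz_lie, lie_e12_e1, h₁₂, zero_lie, lie_zero, add_zero]

theorem IsTopWeight.lie_e1_f1 {v : N} (hv : IsTopWeight v) : ∃ c : ℂ, ⁅e1, ⁅f1, v⁆⁆ = c • v := by
  obtain ⟨⟨a, ha⟩, -, ⟨c, hc⟩, -, -⟩ := hv
  exact ⟨a + c, by rw [leibniz_lie, RelaxedSL3.lie_e1_f1, ha, hc, add_smul]⟩

theorem IsTopWeight.lie_f1 {v : N} (hv : IsTopWeight v) : IsTopWeight ⁅f1, v⁆ := by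
  obtain ⟨d, hd⟩ := hv.lie_e1_f1
  obtain ⟨⟨a, ha⟩, ⟨b, hb⟩, ⟨c, hc⟩, h₂, h₁₂⟩ := hv
  refine ⟨⟨_, weight_lie lie_h1_f1 ha⟩,
    ⟨_, weight_lie (c := 1) (by rw [lie_h2_f1, one_smul]) hb⟩, ⟨d, ?_⟩, ?_, ?_⟩
  · rw [hd, lie_smul]
  · rw [leibniz_lie, lie_e2_f1, zero_lie, h₂, lie_zero, add_zero]
  · rw [leibniz_lie, lie_e12_f1, neg_lie, h₁₂, h₂, neg_zero, lie_zero, add_zero]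

/-- The vectors `e₁ʲ v` and `f₁ʲ v`. -/
def topVec (v : N) : ℤ → N
  | .ofNat n => (fun x => ⁅e1, x⁆)^[n] v
  | .negSucc n => (fun x => ⁅f1, x⁆)^[n + 1] v

theorem topVec_ofNat_succ (v : N) (n : ℕ) : topVec v (n + 1 : ℕ) = ⁅e1, topVec v n⁆ :=
  Function.iterate_succ_apply' _ _ _

theorem topVec_neg_succ (v : N) (n : ℕ) : topVec v (-(n + 1 : ℕ)) = ⁅f1, topVec v (-n)⁆ := by
  cases n with
  | zero => rfl
  | succ n => exact Function.iterate_succ_apply' _ _ _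

theorem IsTopWeight.topVec {v : N} (hv : IsTopWeight v) (j : ℤ) : IsTopWeight (topVec v j) := by
  obtain ⟨n, rfl | rfl⟩ := Int.eq_nat_or_neg j
  · induction n with
    | zero => exact hv
    | succ n ih => rw [topVec_ofNat_succ]; exact ih.lie_e1
  · induction n with
    | zero => exact hv
    | succ n ih => rw [topVec_neg_succ]; exact ih.lie_f1

/-- For `j ≥ 0` this is the construction of `topVec`; for `j < 0` the vector is `f₁ x` with `x` of
the same kind, and `e₁ f₁` acts on `x` by a scalar. -/
theorem IsTopWeight.lie_e1_topVec {v : N} (hv : IsTopWeight v) (j : ℤ) :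
    ∃ c : ℂ, ⁅e1, RelaxedSL3.topVec v j⁆ = c • RelaxedSL3.topVec v (j + 1) := by
  obtain ⟨n, rfl | rfl⟩ := Int.eq_nat_or_neg j
  · exact ⟨1, by rw [one_smul, ← topVec_ofNat_succ, Nat.cast_add_one]⟩
  · cases n with
    | zero => exact ⟨1, by rw [one_smul]; rfl⟩
    | succ n =>
      rw [topVec_neg_succ, show -((n + 1 : ℕ) : ℤ) + 1 = -n by push_cast; ring]
      exact (hv.topVec _).lie_e1_f1

theorem IsTopWeight.lie_f1_topVec {v : N} (hv : IsTopWeight v) (j : ℤ) :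
    ∃ c : ℂ, ⁅f1, RelaxedSL3.topVec v j⁆ = c • RelaxedSL3.topVec v (j - 1) := by
  obtain ⟨n, rfl | rfl⟩ := Int.eq_nat_or_neg j
  · cases n with
    | zero => exact ⟨1, by rw [one_smul]; rfl⟩
    | succ n =>
      rw [topVec_ofNat_succ, show ((n + 1 : ℕ) : ℤ) - 1 = n by push_cast; ring]
      exact (hv.topVec _).casimir
  · exact ⟨1, by
      rw [one_smul, ← topVec_neg_succ, show -(n : ℤ) - 1 = -((n + 1 : ℕ) : ℤ) by push_cast; ring]⟩

/-- The vectors `f₂ᵃ f₁₂ᵇ e₁ʲ v` and `f₂ᵃ f₁₂ᵇ f₁ʲ v`. -/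
def pbw (v : N) (p : ℤ × ℕ × ℕ) : N :=
  (fun x => ⁅f2, x⁆)^[p.2.1] ((fun x => ⁅f12, x⁆)^[p.2.2] (topVec v p.1))

theorem pbw_zero (v : N) (j : ℤ) : pbw v (j, 0, 0) = topVec v j := rfl
theorem pbw_succ_left (v : N) (j : ℤ) (a b : ℕ) : pbw v (j, a + 1, b) = ⁅f2, pbw v (j, a, b)⁆ :=
  Function.iterate_succ_apply' _ _ _
theorem pbw_zero_succ (v : N) (j : ℤ) (b : ℕ) : pbw v (j, 0, b + 1) = ⁅f12, pbw v (j, 0, b)⁆ :=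
  Function.iterate_succ_apply' _ _ _

theorem lie_f12_pbw (v : N) (j : ℤ) (a b : ℕ) : ⁅f12, pbw v (j, a, b)⁆ = pbw v (j, a, b + 1) := by
  induction a with
  | zero => rw [pbw_zero_succ]
  | succ a ih =>
    rw [pbw_succ_left, pbw_succ_left, ← ih, leibniz_lie f12, ← lie_skew, lie_f2_f12, neg_zero,
      zero_lie, zero_add]

theorem map_pbw (f : N →ₗ⁅ℂ, sl3⁆ R) (v : N) (p : ℤ × ℕ × ℕ) : f (pbw v p) = pbw (f v) p := by
  have htop : ∀ j, f (topVec v j) = topVec (f v) j := by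
    intro j
    obtain ⟨n, rfl | rfl⟩ := Int.eq_nat_or_neg j
    · induction n with
      | zero => rfl
      | succ n ih => rw [topVec_ofNat_succ, topVec_ofNat_succ, f.map_lie, ih]
    · induction n with
      | zero => rfl
      | succ n ih => rw [topVec_neg_succ, topVec_neg_succ, f.map_lie, ih]
  obtain ⟨j, a, b⟩ := p
  induction a with
  | zero =>
    induction b with
    | zero => exact htop j
    | succ b ih => rw [pbw_zero_succ, pbw_zero_succ, f.map_lie, ih]
  | succ a ih => rw [pbw_succ_left, pbw_succ_left, f.map_lie, ih]

/-- Only the spanning half of the Poincaré–Birkhoff–Witt theorem is needed, and it follows from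
stability of this span. Independence will come from a concrete module. -/
theorem lie_mem_span_pbw {v : N} (hv : IsTopWeight v) (X : sl3) :
    ∀ x ∈ Submodule.span ℂ (Set.range (pbw v)), ⁅X, x⁆ ∈ Submodule.span ℂ (Set.range (pbw v)) := by
  set W := Submodule.span ℂ (Set.range (pbw v))
  have red : ∀ X : sl3, (∀ p, ⁅X, pbw v p⁆ ∈ W) → ∀ x ∈ W, ⁅X, x⁆ ∈ W := by
    intro X h x hx
    induction hx using Submodule.span_induction with
    | mem x hx => obtain ⟨p, rfl⟩ := hx; exact h p
    | zero => rw [lie_zero]; exact zero_mem _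
    | add x y _ _ hx hy => rw [lie_add]; exact add_mem hx hy
    | smul c x _ hx => rw [lie_smul]; exact Submodule.smul_mem _ _ hx
  have hW : ∀ p, pbw v p ∈ W := fun p => Submodule.subset_span ⟨p, rfl⟩
  have hf2 : ∀ x ∈ W, ⁅f2, x⁆ ∈ W := red _ fun ⟨j, a, b⟩ => by
    rw [← pbw_succ_left]; exact hW _
  have hf12 : ∀ x ∈ W, ⁅f12, x⁆ ∈ W := red _ fun ⟨j, a, b⟩ => by
    rw [lie_f12_pbw]; exact hW _
  -- The four statements are proved together, because `[e₂, f₁₂] = f₁` and `[e₂, f₂] = h₂` feed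
  -- those for `f₁` and `h₂` into that for `e₂`.
  have key : ∀ p, ⁅e1, pbw v p⁆ ∈ W ∧ ⁅e2, pbw v p⁆ ∈ W ∧ ⁅f1, pbw v p⁆ ∈ W ∧
      ⁅h2, pbw v p⁆ ∈ W := by
    rintro ⟨j, a, b⟩
    induction a with
    | zero =>
      induction b with
      | zero =>
        have ht := hv.topVec j
        obtain ⟨c, hc⟩ := hv.lie_e1_topVec j
        obtain ⟨d, hd⟩ := hv.lie_f1_topVec j
        obtain ⟨e, he⟩ := ht.h2_eq
        rw [pbw_zero, hc, hd, he, ht.e2_eq]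
        exact ⟨Submodule.smul_mem _ _ (hW (_, 0, 0)), zero_mem _,
          Submodule.smul_mem _ _ (hW (_, 0, 0)), Submodule.smul_mem _ _ (hW (_, 0, 0))⟩
      | succ b ih =>
        obtain ⟨i₁, i₂, i₃, i₄⟩ := ih
        rw [pbw_zero_succ, leibniz_lie e1, leibniz_lie e2, leibniz_lie f1, leibniz_lie h2,
          lie_e1_f12, lie_e2_f12, lie_f1_f12, lie_h2_f12, neg_lie, neg_lie, zero_lie]
        exact ⟨add_mem (neg_mem (hf2 _ (hW _))) (hf12 _ i₁), add_mem i₃ (hf12 _ i₂),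
          add_mem (zero_mem _) (hf12 _ i₃), add_mem (neg_mem (hf12 _ (hW _))) (hf12 _ i₄)⟩
    | succ a ih =>
      obtain ⟨i₁, i₂, i₃, i₄⟩ := ih
      rw [pbw_succ_left, leibniz_lie e1, leibniz_lie e2, leibniz_lie f1, leibniz_lie h2,
        lie_e1_f2, lie_e2_f2, lie_f1_f2, lie_h2_f2, neg_lie, smul_lie, zero_lie]
      exact ⟨add_mem (zero_mem _) (hf2 _ i₁), add_mem i₄ (hf2 _ i₂),
        add_mem (neg_mem (hf12 _ (hW _))) (hf2 _ i₃),
        add_mem (Submodule.smul_mem _ _ (hf2 _ (hW _))) (hf2 _ i₄)⟩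
  induction X using sl3_induction with
  | he1 => exact red _ fun p => (key p).1
  | he2 => exact red _ fun p => (key p).2.1
  | hf1 => exact red _ fun p => (key p).2.2.1
  | hf2 => exact hf2
  | add X Y hX hY => intro x hx; rw [add_lie]; exact add_mem (hX x hx) (hY x hx)
  | smul c X hX => intro x hx; rw [smul_lie]; exact Submodule.smul_mem _ _ (hX x hx)
  | lie X Y hX hY =>
    intro x hx
    rw [lie_lie]
    exact sub_mem (hX _ (hY x hx)) (hY _ (hX x hx))

theorem RVerma.span_pbw (lam : Module.Dual ℂ cartan) (μ : ℂ) :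
    Submodule.span ℂ (Set.range (pbw (RVerma.gen lam μ))) = ⊤ := by
  let W : LieSubmodule ℂ sl3 (RVerma lam μ) :=
    { Submodule.span ℂ (Set.range (pbw (RVerma.gen lam μ))) with
      lie_mem := fun {X x} hx => lie_mem_span_pbw RVerma.isTopVector_gen.isTopWeight X x hx }
  have : W = ⊤ := RVerma.eq_top_of_gen_mem (Submodule.subset_span ⟨(0, 0, 0), rfl⟩)
  exact congrArg LieSubmodule.toSubmodule this

/-- If the vectors `f₂ᵃ f₁₂ᵇ e₁ʲ v`, `f₂ᵃ f₁₂ᵇ f₁ʲ v` are linearly independent, then `v` generates a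
copy of the relaxed Verma module. -/
theorem RVerma.exists_injective_hom {lam : Module.Dual ℂ cartan} {μ : ℂ} {v : N}
    (hv : IsTopVector lam μ v) (hli : LinearIndependent ℂ (pbw v)) :
    ∃ f : RVerma lam μ →ₗ⁅ℂ, sl3⁆ N, f (RVerma.gen lam μ) = v ∧ Function.Injective f ∧
      f.range.toSubmodule = Submodule.span ℂ (Set.range (pbw v)) := by
  obtain ⟨f, hf⟩ := RVerma.exists_hom hv
  have hcomp : ⇑f ∘ pbw (RVerma.gen lam μ) = pbw v := by
    funext p
    rw [Function.comp_apply, map_pbw, hf]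
  refine ⟨f, hf, ?_, ?_⟩
  · refine (injective_iff_map_eq_zero f).2 fun x hx => ?_
    have hx' : x ∈ Submodule.span ℂ (Set.range (pbw (RVerma.gen lam μ))) := by
      rw [RVerma.span_pbw]; trivial
    obtain ⟨c, rfl⟩ := (Finsupp.mem_span_range_iff_exists_finsupp).1 hx'
    -- An element of the kernel is a combination of spanning vectors whose coefficients give a
    -- relation among the independent vectors `pbw v`.
    have h0 : Finsupp.linearCombination ℂ (pbw v) c = 0 := by
      rw [← hx, Finsupp.linearCombination_apply, Finsupp.sum, Finsupp.sum, map_sum]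
      simp only [map_smul, ← hcomp, Function.comp_apply]
    rw [linearIndependent_iff.1 hli c h0, Finsupp.sum_zero_index]
  · rw [← hcomp, Set.range_comp]
    have := Submodule.map_span (f : RVerma lam μ →ₗ[ℂ] N) (Set.range (pbw (RVerma.gen lam μ)))
    rw [RVerma.span_pbw, Submodule.map_top] at this
    exact this

end PBW

/-! ### The contragredient model of the relaxed Verma modules -/

section WMatrix

variable {μ₁ : ℂ} {μ₂ : ℤ} (hμ : ∀ n : ℤ, μ₁ + (μ₂ : ℂ) ≠ n) (k l : ℤ) (m : ℕ) (q : ℤ × ℤ × ℕ)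
include hμ

theorem wMatrix_e1 : wMatrix μ₁ μ₂ e1 (k, l, m) q =
    -bar μ₁ k * Finsupp.single (k - 1, l, m) 1 q +
    (-(bar (μ₂ : ℂ) l * (bar (μ₂ : ℂ) l - 1)) /
      ((bar μ₁ k + bar (μ₂ : ℂ) l) * (bar μ₁ k + bar (μ₂ : ℂ) l - 1)) * m) *
        Finsupp.single (k, l + 1, m - 1) 1 q := by
  rw [wMatrix, lie_e1_w hμ, map_add, map_smul, map_smul, repr_w, repr_w]
  rfl

theorem wMatrix_e2 : wMatrix μ₁ μ₂ e2 (k, l, m) q =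
    -bar (μ₂ : ℂ) l * Finsupp.single (k, l - 1, m) 1 q +
    ((bar μ₁ k * (bar μ₁ k - 1)) /
      ((bar μ₁ k + bar (μ₂ : ℂ) l) * (bar μ₁ k + bar (μ₂ : ℂ) l - 1)) * m) *
        Finsupp.single (k + 1, l, m - 1) 1 q := by
  rw [wMatrix, lie_e2_w hμ, map_add, map_smul, map_smul, repr_w, repr_w]
  rfl

theorem wMatrix_f1 : wMatrix μ₁ μ₂ f1 (k, l, m) q =
    -bar (μ₂ : ℂ) l * Finsupp.single (k, l - 1, m + 1) 1 q +
    (bar μ₁ k * (bar μ₁ k - 1) * (m + (bar μ₁ k + bar (μ₂ : ℂ) l)) /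
      ((bar μ₁ k + bar (μ₂ : ℂ) l) * (bar μ₁ k + bar (μ₂ : ℂ) l - 1))) *
        Finsupp.single (k + 1, l, m) 1 q := by
  rw [wMatrix, lie_f1_w hμ, map_add, map_smul, map_smul, repr_w, repr_w]
  rfl

theorem wMatrix_f2 : wMatrix μ₁ μ₂ f2 (k, l, m) q =
    bar μ₁ k * Finsupp.single (k - 1, l, m + 1) 1 q +
    (bar (μ₂ : ℂ) l * (bar (μ₂ : ℂ) l - 1) * (m + (bar μ₁ k + bar (μ₂ : ℂ) l)) /
      ((bar μ₁ k + bar (μ₂ : ℂ) l) * (bar μ₁ k + bar (μ₂ : ℂ) l - 1))) *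
        Finsupp.single (k, l + 1, m) 1 q := by
  rw [wMatrix, lie_f2_w hμ, map_add, map_smul, map_smul, repr_w, repr_w]
  rfl

theorem wMatrix_e12 : wMatrix μ₁ μ₂ e12 (k, l, m) q =
    -m * Finsupp.single (k, l, m - 1) 1 q := by
  rw [wMatrix, lie_e12_w hμ, map_smul, repr_w]
  rfl

theorem wMatrix_f12 : wMatrix μ₁ μ₂ f12 (k, l, m) q =
    (bar μ₁ k + bar (μ₂ : ℂ) l + m) * Finsupp.single (k, l, m + 1) 1 q := by
  rw [wMatrix, lie_f12_w' hμ, map_smul, repr_w]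
  rfl

end WMatrix

/-! ### Parameters of the three generators -/

theorem alpha1_h1 : alpha1 ⟨h1, h1_mem_cartan⟩ = 2 := by
  change h1.1 0 0 - h1.1 1 1 = 2
  rw [show h1.1 = _ from int_h1]; change ((1 : ℤ) : ℂ) - ((-1 : ℤ) : ℂ) = _; norm_num
theorem alpha1_h2 : alpha1 ⟨h2, h2_mem_cartan⟩ = -1 := by
  change h2.1 0 0 - h2.1 1 1 = -1
  rw [show h2.1 = _ from int_h2]; change ((0 : ℤ) : ℂ) - ((1 : ℤ) : ℂ) = _; norm_num
theorem alpha2_h1 : alpha2 ⟨h1, h1_mem_cartan⟩ = -1 := by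
  change h1.1 1 1 - h1.1 2 2 = -1
  rw [show h1.1 = _ from int_h1]; change ((-1 : ℤ) : ℂ) - ((0 : ℤ) : ℂ) = _; norm_num
theorem alpha2_h2 : alpha2 ⟨h2, h2_mem_cartan⟩ = 2 := by
  change h2.1 1 1 - h2.1 2 2 = 2
  rw [show h2.1 = _ from int_h2]; change ((1 : ℤ) : ℂ) - ((-1 : ℤ) : ℂ) = _; norm_num

theorem cartan_eq (h : cartan) : h = h.1.1 0 0 • (⟨h1, h1_mem_cartan⟩ : cartan) +
    (-h.1.1 2 2) • (⟨h2, h2_mem_cartan⟩ : cartan) := by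
  apply Subtype.ext
  apply Subtype.ext
  have ht : h.1.1 0 0 + h.1.1 1 1 + h.1.1 2 2 = 0 := by
    have : h.1.1.trace = 0 := h.1.2
    rwa [Matrix.trace_fin_three] at this
  change h.1.1 = h.1.1 0 0 • h1.1 + (-h.1.1 2 2) • h2.1
  rw [show h1.1 = _ from int_h1, show h2.1 = _ from int_h2]
  ext i j
  have hd := h.2 i j
  fin_cases i <;> fin_cases j <;> simp at hd ⊢ <;> first | exact hd | linear_combination ht

/-- The parameters `λ`, `c`, `k` for which the vector at `(k, μ₂ + c, 0)` satisfies the relations of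
the generator of `𝓡_{𝔭₁,λ,μ₁}`. -/
structure IsTopIndex (μ₁ : ℂ) (lam : Module.Dual ℂ cartan) (c : ℕ) (k : ℤ) : Prop where
  lam_h1 : lam ⟨h1, h1_mem_cartan⟩ = -2 * k + c
  lam_h2 : lam ⟨h2, h2_mem_cartan⟩ = k - 2 * c
  casimir : bar μ₁ k * (bar μ₁ k - 1) * (bar μ₁ k - 2) =
    (μ₁ + 1) * (μ₁ + lam ⟨h1, h1_mem_cartan⟩) * (bar μ₁ k + c - 2)
  le_two : c ≤ 2

/-- The weights force `k` through `λ(h₁) = -2k + c`: for `λ = 0, -ρ, -2α₂` the pairs `(c, k)` are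
`(0, 0)`, `(1, 1)`, `(2, 0)`. In each case `k̄ + c - 2` is one of the three factors of the cubic in
`casimir`. -/
theorem isTopIndex_zero (μ₁ : ℂ) : IsTopIndex μ₁ 0 0 0 where
  lam_h1 := by simp
  lam_h2 := by simp
  casimir := by simp [bar]; ring
  le_two := by omega

theorem isTopIndex_neg_rho (μ₁ : ℂ) : IsTopIndex μ₁ (-rho) 1 1 where
  lam_h1 := by
    rw [LinearMap.neg_apply, rho, LinearMap.add_apply, alpha1_h1, alpha2_h1]; norm_num
  lam_h2 := by
    rw [LinearMap.neg_apply, rho, LinearMap.add_apply, alpha1_h2, alpha2_h2]; norm_num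
  casimir := by
    rw [LinearMap.neg_apply, rho, LinearMap.add_apply, alpha1_h1, alpha2_h1, bar]
    push_cast
    ring
  le_two := by omega

theorem isTopIndex_neg_two_alpha2 (μ₁ : ℂ) : IsTopIndex μ₁ (-(2 : ℂ) • alpha2) 2 0 where
  lam_h1 := by
    rw [LinearMap.smul_apply, alpha2_h1]; norm_num
  lam_h2 := by
    rw [LinearMap.smul_apply, alpha2_h2]; norm_num
  casimir := by
    rw [LinearMap.smul_apply, alpha2_h1, bar, smul_eq_mul]
    push_cast
    ring
  le_two := by omega

theorem bar_int_add (μ₂ : ℤ) (c : ℕ) : bar (μ₂ : ℂ) (μ₂ + c) = c := by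
  simp [bar]

/-- Stated for an abstract `v` because it is applied to two kinds of vectors with the same `f₁
e₁`-scalar: coordinate functionals on `M_{l̄ ≥ 0}`, and basis vectors on the lowest level of a
subquotient. For the weight it suffices to know `h₁` and `h₂`, which span `𝔱`. -/
theorem IsTopIndex.isTopVector {μ₁ : ℂ} {μ₂ : ℤ} (hμ : ∀ n : ℤ, μ₁ + (μ₂ : ℂ) ≠ n)
    {lam : Module.Dual ℂ cartan} {c : ℕ} {k : ℤ} (hc : IsTopIndex μ₁ lam c k)
    {N : Type} [AddCommGroup N] [Module ℂ N] [LieRingModule sl3 N] [LieModule ℂ sl3 N] {v : N}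
    (hv : v ∈ eig N (wEig μ₁ μ₂ (k, μ₂ + c, 0)))
    (hcas : ⁅f1, ⁅e1, v⁆⁆ =
      (-(bar μ₁ k * (bar μ₁ k - 1) * (bar μ₁ k - 2)) / (bar μ₁ k + c - 2)) • v)
    (he2 : ⁅e2, v⁆ = 0) (he12 : ⁅e12, v⁆ = 0) : IsTopVector lam μ₁ v where
  weight h := by
    obtain ⟨a₁, a₂, -⟩ := hv
    have e : (h : sl3) = h.1.1 0 0 • h1 + (-h.1.1 2 2) • h2 := congrArg Subtype.val (cartan_eq h)
    have e' : (lam + μ₁ • alpha1) h = h.1.1 0 0 * (lam + μ₁ • alpha1) ⟨h1, h1_mem_cartan⟩ +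
        (-h.1.1 2 2) * (lam + μ₁ • alpha1) ⟨h2, h2_mem_cartan⟩ := by
      conv_lhs => rw [cartan_eq h]
      rw [map_add, map_smul, map_smul, smul_eq_mul, smul_eq_mul]
    rw [e', LinearMap.add_apply, LinearMap.add_apply, LinearMap.smul_apply, LinearMap.smul_apply,
      alpha1_h1, alpha1_h2, hc.lam_h1, hc.lam_h2]
    conv_lhs => rw [e]
    rw [add_lie, smul_lie, smul_lie, a₁, a₂]
    simp only [wEig, bar_int_add]
    rw [smul_smul, smul_smul, ← add_smul]
    congr 1
    simp only [bar, Nat.cast_zero, smul_eq_mul]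
    ring
  casimir := by
    have hS : bar μ₁ k + c - 2 ≠ 0 := by
      have := wt_add_ne hμ k (μ₂ + c) (-2)
      rw [bar_int_add] at this
      push_cast at this
      rwa [← sub_eq_add_neg] at this
    rw [hcas, hc.casimir, ← neg_mul, mul_div_cancel_right₀ _ hS]
  e2_eq := he2
  e12_eq := he12

/-! ### Coordinate functionals in the twisted dual -/

section Coord

variable {I M : Type} [AddCommGroup M] [Module ℂ M] [LieRingModule sl3 M] [LieModule ℂ sl3 M]
  {J : Set I} (b : Basis J ℂ M)

open scoped Classical in
/-- The coordinate functional at `p`, which is zero if `p ∉ J`. -/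
def coordFun (p : I) : TwistedDual M :=
  (b.constr ℂ fun q => if q.1 = p then (1 : ℂ) else 0 : M →ₗ[ℂ] ℂ)

variable {b}

theorem coordFun_apply_basis (p : I) (q : J) : coordFun b p (b q) = Finsupp.single q.1 1 p := by
  classical
  rw [Finsupp.single_apply]
  refine (b.constr_basis ℂ _ q).trans ?_
  congr

theorem coordFun_apply (p : J) (x : M) : coordFun b p x = b.repr x p := by
  induction x using basis_induction b with
  | zero => rw [map_zero b.repr]; exact map_zero (show M →ₗ[ℂ] ℂ from coordFun b p)
  | coe q =>
    classical
    rw [coordFun_apply_basis, Basis.repr_self, Finsupp.single_apply, Finsupp.single_apply]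
    simp only [Subtype.ext_iff]
  | smul c x hx =>
    rw [map_smul b.repr, Finsupp.smul_apply, ← hx]
    exact map_smul (show M →ₗ[ℂ] ℂ from coordFun b p) c x
  | add x y hx hy =>
    rw [map_add b.repr, Finsupp.add_apply, ← hx, ← hy]
    exact map_add (show M →ₗ[ℂ] ℂ from coordFun b p) x y

theorem twistedDual_ext {η θ : TwistedDual M} (h : ∀ q, η (b q) = θ (b q)) : η = θ :=
  b.ext (f₁ := (η : M →ₗ[ℂ] ℂ)) (f₂ := (θ : M →ₗ[ℂ] ℂ)) h

theorem lie_coordFun_apply {A : sl3 → I → I → ℂ} (hb : HasMatrix b A) (X : sl3) (p q : J) :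
    ⁅X, coordFun b p⁆ (b q) = -A (tau X) q p := by
  rw [twistedDual_lie_apply, coordFun_apply, hb]

/-- `τ` negates `h₁` and `h₂` and exchanges `e₁₂` with `-f₁₂`, so `h₁`, `h₂` and `f₁₂ e₁₂` act on
functionals by their transposes, with unchanged eigenvalues. -/
theorem coordFun_mem_eig {χ : I → ℂ × ℂ × ℂ} (hχ : IsEigenBasis b χ) (p : J) :
    coordFun b p ∈ eig (TwistedDual M) (χ p) := by
  have key : ∀ (i : Fin 3) (x : M),
      coordFun b p (eigOp i x) = comp (χ p) i * coordFun b p x := fun i x => by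
    rw [coordFun_apply, coordFun_apply, hχ.repr_eigOp]
  have hneg : ∀ x : M, coordFun b p (-x) = -coordFun b p x :=
    map_neg (show M →ₗ[ℂ] ℂ from coordFun b p)
  refine ⟨DFunLike.ext _ _ fun x => ?_, DFunLike.ext _ _ fun x => ?_, DFunLike.ext _ _ fun x => ?_⟩
  · rw [twistedDual_lie_apply, tau_h1, neg_lie, hneg, neg_neg]
    exact key 0 x
  · rw [twistedDual_lie_apply, tau_h2, neg_lie, hneg, neg_neg]
    exact key 1 x
  · rw [twistedDual_lie_apply, twistedDual_lie_apply, tau_f12, tau_e12, neg_lie, neg_lie, lie_neg,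
      neg_neg, neg_neg]
    exact key 2 x

end Coord

/-! ### Action on the coordinate functionals of `M_{l̄ ≥ 0}` -/

section Contragredient

/-- Compares two matrix entries, each a scalar times an indicator. The alternative `a = 0` allows
the indicator on the left to match spuriously, as truncated subtraction makes it do. -/
theorem mul_single_eq {I : Type} {a a' : ℂ} {p p' q q' : I} (h : p = p' → a = 0 ∨ q = q')
    (h' : q = q' → p = p' ∧ a = a') :
    a * Finsupp.single p 1 p' = a' * Finsupp.single q 1 q' := by
  classical
  rw [Finsupp.single_apply, Finsupp.single_apply]
  by_cases hq : q = q'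
  · obtain ⟨rfl, rfl⟩ := h' hq
    rw [if_pos rfl, if_pos hq]
  · rw [if_neg hq, mul_zero]
    split_ifs with hp
    · rw [(h hp).resolve_right hq, zero_mul]
    · rw [mul_zero]

/-- For `c = 1, 2` the level just below `c` is a root of `l̄(l̄ - 1)`, and for `c = 0` it lies
outside `l̄ ≥ 0`. So no arrow of `M_{l̄ ≥ 0}` enters the level `c` from below. -/
theorem bar_mul_eq_zero {μ₂ : ℤ} {c : ℕ} (hc : c ≤ 2) {l : ℤ} (hl : μ₂ ≤ l) (h : l + 1 = μ₂ + c) :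
    bar (μ₂ : ℂ) l * (bar (μ₂ : ℂ) l - 1) = 0 := by
  obtain rfl | rfl : l = μ₂ ∨ l = μ₂ + 1 := by omega
  · simp [bar]
  · simp [bar]

variable {μ₁ : ℂ} {μ₂ : ℤ} (hμ : ∀ n : ℤ, μ₁ + (μ₂ : ℂ) ≠ n)
  {M : Type} [AddCommGroup M] [Module ℂ M] [LieRingModule sl3 M] [LieModule ℂ sl3 M]
  {b : Basis {p : ℤ × ℤ × ℕ | μ₂ ≤ p.2.1} ℂ M} (hb : HasMatrix b (wMatrix μ₁ μ₂))
include hμ hb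

/-- `f₂` acts by minus the transpose of `e₂`. The coefficient `l̄ + 1` towards the next level is
nonzero for `l̄ ≥ 0`, which makes the powers of `f₂` act freely. -/
theorem lie_f2_coordFun (k : ℤ) {l : ℤ} (hl : μ₂ ≤ l) (m : ℕ) :
    ⁅f2, coordFun b (k, l, m)⁆ = (bar (μ₂ : ℂ) l + 1) • coordFun b (k, l + 1, m) +
      (-((bar μ₁ k - 1) * (bar μ₁ k - 2) / ((bar μ₁ k - 1 + bar (μ₂ : ℂ) l) *
        (bar μ₁ k - 1 + bar (μ₂ : ℂ) l - 1)) * (m + 1))) • coordFun b (k - 1, l, m + 1) := by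
  refine twistedDual_ext (b := b) fun ⟨⟨k', l', m'⟩, hq⟩ => ?_
  refine (lie_coordFun_apply hb f2 ⟨(k, l, m), hl⟩ _).trans ?_
  change _ = _ * coordFun b _ _ + _ * coordFun b _ _
  rw [tau_f2, wMatrix_e2 hμ, coordFun_apply_basis, coordFun_apply_basis, neg_add, ← neg_mul,
    ← neg_mul, neg_neg]
  congr 1
  · refine mul_single_eq (fun h => Or.inr ?_) fun h => ?_
    · simp only [Prod.mk.injEq] at h ⊢
      omega
    · simp only [Prod.mk.injEq] at h ⊢
      obtain ⟨rfl, rfl, rfl⟩ := h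
      refine ⟨⟨rfl, by omega, rfl⟩, ?_⟩
      rw [bar_add_one]
  · refine mul_single_eq (fun h => ?_) fun h => ?_
    -- At `m' = 0` the truncated `m' - 1` may match a wrong index; the factor `m'` removes that
    -- term.
    · cases m' with
      | zero => left; simp
      | succ m' =>
        right
        simp only [Prod.mk.injEq] at h ⊢
        omega
    · simp only [Prod.mk.injEq] at h ⊢
      obtain ⟨rfl, rfl, rfl⟩ := h
      refine ⟨⟨by omega, rfl, by omega⟩, ?_⟩
      rw [bar_sub_one]
      push_cast
      ring

theorem lie_f12_coordFun (k : ℤ) {l : ℤ} (hl : μ₂ ≤ l) (m : ℕ) :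
    ⁅f12, coordFun b (k, l, m)⁆ = (-(m + 1) : ℂ) • coordFun b (k, l, m + 1) := by
  refine twistedDual_ext (b := b) fun ⟨⟨k', l', m'⟩, hq⟩ => ?_
  rw [← neg_neg f12, neg_lie]
  change -(⁅-f12, coordFun b _⁆ _) = _ * coordFun b _ _
  rw [lie_coordFun_apply hb (-f12) ⟨(k, l, m), hl⟩, map_neg, tau_f12, neg_neg, neg_neg,
    wMatrix_e12 hμ, coordFun_apply_basis]
  refine mul_single_eq (fun h => ?_) fun h => ?_
  · cases m' with
    | zero => left; simp
    | succ m' =>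
      right
      simp only [Prod.mk.injEq] at h ⊢
      omega
  · simp only [Prod.mk.injEq] at h ⊢
    obtain ⟨rfl, rfl, rfl⟩ := h
    refine ⟨⟨rfl, rfl, by omega⟩, ?_⟩
    push_cast
    rfl

theorem lie_e1_coordFun (k : ℤ) {l : ℤ} (hl : μ₂ ≤ l) :
    ⁅e1, coordFun b (k, l, 0)⁆ = (-((bar μ₁ k - 1) * (bar μ₁ k - 2) /
      (bar μ₁ k + bar (μ₂ : ℂ) l - 2))) • coordFun b (k - 1, l, 0) := by
  refine twistedDual_ext (b := b) fun ⟨⟨k', l', m'⟩, hq⟩ => ?_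
  refine (lie_coordFun_apply hb e1 ⟨(k, l, 0), hl⟩ _).trans ?_
  change _ = _ * coordFun b _ _
  rw [tau_e1, wMatrix_f1 hμ, coordFun_apply_basis, Finsupp.single_eq_of_ne (by simp), mul_zero,
    zero_add, ← neg_mul]
  refine mul_single_eq (fun h => Or.inr ?_) fun h => ?_
  · simp only [Prod.mk.injEq] at h ⊢
    omega
  · simp only [Prod.mk.injEq] at h ⊢
    obtain ⟨rfl, rfl, rfl⟩ := h
    refine ⟨⟨by omega, rfl, rfl⟩, ?_⟩
    have h1 := wt_ne hμ (k - 1) l'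
    have h2 := wt_sub_one_ne hμ (k - 1) l'
    rw [bar_sub_one] at h1 h2 ⊢
    rw [show bar μ₁ k + bar (μ₂ : ℂ) l' - 2 = bar μ₁ k - 1 + bar (μ₂ : ℂ) l' - 1 by ring]
    field_simp
    push_cast
    ring

theorem lie_f1_coordFun (k : ℤ) {c : ℕ} (hc : c ≤ 2) :
    ⁅f1, coordFun b (k, μ₂ + c, 0)⁆ = (bar μ₁ k + 1) • coordFun b (k + 1, μ₂ + c, 0) := by
  refine twistedDual_ext (b := b) fun ⟨⟨k', l', m'⟩, hq⟩ => ?_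
  refine (lie_coordFun_apply hb f1 ⟨(k, μ₂ + c, 0),
    show μ₂ ≤ μ₂ + c by omega⟩ _).trans ?_
  change _ = _ * coordFun b _ _
  -- The second term of the `e₁`-entry could only come from the level `c - 1`, where its coefficient
  -- vanishes.
  have h0 : Finsupp.single (k', l' + 1, m' - 1) (1 : ℂ) (k, μ₂ + c, 0) = 0 ∨
      bar (μ₂ : ℂ) l' * (bar (μ₂ : ℂ) l' - 1) = 0 := by
    by_cases h : (k, μ₂ + (c : ℤ), 0) = (k', l' + 1, m' - 1)
    · right
      simp only [Prod.mk.injEq] at h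
      exact bar_mul_eq_zero hc hq h.2.1.symm
    · left
      exact Finsupp.single_eq_of_ne h
  rw [tau_f1, wMatrix_e1 hμ, coordFun_apply_basis]
  have h1 : ∀ x y : ℂ, x / y * m' * Finsupp.single (k', l' + 1, m' - 1) (1 : ℂ) (k, μ₂ + c, 0)
      = x * Finsupp.single (k', l' + 1, m' - 1) (1 : ℂ) (k, μ₂ + c, 0) * (m' / y) := by
    intro x y; ring
  rw [h1, neg_mul (_ * _), mul_eq_zero.2 h0.symm, neg_zero, zero_mul, add_zero, ← neg_mul, neg_neg]
  refine mul_single_eq (fun h => Or.inr ?_) fun h => ?_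
  · simp only [Prod.mk.injEq] at h ⊢
    omega
  · simp only [Prod.mk.injEq] at h ⊢
    obtain ⟨rfl, rfl, rfl⟩ := h
    refine ⟨⟨by omega, rfl, rfl⟩, ?_⟩
    rw [bar_add_one]

theorem lie_e2_coordFun (k : ℤ) {c : ℕ} (hc : c ≤ 2) :
    ⁅e2, coordFun b (k, μ₂ + c, 0)⁆ = 0 := by
  refine twistedDual_ext (b := b) fun ⟨⟨k', l', m'⟩, hq⟩ => ?_
  refine (lie_coordFun_apply hb e2 ⟨(k, μ₂ + c, 0),
    show μ₂ ≤ μ₂ + c by omega⟩ _).trans ?_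
  change _ = (0 : ℂ)
  have h0 : Finsupp.single (k', l' + 1, m') (1 : ℂ) (k, μ₂ + c, 0) = 0 ∨
      bar (μ₂ : ℂ) l' * (bar (μ₂ : ℂ) l' - 1) = 0 := by
    by_cases h : (k, μ₂ + (c : ℤ), 0) = (k', l' + 1, m')
    · right
      simp only [Prod.mk.injEq] at h
      exact bar_mul_eq_zero hc hq h.2.1.symm
    · left
      exact Finsupp.single_eq_of_ne h
  rw [tau_e2, wMatrix_f2 hμ, Finsupp.single_eq_of_ne (by simp), mul_zero, zero_add, neg_eq_zero]
  rcases h0 with h | h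
  · rw [h, mul_zero]
  · rw [h, zero_mul, zero_div, zero_mul]

theorem lie_e12_coordFun (k : ℤ) {l : ℤ} (hl : μ₂ ≤ l) : ⁅e12, coordFun b (k, l, 0)⁆ = 0 := by
  refine twistedDual_ext (b := b) fun ⟨⟨k', l', m'⟩, hq⟩ => ?_
  rw [← neg_neg e12, neg_lie]
  change -(⁅-e12, coordFun b _⁆ _) = (0 : ℂ)
  rw [lie_coordFun_apply hb (-e12) ⟨(k, l, 0), hl⟩, map_neg, tau_e12, neg_neg, neg_neg,
    wMatrix_f12 hμ, Finsupp.single_eq_of_ne (by simp), mul_zero]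

theorem IsTopIndex.isTopVector_coordFun (hχ : IsEigenBasis b (wEig μ₁ μ₂))
    {lam : Module.Dual ℂ cartan} {c : ℕ} {k : ℤ} (hc : IsTopIndex μ₁ lam c k) :
    IsTopVector lam μ₁ (coordFun b (k, μ₂ + c, 0)) := by
  have hl : μ₂ ≤ μ₂ + (c : ℤ) := by omega
  refine hc.isTopVector hμ (coordFun_mem_eig hχ ⟨(k, μ₂ + c, 0), hl⟩) ?_
    (lie_e2_coordFun hμ hb k hc.le_two) (lie_e12_coordFun hμ hb k hl)
  rw [lie_e1_coordFun hμ hb k hl, lie_smul, lie_f1_coordFun hμ hb _ hc.le_two, smul_smul,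
    sub_add_cancel, bar_int_add, bar_sub_one]
  congr 1
  ring

/-- The multiples of `coordFun b` occurring in the top of the relaxed Verma module. -/
theorem topVec_coordFun (k : ℤ) {c : ℕ} (hc : c ≤ 2) (j : ℤ) :
    ∃ d : ℂ, d ≠ 0 ∧
      topVec (coordFun b (k, μ₂ + c, 0)) j = d • coordFun b (k - j, μ₂ + c, 0) := by
  have hl : μ₂ ≤ μ₂ + (c : ℤ) := by omega
  obtain ⟨n, rfl | rfl⟩ := Int.eq_nat_or_neg j
  · induction n with
    | zero => exact ⟨1, one_ne_zero, by rw [one_smul, Nat.cast_zero, sub_zero]; rfl⟩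
    | succ n ih =>
      obtain ⟨d, hd, h⟩ := ih
      refine ⟨d * -((bar μ₁ (k - n) - 1) * (bar μ₁ (k - n) - 2) /
        (bar μ₁ (k - n) + bar (μ₂ : ℂ) (μ₂ + c) - 2)), mul_ne_zero hd (neg_ne_zero.2
          (div_ne_zero (mul_ne_zero ?_ ?_) ?_)), ?_⟩
      · exact bar_sub_one_ne hμ _
      · simpa using bar_sub_ne hμ (k - n) 2
      · simpa [sub_eq_add_neg] using wt_add_ne hμ (k - n) (μ₂ + c) (-2)
      · rw [topVec_ofNat_succ, h, lie_smul, lie_e1_coordFun hμ hb _ hl, smul_smul,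
          show k - (n : ℤ) - 1 = k - (n + 1 : ℕ) by push_cast; ring]
  · induction n with
    | zero => exact ⟨1, one_ne_zero, by rw [one_smul, Nat.cast_zero, neg_zero, sub_zero]; rfl⟩
    | succ n ih =>
      obtain ⟨d, hd, h⟩ := ih
      refine ⟨d * (bar μ₁ (k - -n) + 1), mul_ne_zero hd ?_, ?_⟩
      · simpa using bar_sub_ne hμ (k - -n) (-1)
      · rw [topVec_neg_succ, h, lie_smul, lie_f1_coordFun hμ hb _ hc, smul_smul,
          show k - -(n : ℤ) + 1 = k - -(n + 1 : ℕ) by push_cast; ring]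

/-- Each `f₂` raises the level by one with the nonzero factor `l̄ + 1`, up to terms that stay on the
same level; `f₁₂` and the passage through the top contribute nonzero scalars. Hence the family is
triangular with respect to the exponent of `f₂`. -/
theorem pbw_coordFun (k : ℤ) {c : ℕ} (hc : c ≤ 2) (p : ℤ × ℕ × ℕ) :
    ∃ d : ℂ, d ≠ 0 ∧ pbw (coordFun b (k, μ₂ + c, 0)) p -
      d • coordFun b (k - p.1, μ₂ + c + p.2.1, p.2.2) ∈
        Submodule.span ℂ ((fun q : ℤ × ℕ × ℕ => coordFun b (k - q.1, μ₂ + c + q.2.1, q.2.2)) ''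
          {q | q.2.1 < p.2.1}) := by
  obtain ⟨j, a, m⟩ := p
  induction a with
  | zero =>
    obtain ⟨d, hd, h⟩ : ∃ d : ℂ, d ≠ 0 ∧ pbw (coordFun b (k, μ₂ + c, 0)) (j, 0, m) =
        d • coordFun b (k - j, μ₂ + c, m) := by
      induction m with
      | zero => exact topVec_coordFun hμ hb k hc j
      | succ m ih =>
        obtain ⟨d, hd, h⟩ := ih
        refine ⟨d * -(m + 1), mul_ne_zero hd (neg_ne_zero.2 (Nat.cast_add_one_ne_zero m)), ?_⟩
        rw [pbw_zero_succ, h, lie_smul, lie_f12_coordFun hμ hb _ (by omega), smul_smul]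
    refine ⟨d, hd, ?_⟩
    rw [h, Nat.cast_zero, add_zero, sub_self]
    exact zero_mem _
  | succ a ih =>
    obtain ⟨d, hd, h⟩ := ih
    -- The scalar `c + q.2.1 + 1` is `l̄ + 1` at `l = μ₂ + c + q.2.1`.
    have hstep : ∀ (q : ℤ × ℕ × ℕ), ⁅f2, coordFun b (k - q.1, μ₂ + c + q.2.1, q.2.2)⁆ -
        ((c + q.2.1 + 1 : ℕ) : ℂ) • coordFun b (k - q.1, μ₂ + c + (q.2.1 + 1 : ℕ), q.2.2) ∈
        Submodule.span ℂ ((fun q : ℤ × ℕ × ℕ => coordFun b (k - q.1, μ₂ + c + q.2.1, q.2.2)) ''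
          {s | s.2.1 ≤ q.2.1}) := by
      rintro ⟨j, a, m⟩
      rw [lie_f2_coordFun hμ hb _ (by omega),
        show μ₂ + (c : ℤ) + (a : ℤ) = μ₂ + ((c + a : ℕ) : ℤ) by push_cast; ring, bar_int_add,
        ← Nat.cast_add_one,
        show μ₂ + ((c + a : ℕ) : ℤ) + 1 = μ₂ + c + ((a + 1 : ℕ) : ℤ) by push_cast; ring,
        add_sub_cancel_left]
      refine Submodule.smul_mem _ _ (Submodule.subset_span ⟨(j + 1, a, m + 1), le_refl a, ?_⟩)
      change coordFun b _ = _
      rw [show k - (j + 1) = k - j - 1 by ring,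
        show μ₂ + ((c + a : ℕ) : ℤ) = μ₂ + c + (a : ℤ) by push_cast; ring]
    refine ⟨d * ((c + a + 1 : ℕ) : ℂ), mul_ne_zero hd (Nat.cast_ne_zero.2 (by omega)), ?_⟩
    have h1 : ∀ y ∈ Submodule.span ℂ
        ((fun q : ℤ × ℕ × ℕ => coordFun b (k - q.1, μ₂ + c + q.2.1, q.2.2)) '' {q | q.2.1 < a}),
        ⁅f2, y⁆ ∈ Submodule.span ℂ ((fun q : ℤ × ℕ × ℕ =>
          coordFun b (k - q.1, μ₂ + c + q.2.1, q.2.2)) '' {q | q.2.1 < a + 1}) := by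
      intro y hy
      induction hy using Submodule.span_induction with
      | mem y hy =>
        obtain ⟨q, hq, rfl⟩ := hy
        have hq' : q.2.1 < a := hq
        rw [← sub_add_cancel ⁅f2, _⁆ (((c + q.2.1 + 1 : ℕ) : ℂ) •
          coordFun b (k - q.1, μ₂ + c + (q.2.1 + 1 : ℕ), q.2.2))]
        refine add_mem (Submodule.span_mono (Set.image_mono fun s hs => ?_) (hstep q))
          (Submodule.smul_mem _ _ (Submodule.subset_span ⟨(q.1, q.2.1 + 1, q.2.2), ?_, rfl⟩))
        · have hs' : s.2.1 ≤ q.2.1 := hs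
          change s.2.1 < a + 1
          omega
        · change q.2.1 + 1 < a + 1
          omega
      | zero => rw [lie_zero]; exact zero_mem _
      | add x y _ _ hx hy => rw [lie_add]; exact add_mem hx hy
      | smul c x _ hx => rw [lie_smul]; exact Submodule.smul_mem _ _ hx
    have h2 := add_mem (h1 _ h) (Submodule.smul_mem _ d
      (Submodule.span_mono (Set.image_mono fun s hs => Nat.lt_succ_of_le hs) (hstep (j, a, m))))
    rw [lie_sub, ← pbw_succ_left, lie_smul, smul_sub, sub_add_sub_cancel, smul_smul] at h2
    exact h2

end Contragredient

/-! ### Bases of the relaxed Verma modules -/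

section Basis

variable {μ₁ : ℂ} {μ₂ : ℤ} (hμ : ∀ n : ℤ, μ₁ + (μ₂ : ℂ) ≠ n)
include hμ

theorem isStable_ge_zero : IsStable μ₁ μ₂ {p | μ₂ ≤ p.2.1} :=
  isStable_of (P := fun l => μ₂ ≤ l) hμ (by omega) (by omega)

/-- The relaxed Verma modules have a basis in which the action is contragredient to that on the
vectors `w`. -/
theorem IsTopIndex.exists_basis {lam : Module.Dual ℂ cartan} {c : ℕ} {k : ℤ}
    (hc : IsTopIndex μ₁ lam c k) :
    ∃ r : Basis {p : ℤ × ℤ × ℕ | μ₂ + c ≤ p.2.1} ℂ (RVerma lam μ₁),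
      HasMatrix r (dualMatrix (wMatrix μ₁ μ₂)) ∧ IsEigenBasis r (wEig μ₁ μ₂) ∧
      r ⟨(k, μ₂ + c, 0), le_refl (μ₂ + (c : ℤ))⟩ = RVerma.gen lam μ₁ := by
  -- All three relaxed Verma modules are realized in the twisted dual of the single module `M_{l̄ ≥
  -- 0}`.
  obtain ⟨b, hb, hbw, -⟩ := (isStable_ge_zero hμ).exists_basis
  have hχ : IsEigenBasis b (wEig μ₁ μ₂) := by
    refine ⟨fun p => mem_eig_of_coe ?_, (wEig_injective hμ).injOn⟩
    rw [hbw]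
    exact w_mem_eig hμ p
  choose d hd0 hd using pbw_coordFun hμ hb k hc.le_two
  let B : ℤ × ℕ × ℕ → TwistedDual (genSub μ₁ μ₂ {p | μ₂ ≤ p.2.1}) :=
    fun q => coordFun b (k - q.1, μ₂ + c + q.2.1, q.2.2)
  let idx : ℤ × ℕ × ℕ → {p : ℤ × ℤ × ℕ | μ₂ ≤ p.2.1} := fun q =>
    ⟨(k - q.1, μ₂ + c + q.2.1, q.2.2), show μ₂ ≤ μ₂ + c + q.2.1 by omega⟩
  let φ : ℤ × ℕ × ℕ → TwistedDual (genSub μ₁ μ₂ {p | μ₂ ≤ p.2.1}) →ₗ[ℂ] ℂ := fun q =>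
    { toFun := fun η => η (b (idx q))
      map_add' := fun _ _ => rfl
      map_smul' := fun _ _ => rfl }
  have hφ : ∀ p q, φ p (B q) = Finsupp.single (idx p).1 1 (idx q).1 := fun p q =>
    coordFun_apply_basis _ _
  have hidx : ∀ p q, (idx p).1 = (idx q).1 → p = q := by
    rintro ⟨j, a, m⟩ ⟨j', a', m'⟩ h
    simp only [idx, Prod.mk.injEq] at h ⊢
    omega
  obtain ⟨f, hfgen, hfinj, hfrange⟩ := RVerma.exists_injective_hom
    (hc.isTopVector_coordFun hμ hb hχ)
    (linearIndependent_of_triangular (φ := φ) (B := B) (ht := fun q => q.2.1) hd0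
      (fun p q h => by rw [hφ, Finsupp.single_eq_of_ne fun h' => h (hidx _ _ h').symm])
      (fun p => by rw [hφ, Finsupp.single_eq_same]) hd)
  rw [span_range_eq_of_triangular (B := B) (ht := fun q => q.2.1) hd0 hd] at hfrange
  have hsub : {p : ℤ × ℤ × ℕ | μ₂ + c ≤ p.2.1} ⊆ {p | μ₂ ≤ p.2.1} := by
    intro p hp
    have hp' : μ₂ + (c : ℤ) ≤ p.2.1 := hp
    change μ₂ ≤ p.2.1
    omega
  -- The image of `f` is the span of the coordinate functionals on the levels `l̄ ≥ c`; their
  -- preimages under the injective `f` form the required basis.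
  have hex : ∀ p : {p : ℤ × ℤ × ℕ | μ₂ + c ≤ p.2.1}, ∃ x, f x = coordFun b p := by
    rintro ⟨⟨k', l', m'⟩, hp⟩
    have hp' : μ₂ + (c : ℤ) ≤ l' := hp
    have hmem : coordFun b (k', l', m') ∈ f.range.toSubmodule := by
      rw [hfrange]
      -- This inverts the parametrization `(k - j, μ₂ + c + a, m)` used for `B`.
      refine Submodule.subset_span ⟨(k - k', (l' - (μ₂ + c)).toNat, m'), ?_⟩
      simp only [B]
      congr 2
      · ring
      · rw [Int.toNat_of_nonneg (by omega), add_sub_cancel]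
    exact (LieModuleHom.mem_range f _).1 hmem
  choose v hv using hex
  have hcoord : ∀ p q : {p : ℤ × ℤ × ℕ | μ₂ + c ≤ p.2.1},
      f (v p) (b (Set.inclusion hsub q)) = Finsupp.single p 1 q := by
    classical
    intro p q
    rw [hv, coordFun_apply_basis, Finsupp.single_apply, Finsupp.single_apply]
    simp only [Subtype.ext_iff, eq_comm]
  let ev : {p : ℤ × ℤ × ℕ | μ₂ + c ≤ p.2.1} → RVerma lam μ₁ →ₗ[ℂ] ℂ := fun q =>
    { toFun := fun x => f x (b (Set.inclusion hsub q))
      map_add' := fun x y => by rw [map_add]; rfl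
      map_smul' := fun a x => by rw [map_smul]; rfl }
  have li : LinearIndependent ℂ v := by
    -- With constant height and `B = v`, the criterion only asks for functionals dual to `v`, and
    -- evaluations at basis vectors of `M_{l̄ ≥ 0}` are such.
    refine linearIndependent_of_triangular (φ := ev) (B := v) (ht := fun _ => 0) (d := fun _ => 1)
      (fun _ => one_ne_zero) (fun p q h => ?_) (fun p => ?_) fun p => ?_
    · exact (hcoord q p).trans (Finsupp.single_eq_of_ne h)
    · exact (hcoord p p).trans Finsupp.single_eq_same
    · rw [one_smul, sub_self]; exact zero_mem _
  have sp : ⊤ ≤ Submodule.span ℂ (Set.range v) := by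
    rintro x -
    have hx : f x ∈ Submodule.span ℂ (Set.range B) := by
      rw [← hfrange]
      exact (LieModuleHom.mem_range f _).2 ⟨x, rfl⟩
    have hle : Submodule.span ℂ (Set.range B) ≤
        (Submodule.span ℂ (Set.range v)).map (f : RVerma lam μ₁ →ₗ[ℂ] _) := by
      refine Submodule.span_le.2 ?_
      rintro _ ⟨q, rfl⟩
      have hq : μ₂ + (c : ℤ) ≤ μ₂ + c + q.2.1 := by omega
      exact ⟨v ⟨(k - q.1, μ₂ + c + q.2.1, q.2.2), hq⟩, Submodule.subset_span ⟨_, rfl⟩, hv _⟩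
    obtain ⟨y, hy, hyx⟩ := hle hx
    have : y = x := hfinj hyx
    rwa [← this]
  obtain ⟨r, hr⟩ : ∃ r : Basis {p : ℤ × ℤ × ℕ | μ₂ + c ≤ p.2.1} ℂ (RVerma lam μ₁),
      ∀ p, r p = v p := ⟨Basis.mk li sp, fun p => Basis.mk_apply li sp p⟩
  have hrepr : ∀ x q, r.repr x q = f x (b (Set.inclusion hsub q)) := by
    intro x q
    induction x using basis_induction r with
    | zero => rw [map_zero, map_zero]; rfl
    | coe p => rw [hr, hcoord, ← hr, Basis.repr_self]
    | smul a x hx => rw [map_smul, map_smul, Finsupp.smul_apply, hx]; rfl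
    | add x y hx hy => rw [map_add, map_add, Finsupp.add_apply, hx, hy]; rfl
  refine ⟨r, fun X p q => ?_, ⟨fun p => ?_, (wEig_injective hμ).injOn⟩, ?_⟩
  · rw [hrepr, hr, f.map_lie, hv]
    exact lie_coordFun_apply hb X (Set.inclusion hsub p) (Set.inclusion hsub q)
  · rw [hr]
    obtain ⟨a₁, a₂, a₃⟩ := coordFun_mem_eig hχ (Set.inclusion hsub p)
    refine ⟨hfinj ?_, hfinj ?_, hfinj ?_⟩
    · rw [f.map_lie, map_smul, hv]; exact a₁
    · rw [f.map_lie, map_smul, hv]; exact a₂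
    · rw [f.map_lie, f.map_lie, map_smul, hv]; exact a₃
  · apply hfinj
    rw [hr, hv, hfgen]

end Basis

/-! ### The maximal submodules and the simple quotients -/

section Inclusion

variable {I M R : Type}
  [AddCommGroup M] [Module ℂ M] [LieRingModule sl3 M] [LieModule ℂ sl3 M]
  [AddCommGroup R] [Module ℂ R] [LieRingModule sl3 R] [LieModule ℂ sl3 R]
  {J J' : Set I} {A : sl3 → I → I → ℂ}

/-- If no arrow leads from `J` to the rest of `J'`, the basis vectors in `J` span a submodule of `M`
with the same matrix as `R`. -/
theorem HasMatrix.exists_inclusion {r : Basis J ℂ R} {b : Basis J' ℂ M}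
    (hr : HasMatrix r A) (hb : HasMatrix b A) (hJ : J ⊆ J')
    (hA : ∀ X, ∀ p ∈ J, ∀ q ∈ J', q ∉ J → A X p q = 0) :
    ∃ i : R →ₗ⁅ℂ, sl3⁆ M, Function.Injective i ∧
      ∀ x, x ∈ i.range ↔ ∀ p : J', p.1 ∉ J → b.repr x p = 0 := by
  classical
  let g : R →ₗ[ℂ] M := r.constr ℂ fun p => b (Set.inclusion hJ p)
  have hg : ∀ p, g (r p) = b (Set.inclusion hJ p) := fun p => r.constr_basis ℂ _ p
  have h1 : ∀ x (q : J), b.repr (g x) (Set.inclusion hJ q) = r.repr x q := by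
    intro x q
    induction x using basis_induction r with
    | zero => simp
    | coe p =>
      rw [hg, Basis.repr_self, Basis.repr_self, Finsupp.single_apply, Finsupp.single_apply]
      simp only [(Set.inclusion_injective hJ).eq_iff]
    | smul c x hx => simp [hx]
    | add x y hx hy => simp [hx, hy]
  have h2 : ∀ x (q : J'), q.1 ∉ J → b.repr (g x) q = 0 := by
    intro x q hq
    induction x using basis_induction r with
    | zero => simp
    | coe p =>
      rw [hg, Basis.repr_self, Finsupp.single_eq_of_ne]
      rintro rfl
      exact hq p.2
    | smul c x hx => simp [hx]
    | add x y hx hy => simp [hx, hy]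
  have hlie : ∀ (X : sl3) (x : R), g ⁅X, x⁆ = ⁅X, g x⁆ := by
    intro X x
    induction x using basis_induction r with
    | zero => simp
    | coe p =>
      apply b.repr.injective
      ext q
      rw [hg, hb]
      by_cases hq : q.1 ∈ J
      · exact (h1 _ ⟨q, hq⟩).trans (hr X p ⟨q, hq⟩)
      · rw [h2 _ q hq, ← hA X p p.2 q q.2 hq]
    | smul c x hx => rw [lie_smul, map_smul, hx, map_smul, lie_smul]
    | add x y hx hy => rw [lie_add, map_add, hx, hy, map_add, lie_add]
  refine ⟨{ g with map_lie' := fun {X x} => hlie X x }, ?_, fun x => ?_⟩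
  · refine (injective_iff_map_eq_zero g).2 fun x hx => ?_
    apply r.repr.injective
    ext q
    rw [← h1, hx, map_zero, map_zero, Finsupp.zero_apply, Finsupp.zero_apply]
  · rw [LieModuleHom.mem_range]
    constructor
    · rintro ⟨y, rfl⟩ p hp
      exact h2 y p hp
    · intro hx
      have : x ∈ LinearMap.range g := by
        rw [← b.linearCombination_repr x, Finsupp.linearCombination_apply]
        refine sum_mem fun p hp => Submodule.smul_mem _ _ ?_
        have hpJ : p.1 ∈ J := by
          by_contra h
          exact Finsupp.mem_support_iff.1 hp (hx p h)
        exact ⟨r ⟨p, hpJ⟩, hg _⟩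
      exact this

end Inclusion

section Simple

variable {lam : Module.Dual ℂ cartan} {μ : ℂ} {M : Type}
  [AddCommGroup M] [Module ℂ M] [LieRingModule sl3 M] [LieModule ℂ sl3 M]

omit [LieModule ℂ sl3 M] in
theorem eq_top_of_ne_bot (hM : LieModule.IsIrreducible ℂ sl3 M) {N : LieSubmodule ℂ sl3 M}
    (h : N ≠ ⊥) : N = ⊤ :=
  (IsSimpleOrder.eq_bot_or_eq_top N).resolve_left h

theorem RVerma.exists_surjective_hom (hM : LieModule.IsIrreducible ℂ sl3 M) {v : M}
    (hv : IsTopVector lam μ v) (h0 : v ≠ 0) :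
    ∃ f : RVerma lam μ →ₗ⁅ℂ, sl3⁆ M, f (RVerma.gen lam μ) = v ∧ Function.Surjective f := by
  obtain ⟨f, hf⟩ := RVerma.exists_hom hv
  refine ⟨f, hf, ?_⟩
  have : f.range = ⊤ := by
    refine eq_top_of_ne_bot hM fun hbot => h0 ?_
    have : v ∈ f.range := (LieModuleHom.mem_range f v).2 ⟨_, hf⟩
    rwa [hbot, LieSubmodule.mem_bot] at this
  intro x
  have hx : x ∈ f.range := by rw [this]; trivial
  exact (LieModuleHom.mem_range f x).1 hx

omit [LieModule ℂ sl3 M] in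
-- If `maxSub` were not killed by `f`, its image would be all of `M`. It would then contain a vector
-- with the same image as the generator, hence the generator itself, as `f.ker` lies in `maxSub`.
theorem RVerma.ker_eq_maxSub (hM : LieModule.IsIrreducible ℂ sl3 M) {f : RVerma lam μ →ₗ⁅ℂ, sl3⁆ M}
    (hf : f (RVerma.gen lam μ) ≠ 0) (hmax : maxSub lam μ ≠ ⊤) : f.ker = maxSub lam μ := by
  have hle : f.ker ≤ maxSub lam μ := by
    refine le_sSup fun h => hf ?_
    rw [← LieModuleHom.mem_ker, h]
    trivial
  refine le_antisymm hle ?_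
  by_contra hc
  have htop : (maxSub lam μ).map f = ⊤ := by
    refine eq_top_of_ne_bot hM fun hbot => hc fun x hx => ?_
    rw [LieModuleHom.mem_ker, ← LieSubmodule.mem_bot (R := ℂ) (L := sl3), ← hbot]
    exact LieSubmodule.mem_map_of_mem hx
  have hmem : f (RVerma.gen lam μ) ∈ (maxSub lam μ).map f := by rw [htop]; trivial
  obtain ⟨y, hy, hyf⟩ := (LieSubmodule.mem_map _).1 hmem
  refine hmax (RVerma.eq_top_of_gen_mem ?_)
  rw [← sub_add_cancel (RVerma.gen lam μ) y]
  refine add_mem (hle ?_) hy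
  rw [LieModuleHom.mem_ker, map_sub, hyf, sub_self]

end Simple

/-! ### Comparison of the relaxed Verma modules with the subquotients of `M` -/

section Main

variable {μ₁ : ℂ} {μ₂ : ℤ} (hμ : ∀ n : ℤ, μ₁ + (μ₂ : ℂ) ≠ n)
  {lam lam' : Module.Dual ℂ cartan} {c : ℕ} {k k' : ℤ}
include hμ

/-- Stability of `l̄ ≤ c` in `M` means, contragrediently, that no arrow leaves `l̄ ≥ c + 1`, so the
relaxed Verma module of `lam'` embeds in that of `lam`. The image is maximal because the remaining
level `c` is connected and contains the generator. -/
theorem IsTopIndex.exists_embedding (hc : IsTopIndex μ₁ lam c k)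
    (hc' : IsTopIndex μ₁ lam' (c + 1) k') :
    maxSub lam μ₁ ≠ ⊤ ∧
    (∃ i : RVerma lam' μ₁ →ₗ⁅ℂ, sl3⁆ RVerma lam μ₁,
      Function.Injective i ∧ i.range = maxSub lam μ₁) ∧
    ∃ r : Basis {p : ℤ × ℤ × ℕ | μ₂ + c ≤ p.2.1} ℂ (RVerma lam μ₁),
      HasMatrix r (dualMatrix (wMatrix μ₁ μ₂)) ∧ IsEigenBasis r (wEig μ₁ μ₂) ∧
      ∀ x, x ∈ maxSub lam μ₁ ↔ ∀ p, p.1.2.1 = μ₂ + c → r.repr x p = 0 := by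
  obtain ⟨r, hr, hχ, hgen⟩ := hc.exists_basis hμ
  obtain ⟨r', hr', -, -⟩ := hc'.exists_basis hμ
  have hsub : {p : ℤ × ℤ × ℕ | μ₂ + ((c + 1 : ℕ) : ℤ) ≤ p.2.1} ⊆ {p | μ₂ + c ≤ p.2.1} := by
    intro p hp
    have hp' : μ₂ + ((c + 1 : ℕ) : ℤ) ≤ p.2.1 := hp
    change μ₂ + (c : ℤ) ≤ p.2.1
    push_cast at hp'
    omega
  -- From `c + 1 ≤ 2`, the top level `c` is one of the two from which no arrow leads upwards.
  have hst : IsStable μ₁ μ₂ {p | p.2.1 ≤ μ₂ + c} := by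
    have := hc'.le_two
    exact isStable_of (P := fun l => l ≤ μ₂ + c) hμ (by omega) (by omega)
  obtain ⟨i, hi, hrange⟩ := hr'.exists_inclusion hr hsub (by
    intro X p hp q hq hqp
    have hp' : μ₂ + ((c + 1 : ℕ) : ℤ) ≤ p.2.1 := hp
    have hqp' : ¬ μ₂ + ((c + 1 : ℕ) : ℤ) ≤ q.2.1 := hqp
    push_cast at hp' hqp'
    rw [dualMatrix, neg_eq_zero]
    by_contra hne
    have hmem : ⁅tau X, w μ₁ μ₂ q⁆ ∈ genSub μ₁ μ₂ {p | p.2.1 ≤ μ₂ + c} :=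
      LieSubmodule.lie_mem _ (LieSubmodule.subset_lieSpan
        ⟨q, show q.2.1 ≤ μ₂ + c by omega, rfl⟩)
    have : p.2.1 ≤ μ₂ + c := hst.mem_iff.1 hmem p hne
    omega)
  have hrange' : ∀ x, x ∈ i.range ↔ ∀ p, p.1.2.1 = μ₂ + c → r.repr x p = 0 := by
    intro x
    rw [hrange]
    refine forall_congr' fun p => ?_
    have hp : μ₂ + (c : ℤ) ≤ p.1.2.1 := p.2
    have : p.1 ∉ {p : ℤ × ℤ × ℕ | μ₂ + ((c + 1 : ℕ) : ℤ) ≤ p.2.1} ↔ p.1.2.1 = μ₂ + c := by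
      change ¬ μ₂ + ((c + 1 : ℕ) : ℤ) ≤ p.1.2.1 ↔ _
      push_cast
      omega
    rw [this]
  have hne : i.range ≠ ⊤ := by
    intro h
    have h0 := (hrange' (RVerma.gen lam μ₁)).1 (by rw [h]; trivial)
      ⟨(k, μ₂ + c, 0), le_refl (μ₂ + (c : ℤ))⟩ rfl
    rw [← hgen, Basis.repr_self, Finsupp.single_eq_same] at h0
    exact one_ne_zero h0
  have hmax : i.range = maxSub lam μ₁ := by
    refine le_antisymm (le_sSup hne) (sSup_le fun N hN x hx => ?_)
    rw [hrange']
    rintro ⟨⟨k₁, l₁, m₁⟩, hp⟩ hpc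
    -- A submodule with a component on the level `c` contains a basis vector there, from which the
    -- generator can be reached.
    by_contra h0
    refine hN (RVerma.eq_top_of_gen_mem ?_)
    have hl₁ : l₁ = μ₂ + c := hpc
    subst hl₁
    rw [← hgen]
    exact hχ.mem_of_reach hr
      (reach_of_l (P := fun l => μ₂ + c ≤ l) hμ (le_refl (μ₂ + (c : ℤ))) k k₁ 0 m₁).dual
      (hχ.basis_mem_of_repr hx h0)
  exact ⟨hmax ▸ hne, ⟨i, hi, hmax⟩, r, hr, hχ, fun x => hmax ▸ hrange' x⟩

/-- Applied to `LSimple` and also to `M_{l̄ = c}` viewed as a quotient; both then have the same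
matrix. -/
theorem IsTopIndex.exists_basis_quotient (hc : IsTopIndex μ₁ lam c k)
    (hc' : IsTopIndex μ₁ lam' (c + 1) k') {M : Type} [AddCommGroup M] [Module ℂ M]
    [LieRingModule sl3 M] [LieModule ℂ sl3 M] (f : RVerma lam μ₁ →ₗ⁅ℂ, sl3⁆ M)
    (hf : Function.Surjective f) (hker : ∀ x, f x = 0 ↔ x ∈ maxSub lam μ₁) :
    ∃ r : Basis {p : ℤ × ℤ × ℕ | p.2.1 = μ₂ + c} ℂ M,
      HasMatrix r (dualMatrix (wMatrix μ₁ μ₂)) ∧ IsEigenBasis r (wEig μ₁ μ₂) := by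
  obtain ⟨-, -, r, hr, hχ, hmax⟩ := hc.exists_embedding hμ hc'
  have hJ : {p : ℤ × ℤ × ℕ | p.2.1 = μ₂ + c} ⊆ {p | μ₂ + c ≤ p.2.1} := by
    intro p hp
    have hp' : p.2.1 = μ₂ + c := hp
    exact hp'.ge
  have hk : ∀ x, f x = 0 ↔ ∀ p : {p : ℤ × ℤ × ℕ | μ₂ + c ≤ p.2.1},
      p.1 ∈ {p : ℤ × ℤ × ℕ | p.2.1 = μ₂ + c} → r.repr x p = 0 :=
    fun x => (hker x).trans (hmax x)
  obtain ⟨s, hs, hsf⟩ := hr.exists_basis_of_surjective f hf hJ hk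
  refine ⟨s, hs, fun p => ?_, (wEig_injective hμ).injOn⟩
  rw [hsf p]
  exact map_mem_eig f (hχ.mem (Set.inclusion hJ p))

theorem IsTopIndex.exists_basis_LSimple (hc : IsTopIndex μ₁ lam c k)
    (hc' : IsTopIndex μ₁ lam' (c + 1) k') :
    ∃ r : Basis {p : ℤ × ℤ × ℕ | p.2.1 = μ₂ + c} ℂ (LSimple lam μ₁),
      HasMatrix r (dualMatrix (wMatrix μ₁ μ₂)) ∧ IsEigenBasis r (wEig μ₁ μ₂) :=
  hc.exists_basis_quotient hμ hc' (LieSubmodule.Quotient.mk' (maxSub lam μ₁))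
    (LieSubmodule.Quotient.surjective_mk' _) fun _ => LieSubmodule.Quotient.mk_eq_zero _

/-- The basis vector at the lowest value of `l̄` and `m = 0` satisfies the relations of the
generator of the relaxed Verma module. -/
theorem IsTopIndex.isTopVector_basis (hc : IsTopIndex μ₁ lam c k) {P : ℤ → Prop}
    (hP : P (μ₂ + c)) (hP' : ¬ P (μ₂ + c - 1)) {M : Type} [AddCommGroup M] [Module ℂ M]
    [LieRingModule sl3 M] [LieModule ℂ sl3 M]
    {b : Basis {p : ℤ × ℤ × ℕ | P p.2.1} ℂ M} (hb : HasMatrix b (wMatrix μ₁ μ₂))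
    (hχ : IsEigenBasis b (wEig μ₁ μ₂)) :
    IsTopVector lam μ₁ (b ⟨(k, μ₂ + c, 0), hP⟩) := by
  classical
  -- Indices on the level `c - 1` are excluded by `hP'`, so the downward terms of `f₁` and `e₂`
  -- disappear.
  have hlow : ∀ (k' : ℤ) (m : ℕ) (q : {p : ℤ × ℤ × ℕ | P p.2.1}),
      Finsupp.single (k', μ₂ + (c : ℤ) - 1, m) (1 : ℂ) q.1 = 0 := by
    rintro k' m ⟨⟨k₁, l₁, m₁⟩, hq⟩
    refine Finsupp.single_eq_of_ne fun h => hP' ?_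
    simp only [Prod.mk.injEq] at h
    rw [← h.2.1]
    exact hq
  have hrepr : ∀ (k' : ℤ) (q : {p : ℤ × ℤ × ℕ | P p.2.1}),
      b.repr (b ⟨(k', μ₂ + c, 0), hP⟩) q = Finsupp.single (k', μ₂ + (c : ℤ), 0) (1 : ℂ) q.1 := by
    intro k' q
    rw [Basis.repr_self, Finsupp.single_apply, Finsupp.single_apply]
    simp only [Subtype.ext_iff]
  have he1 : ∀ k', ⁅e1, b ⟨(k', μ₂ + c, 0), hP⟩⁆ =
      (-bar μ₁ k') • b ⟨(k' - 1, μ₂ + c, 0), hP⟩ := by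
    intro k'
    apply b.repr.injective
    ext q
    rw [hb, wMatrix_e1 hμ, map_smul, Finsupp.smul_apply, hrepr, Nat.cast_zero, mul_zero, zero_mul,
      add_zero, smul_eq_mul]
  have hf1 : ∀ k', ⁅f1, b ⟨(k', μ₂ + c, 0), hP⟩⁆ =
      (bar μ₁ k' * (bar μ₁ k' - 1) / (bar μ₁ k' + c - 1)) • b ⟨(k' + 1, μ₂ + c, 0), hP⟩ := by
    intro k'
    apply b.repr.injective
    ext q
    have h1 := wt_ne hμ k' (μ₂ + c)
    have h2 := wt_sub_one_ne hμ k' (μ₂ + c)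
    rw [hb, wMatrix_f1 hμ, map_smul, Finsupp.smul_apply, hrepr, hlow, mul_zero, zero_add,
      smul_eq_mul]
    rw [bar_int_add] at h1 h2 ⊢
    congr 1
    rw [Nat.cast_zero, zero_add]
    field_simp
  have he2 : ⁅e2, b ⟨(k, μ₂ + c, 0), hP⟩⁆ = 0 := by
    apply b.repr.injective
    ext q
    rw [hb, wMatrix_e2 hμ, hlow]
    simp
  have he12 : ⁅e12, b ⟨(k, μ₂ + c, 0), hP⟩⁆ = 0 := by
    apply b.repr.injective
    ext q
    rw [hb, wMatrix_e12 hμ]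
    simp
  refine hc.isTopVector hμ (hχ.mem ⟨(k, μ₂ + c, 0), hP⟩) ?_ he2 he12
  rw [he1, lie_smul, hf1, smul_smul]
  simp only [sub_add_cancel]
  rw [bar_sub_one, show bar μ₁ k - 1 + (c : ℂ) - 1 = bar μ₁ k + c - 2 by ring]
  congr 1
  ring

theorem IsTopIndex.isIrreducible_LSimple (hc : IsTopIndex μ₁ lam c k)
    (hc' : IsTopIndex μ₁ lam' (c + 1) k') : LieModule.IsIrreducible ℂ sl3 (LSimple lam μ₁) := by
  obtain ⟨r, hr, hχ⟩ := hc.exists_basis_LSimple hμ hc'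
  exact hχ.isIrreducible hr ⟨(k, μ₂ + c, 0), rfl⟩ fun p q => (reach_eq hμ _ q p).dual

/-- The subquotient is irreducible and contains a vector with the relations of the generator. So it
is the quotient of the relaxed Verma module by `maxSub`, and its matrix agrees with that of
`LSimple`. -/
theorem IsTopIndex.nonempty_equiv_LSimple (hc : IsTopIndex μ₁ lam c k)
    (hc' : IsTopIndex μ₁ lam' (c + 1) k') {J' J'' : Set (ℤ × ℤ × ℕ)}
    (h : Realizes μ₁ μ₂ J' J'' {p | p.2.1 = μ₂ + c}) :
    Nonempty (Subquot μ₁ μ₂ J' J'' ≃ₗ⁅ℂ, sl3⁆ LSimple lam μ₁) := by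
  obtain ⟨b, hb, hχ⟩ := h.exists_basis hμ
  have hirr : LieModule.IsIrreducible ℂ sl3 (Subquot μ₁ μ₂ J' J'') :=
    hχ.isIrreducible hb ⟨(k, μ₂ + c, 0), rfl⟩ (reach_eq hμ _)
  obtain ⟨f, hf, hsurj⟩ := RVerma.exists_surjective_hom hirr
    (hc.isTopVector_basis hμ (P := fun l => l = μ₂ + c) rfl (by omega) hb hχ) (b.ne_zero _)
  have hker := RVerma.ker_eq_maxSub hirr (f := f) (by rw [hf]; exact b.ne_zero _)
    (hc.exists_embedding hμ hc').1
  obtain ⟨s, hs, -⟩ := hc.exists_basis_quotient hμ hc' f hsurj fun x => by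
    rw [← hker, LieModuleHom.mem_ker]
  obtain ⟨r, hr, -⟩ := hc.exists_basis_LSimple hμ hc'
  exact hs.nonempty_equiv hr

theorem IsTopIndex.nonempty_equiv_dual_RVerma (hc : IsTopIndex μ₁ lam c k)
    {J' J'' : Set (ℤ × ℤ × ℕ)} (h : Realizes μ₁ μ₂ J' J'' {p | μ₂ + c ≤ p.2.1}) :
    Nonempty (Subquot μ₁ μ₂ J' J'' ≃ₗ⁅ℂ, sl3⁆ dual (RVerma lam μ₁)) := by
  obtain ⟨b, hb, -⟩ := h.exists_basis hμ
  obtain ⟨r, hr, hχ, -⟩ := hc.exists_basis hμ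
  exact hχ.nonempty_equiv_dual hb hr

/-- Self-duality passes through `M_{l̄ = c}`, which is isomorphic both to the simple quotient and,
by contragredient matrices, to its dual. -/
theorem IsTopIndex.nonempty_equiv_dual_LSimple (hc : IsTopIndex μ₁ lam c k)
    (hc' : IsTopIndex μ₁ lam' (c + 1) k') {J' J'' : Set (ℤ × ℤ × ℕ)}
    (h : Realizes μ₁ μ₂ J' J'' {p | p.2.1 = μ₂ + c}) :
    Nonempty (LSimple lam μ₁ ≃ₗ⁅ℂ, sl3⁆ dual (LSimple lam μ₁)) := by
  obtain ⟨b, hb, -⟩ := h.exists_basis hμ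
  obtain ⟨r, hr, hχ⟩ := hc.exists_basis_LSimple hμ hc'
  obtain ⟨e⟩ := hχ.nonempty_equiv_dual hb hr
  obtain ⟨e'⟩ := hc.nonempty_equiv_LSimple hμ hc' h
  exact ⟨e'.symm.trans e⟩

theorem IsTopIndex.isEigenSum_RVerma (hc : IsTopIndex μ₁ lam c k) :
    IsEigenSum (RVerma lam μ₁) := by
  obtain ⟨r, -, hχ, -⟩ := hc.exists_basis hμ
  exact hχ.isEigenSum

theorem IsTopIndex.isEigenSum_LSimple (hc : IsTopIndex μ₁ lam c k)
    (hc' : IsTopIndex μ₁ lam' (c + 1) k') : IsEigenSum (LSimple lam μ₁) := by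
  obtain ⟨r, -, hχ⟩ := hc.exists_basis_LSimple hμ hc'
  exact hχ.isEigenSum

/-- For `c = 2` the index set is `l̄ ≥ 2`, where no arrow degenerates. -/
theorem IsTopIndex.isIrreducible_RVerma (hc : IsTopIndex μ₁ lam 2 k) :
    LieModule.IsIrreducible ℂ sl3 (RVerma lam μ₁) := by
  obtain ⟨r, hr, hχ, -⟩ := hc.exists_basis hμ
  exact hχ.isIrreducible hr ⟨(k, μ₂ + 2, 0), le_refl (μ₂ + 2)⟩
    fun p q => (reach_ge hμ q p).dual

/-- A nonzero homomorphism between simple modules is an isomorphism, and the lowest level of `M_{l̄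
≥ 2}` provides one. -/
theorem IsTopIndex.nonempty_equiv_RVerma (hc : IsTopIndex μ₁ lam 2 k)
    {J' J'' : Set (ℤ × ℤ × ℕ)} (h : Realizes μ₁ μ₂ J' J'' {p | μ₂ + 2 ≤ p.2.1}) :
    Nonempty (Subquot μ₁ μ₂ J' J'' ≃ₗ⁅ℂ, sl3⁆ RVerma lam μ₁) := by
  obtain ⟨b, hb, hχ⟩ := h.exists_basis hμ
  have hirr : LieModule.IsIrreducible ℂ sl3 (Subquot μ₁ μ₂ J' J'') :=
    hχ.isIrreducible hb ⟨(k, μ₂ + 2, 0), le_refl (μ₂ + 2)⟩ (reach_ge hμ)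
  obtain ⟨f, hf, hsurj⟩ := RVerma.exists_surjective_hom hirr
    (hc.isTopVector_basis hμ (P := fun l => μ₂ + 2 ≤ l) (le_refl (μ₂ + 2))
      (by push_cast; omega) hb hχ) (b.ne_zero _)
  have hker : f.ker = ⊥ := by
    have := hc.isIrreducible_RVerma hμ
    by_contra hne
    have htop := eq_top_of_ne_bot this hne
    refine b.ne_zero ⟨(k, μ₂ + (2 : ℕ), 0), le_refl (μ₂ + 2)⟩ ?_
    rw [← hf, ← LieModuleHom.mem_ker, htop]
    trivial
  have hinj : Function.Injective f := by
    refine (injective_iff_map_eq_zero f).2 fun x hx => ?_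
    rwa [← LieModuleHom.mem_ker, hker, LieSubmodule.mem_bot] at hx
  exact ⟨(equivOfBijective f ⟨hinj, hsurj⟩).symm⟩

theorem IsTopIndex.maxSub_eq_bot (hc : IsTopIndex μ₁ lam 2 k) : maxSub lam μ₁ = ⊥ := by
  have := hc.isIrreducible_RVerma hμ
  refine sSup_eq_bot.2 fun N hN => ?_
  by_contra hne
  exact hN (eq_top_of_ne_bot this hne)

/-- The submodule divided out is zero, so the whole basis of the relaxed Verma module survives and
connectedness applies again. -/
theorem IsTopIndex.isIrreducible_LSimple_two (hc : IsTopIndex μ₁ lam 2 k) :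
    LieModule.IsIrreducible ℂ sl3 (LSimple lam μ₁) := by
  obtain ⟨r, hr, hχ, -⟩ := hc.exists_basis hμ
  obtain ⟨s, hs, hsf⟩ := hr.exists_basis_of_surjective
    (LieSubmodule.Quotient.mk' (maxSub lam μ₁))
    (LieSubmodule.Quotient.surjective_mk' _) subset_rfl fun x => by
      refine (LieSubmodule.Quotient.mk_eq_zero _).trans ?_
      rw [hc.maxSub_eq_bot hμ, LieSubmodule.mem_bot]
      constructor
      · rintro rfl p -
        simp
      · intro h
        apply r.repr.injective
        ext p
        rw [h p p.2, map_zero, Finsupp.zero_apply]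
  have hχs : IsEigenBasis s (wEig μ₁ μ₂) := by
    refine ⟨fun p => ?_, (wEig_injective hμ).injOn⟩
    rw [hsf]
    exact map_mem_eig _ (hχ.mem _)
  exact hχs.isIrreducible hs ⟨(k, μ₂ + 2, 0), le_refl (μ₂ + 2)⟩
    fun p q => (reach_ge hμ q p).dual

end Main

theorem realizes_of {μ₁ : ℂ} {μ₂ : ℤ} (hμ : ∀ n : ℤ, μ₁ + (μ₂ : ℂ) ≠ n) {P P' P'' : ℤ → Prop}
    (hdown : ∀ l, P' l → l ≠ μ₂ → P' (l - 1))
    (hup : ∀ l, P' l → l ≠ μ₂ → l ≠ μ₂ + 1 → P' (l + 1))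
    (hdown' : ∀ l, P'' l → l ≠ μ₂ → P'' (l - 1))
    (hup' : ∀ l, P'' l → l ≠ μ₂ → l ≠ μ₂ + 1 → P'' (l + 1))
    (h : ∀ l, (P'' l → P' l) ∧ (P l ↔ P' l ∧ ¬ P'' l)) :
    Realizes μ₁ μ₂ {p | P' p.2.1} {p | P'' p.2.1} {p | P p.2.1} :=
  ⟨isStable_of hμ hdown hup, isStable_of hμ hdown' hup', fun p => (h p.2.1).1,
    Set.ext fun p => (h p.2.1).2.symm⟩

end RelaxedSL3

end

open RelaxedSL3
theorem mainTheorem8 (μ₁ : ℂ) (μ₂ : ℤ) (hμ : ∀ n : ℤ, μ₁ + μ₂ ≠ n) :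
    -- the `w_{k,l,m}` form a basis of `M_{μ₁,μ₂}`
    (LinearIndependent ℂ (w μ₁ μ₂) ∧ Submodule.span ℂ (Set.range (w μ₁ μ₂)) = ⊤) ∧
    -- the subquotients in question exist
    (Realizes μ₁ μ₂ {p | μ₂ ≤ p.2.1} ∅ {p | μ₂ ≤ p.2.1} ∧
      Realizes μ₁ μ₂ Set.univ {p | p.2.1 ≤ μ₂} {p | μ₂ + 1 ≤ p.2.1} ∧
      Realizes μ₁ μ₂ {p | μ₂ ≤ p.2.1} {p | p.2.1 = μ₂} {p | μ₂ + 1 ≤ p.2.1} ∧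
      Realizes μ₁ μ₂ Set.univ {p | p.2.1 ≤ μ₂ + 1} {p | μ₂ + 2 ≤ p.2.1} ∧
      Realizes μ₁ μ₂ {p | p.2.1 = μ₂} ∅ {p | p.2.1 = μ₂} ∧
      Realizes μ₁ μ₂ {p | p.2.1 = μ₂ ∨ p.2.1 = μ₂ + 1} {p | p.2.1 = μ₂} {p | p.2.1 = μ₂ + 1}) ∧
    -- the duals of the modules below are defined
    (IsEigenSum (RVerma 0 μ₁) ∧ IsEigenSum (RVerma (-rho) μ₁) ∧
      IsEigenSum (RVerma (-(2 : ℂ) • alpha2) μ₁) ∧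
      IsEigenSum (LSimple 0 μ₁) ∧ IsEigenSum (LSimple (-rho) μ₁)) ∧
    -- `L_{𝔭₁,λ,μ₁}` is the simple quotient of `𝓡_{𝔭₁,λ,μ₁}`
    (LieModule.IsIrreducible ℂ sl3 (LSimple 0 μ₁) ∧
      LieModule.IsIrreducible ℂ sl3 (LSimple (-rho) μ₁) ∧
      LieModule.IsIrreducible ℂ sl3 (LSimple (-(2 : ℂ) • alpha2) μ₁)) ∧
    -- (1)
    (∀ J' J'', Realizes μ₁ μ₂ J' J'' {p | μ₂ ≤ p.2.1} →
      Nonempty (Subquot μ₁ μ₂ J' J'' ≃ₗ⁅ℂ, sl3⁆ dual (RVerma 0 μ₁))) ∧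
    -- (2)
    (∀ J' J'', Realizes μ₁ μ₂ J' J'' {p | μ₂ + 1 ≤ p.2.1} →
      Nonempty (Subquot μ₁ μ₂ J' J'' ≃ₗ⁅ℂ, sl3⁆ dual (RVerma (-rho) μ₁))) ∧
    -- (3)
    ((∀ J' J'', Realizes μ₁ μ₂ J' J'' {p | μ₂ + 2 ≤ p.2.1} →
        Nonempty (Subquot μ₁ μ₂ J' J'' ≃ₗ⁅ℂ, sl3⁆ RVerma (-(2 : ℂ) • alpha2) μ₁)) ∧
      maxSub (-(2 : ℂ) • alpha2) μ₁ = ⊥ ∧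
      LieModule.IsIrreducible ℂ sl3 (RVerma (-(2 : ℂ) • alpha2) μ₁) ∧
      Nonempty (RVerma (-(2 : ℂ) • alpha2) μ₁ ≃ₗ⁅ℂ, sl3⁆
        dual (RVerma (-(2 : ℂ) • alpha2) μ₁))) ∧
    -- (4)
    ((∀ J' J'', Realizes μ₁ μ₂ J' J'' {p | p.2.1 = μ₂} →
        Nonempty (Subquot μ₁ μ₂ J' J'' ≃ₗ⁅ℂ, sl3⁆ LSimple 0 μ₁)) ∧
      (∃ i : RVerma (-rho) μ₁ →ₗ⁅ℂ, sl3⁆ RVerma 0 μ₁,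
        Function.Injective i ∧ i.range = maxSub 0 μ₁) ∧
      Nonempty (LSimple 0 μ₁ ≃ₗ⁅ℂ, sl3⁆ dual (LSimple 0 μ₁))) ∧
    -- (5)
    ((∀ J' J'', Realizes μ₁ μ₂ J' J'' {p | p.2.1 = μ₂ + 1} →
        Nonempty (Subquot μ₁ μ₂ J' J'' ≃ₗ⁅ℂ, sl3⁆ LSimple (-rho) μ₁)) ∧
      (∃ i : RVerma (-(2 : ℂ) • alpha2) μ₁ →ₗ⁅ℂ, sl3⁆ RVerma (-rho) μ₁,
        Function.Injective i ∧ i.range = maxSub (-rho) μ₁) ∧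
      Nonempty (LSimple (-rho) μ₁ ≃ₗ⁅ℂ, sl3⁆ dual (LSimple (-rho) μ₁))) := by
  have r0 : Realizes μ₁ μ₂ {p | p.2.1 = μ₂} ∅ {p | p.2.1 = μ₂} :=
    realizes_of (P' := fun l => l = μ₂) (P'' := fun _ => False) (P := fun l => l = μ₂) hμ
      (by grind) (by grind) (by grind) (by grind) (by grind)
  have r1 : Realizes μ₁ μ₂ {p | p.2.1 = μ₂ ∨ p.2.1 = μ₂ + 1} {p | p.2.1 = μ₂}
      {p | p.2.1 = μ₂ + 1} :=
    realizes_of (P' := fun l => l = μ₂ ∨ l = μ₂ + 1) (P'' := fun l => l = μ₂)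
      (P := fun l => l = μ₂ + 1) hμ (by grind) (by grind) (by grind) (by grind) (by grind)
  have r2 : Realizes μ₁ μ₂ Set.univ {p | p.2.1 ≤ μ₂ + 1} {p | μ₂ + 2 ≤ p.2.1} :=
    realizes_of (P' := fun _ => True) (P'' := fun l => l ≤ μ₂ + 1) (P := fun l => μ₂ + 2 ≤ l) hμ
      (by grind) (by grind) (by grind) (by grind) (by grind)
  have i0 := isTopIndex_zero μ₁
  have i1 := isTopIndex_neg_rho μ₁
  have i2 := isTopIndex_neg_two_alpha2 μ₁
  -- The general lemmas write the level as `μ₂ + c` with `c` a natural number; for `c = 0` the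
  -- summand has to be removed.
  have hz : {p : ℤ × ℤ × ℕ | p.2.1 = μ₂ + ((0 : ℕ) : ℤ)} = {p | p.2.1 = μ₂} := by simp
  have hz' : {p : ℤ × ℤ × ℕ | μ₂ + ((0 : ℕ) : ℤ) ≤ p.2.1} = {p | μ₂ ≤ p.2.1} := by simp
  refine ⟨⟨linearIndependent_w μ₁ μ₂, span_w μ₁ μ₂⟩, ⟨?_, ?_, ?_, r2, r0, r1⟩,
    ⟨i0.isEigenSum_RVerma hμ, i1.isEigenSum_RVerma hμ, i2.isEigenSum_RVerma hμ,
      i0.isEigenSum_LSimple hμ i1, i1.isEigenSum_LSimple hμ i2⟩,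
    ⟨i0.isIrreducible_LSimple hμ i1, i1.isIrreducible_LSimple hμ i2,
      i2.isIrreducible_LSimple_two hμ⟩,
    fun J' J'' h => i0.nonempty_equiv_dual_RVerma hμ (hz'.symm ▸ h),
    fun J' J'' h => i1.nonempty_equiv_dual_RVerma hμ h,
    ⟨fun J' J'' h => i2.nonempty_equiv_RVerma hμ h, i2.maxSub_eq_bot hμ,
      i2.isIrreducible_RVerma hμ, ?_⟩,
    ⟨fun J' J'' h => i0.nonempty_equiv_LSimple hμ i1 (hz.symm ▸ h),
      (i0.exists_embedding hμ i1).2.1, i0.nonempty_equiv_dual_LSimple hμ i1 (hz.symm ▸ r0)⟩,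
    fun J' J'' h => i1.nonempty_equiv_LSimple hμ i2 h,
    (i1.exists_embedding hμ i2).2.1, i1.nonempty_equiv_dual_LSimple hμ i2 r1⟩
  · exact realizes_of (P' := fun l => μ₂ ≤ l) (P'' := fun _ => False) (P := fun l => μ₂ ≤ l) hμ
      (by grind) (by grind) (by grind) (by grind) (by grind)
  · exact realizes_of (P' := fun _ => True) (P'' := fun l => l ≤ μ₂) (P := fun l => μ₂ + 1 ≤ l) hμ
      (by grind) (by grind) (by grind) (by grind) (by grind)
  · exact realizes_of (P' := fun l => μ₂ ≤ l) (P'' := fun l => l = μ₂) (P := fun l => μ₂ + 1 ≤ l) hμ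
      (by grind) (by grind) (by grind) (by grind) (by grind)
  -- Self-duality again passes through `M`: both sides are isomorphic to `M_{l̄ ≥ 2}`.
  · obtain ⟨e⟩ := i2.nonempty_equiv_RVerma hμ r2
    obtain ⟨e'⟩ := i2.nonempty_equiv_dual_RVerma hμ r2
    exact ⟨e.symm.trans e'⟩
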